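/- A temporal graph $\mathcal G=(V,E,T,\alpha,\beta)$ consists of a lifetime $T\in\mathbb N$, a finite vertex set $V$, a set of time-arcs $E\subseteq V\times V\times\{1,\dots,T\}\times\{0,\dots,T\}$, where $(v,w,t,\lambda)\in E$ is an arc from $v$ to $w$ with time stamp $t$ and transmission time $\lambda$, and minimum and maximum waiting times $\alpha,\beta\colon V\to\{0,\dots,T\}$. A temporal walk from $s$ to $z$ is a sequence $P=((v_{i-1},v_i,t_i,\lambda_i))_{i=1}^k$, $k\ge 1$, of time-arcs $e_i=(v_{i-1},v_i,t_i,\lambda_i)\in E$ with $v_0=s$, $v_k=z$ and $t_i+\lambda_i+\alpha(v_i)\le t_{i+1}\le t_i+\lambda_i+\beta(v_i)$ for all $1\le i<k$. For a cost function $c\colon E\to\mathbb N$ and coefficients $\delta_1,\dots,\delta_7\in\mathbb Q_{\ge 0}$ let $$\begin{aligned}\mathrm{val}(P)={}&\delta_1(t_k+\lambda_k)+\delta_2(-t_1)+\delta_3(t_k+\lambda_k-t_1)+\delta_4\sum_{i=1}^k\lambda_i+\delta_5\sum_{i=1}^k c(e_i)\\&+\delta_6 k+\delta_7\sum_{i=1}^{k-1}\bigl(t_{i+1}-(t_i+\lambda_i)\bigr)\end{aligned}$$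 (the linear combination of the criteria foremost, reverse-foremost, fastest, shortest, cheapest, minimum hop-count and minimum waiting time). A temporal walk from $s$ to $z$ is optimal if it minimizes $\mathrm{val}$ among all temporal walks from $s$ to $z$. Theorem. There is an algorithm that, given any temporal graph $\mathcal G=(V,E,T,\alpha,\beta)$ with its time-arcs listed in an arbitrary order, any cost function $c\colon E\to\mathbb N$, any $\delta_1,\dots,\delta_7\in\mathbb Q_{\ge 0}$ and any source $s\in V$, computes in $O(|V|+|E|\log|E|)$ time, for every vertex $v\in V$, an optimal temporal walk from $s$ to $v$ together with its value $\mathrm{val}$, or reports that no temporal walk from $s$ to $v$ exists. The walks are output by means of a pointer to the last time-arc of the walk for each vertex $v$ and one predecessor pointer for each time-arc. The constant in the $O$-notation is absolute. The machine model is a random access machine with unit cost per elementary operation, on which indices can be added, subtracted, halved, compared and used as addresses, and rational numbers can be added, subtracted, multiplied and compared, and all memory outside the input is initially zero. -/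

import Mathlib

/-! ## Temporal graphs, temporal walks, optimality -/

/-- A time-arc `(src, dst, time, trans)`: a directed connection from `src` to `dst` that departs at
time step `time` and takes `trans` time steps. -/
structure TimeArc (V : Type*) where
  src : V
  dst : V
  time : ℕ
  trans : ℕ

/-- A temporal graph `(V, E, T, α, β)` with lifetime `T`, time-arc set
`E ⊆ V × V × {1, …, T} × {0, …, T}`, minimum waiting times `α : V → {0, …, T}` and maximum waiting
times `β : V → {0, …, T}`. -/
structure TemporalGraph (V : Type*) where
  T : ℕ
  E : Finset (TimeArc V)
  α : V → ℕ
  β : V → ℕ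
  one_le_time : ∀ e ∈ E, 1 ≤ e.time
  time_le : ∀ e ∈ E, e.time ≤ T
  trans_le : ∀ e ∈ E, e.trans ≤ T
  α_le : ∀ v, α v ≤ T
  β_le : ∀ v, β v ≤ T

namespace TemporalGraph

variable {V : Type*} (G : TemporalGraph V)

/-- The arc `f` may be taken directly after the arc `e`: it starts where `e` ends, and the time
spent in between respects the minimum and maximum waiting time of that vertex. -/
def Follows (e f : G.E) : Prop :=
  e.1.dst = f.1.src ∧
  e.1.time + e.1.trans + G.α e.1.dst ≤ f.1.time ∧
  f.1.time ≤ e.1.time + e.1.trans + G.β e.1.dst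

/-- `P` is a temporal walk from `s` to `z` (with at least one time-arc). -/
def IsWalk (s z : V) (P : List G.E) : Prop :=
  P.head?.map (fun e => e.1.src) = some s ∧
  P.getLast?.map (fun e => e.1.dst) = some z ∧
  P.IsChain G.Follows

variable {G}

/-- Departure time `t₁` of a walk (only used for nonempty lists). -/
def departure (P : List G.E) : ℚ := P.head?.elim 0 fun e => (e.1.time : ℚ)

/-- Arrival time `t_k + λ_k` of a walk (only used for nonempty lists). -/
def arrival (P : List G.E) : ℚ := P.getLast?.elim 0 fun e => (e.1.time : ℚ) + e.1.trans

/-- Total transmission time `∑ λ_i`. -/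
def transmission (P : List G.E) : ℚ := (P.map fun e => (e.1.trans : ℚ)).sum

/-- Total cost `∑ c(e_i)`. -/
def totalCost (c : G.E → ℕ) (P : List G.E) : ℚ := (P.map fun e => (c e : ℚ)).sum

/-- Total waiting time `∑_{i < k} (t_{i+1} - (t_i + λ_i))`. -/
def waiting (P : List G.E) : ℚ :=
  (List.zipWith (fun e f : G.E => (f.1.time : ℚ) - (e.1.time + e.1.trans)) P P.tail).sum

/-- The linear combination of foremost, reverse-foremost, fastest, shortest, cheapest,
minimum hop-count and minimum waiting time, in this order. -/
def val (c : G.E → ℕ) (δ : Fin 7 → ℚ≥0) (P : List G.E) : ℚ :=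
  δ 0 * arrival P
  + δ 1 * (-departure P)
  + δ 2 * (arrival P - departure P)
  + δ 3 * transmission P
  + δ 4 * totalCost c P
  + δ 5 * P.length
  + δ 6 * waiting P

variable (G) in
/-- `P` is an optimal temporal walk from `s` to `z`. -/
def IsOptimal (c : G.E → ℕ) (δ : Fin 7 → ℚ≥0) (s z : V) (P : List G.E) : Prop :=
  G.IsWalk s z P ∧ ∀ Q, G.IsWalk s z Q → val c δ P ≤ val c δ Q

end TemporalGraph

/-! ## The machine model

A random access machine with two kinds of data, programmed in a language with assignments,
conditionals and while-loops. *Indices* are natural numbers; they can be used as addresses, and can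
be added, subtracted (truncated), halved (rounding down) and compared. *Numbers* are rationals; they
can be added, subtracted, multiplied and compared, but not rounded or turned into addresses.
A program has (finitely many, by being finite) registers and arrays of each kind. Every elementary
operation costs one time unit. -/

namespace RAM

/-- Contents of index registers, number registers, index arrays and number arrays. -/
structure State where
  ireg : ℕ → ℕ
  nreg : ℕ → ℚ
  iarr : ℕ → ℕ → ℕ
  narr : ℕ → ℕ → ℚ

/-- Index expressions; `load a i` is the entry of array `a` at position `i`. -/
inductive IExp where
  | const (k : ℕ)
  | reg (x : ℕ)
  | load (a : ℕ) (i : IExp)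
  | add (e f : IExp)
  | sub (e f : IExp)
  | half (e : IExp)

/-- Number expressions. -/
inductive NExp where
  | const (q : ℚ)
  | reg (x : ℕ)
  | load (a : ℕ) (i : IExp)
  | add (e f : NExp)
  | sub (e f : NExp)
  | mul (e f : NExp)

/-- Tests. -/
inductive Test where
  | ilt (e f : IExp)
  | ieq (e f : IExp)
  | nlt (e f : NExp)
  | neq (e f : NExp)
  | neg (b : Test)
  | conj (b d : Test)

/-- Programs. -/
inductive Prog where
  | skip
  | setI (x : ℕ) (e : IExp)
  | setN (x : ℕ) (e : NExp)
  | storeI (a : ℕ) (i : IExp) (e : IExp)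
  | storeN (a : ℕ) (i : IExp) (e : NExp)
  | seq (p q : Prog)
  | cond (b : Test) (p q : Prog)
  | loop (b : Test) (p : Prog)

def IExp.eval (σ : State) : IExp → ℕ
  | const k => k
  | reg x => σ.ireg x
  | load a i => σ.iarr a (i.eval σ)
  | add e f => e.eval σ + f.eval σ
  | sub e f => e.eval σ - f.eval σ
  | half e => e.eval σ / 2

def IExp.cost : IExp → ℕ
  | const _ => 1
  | reg _ => 1
  | load _ i => i.cost + 1
  | add e f => e.cost + f.cost + 1
  | sub e f => e.cost + f.cost + 1
  | half e => e.cost + 1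

def NExp.eval (σ : State) : NExp → ℚ
  | const q => q
  | reg x => σ.nreg x
  | load a i => σ.narr a (i.eval σ)
  | add e f => e.eval σ + f.eval σ
  | sub e f => e.eval σ - f.eval σ
  | mul e f => e.eval σ * f.eval σ

def NExp.cost : NExp → ℕ
  | const _ => 1
  | reg _ => 1
  | load _ i => i.cost + 1
  | add e f => e.cost + f.cost + 1
  | sub e f => e.cost + f.cost + 1
  | mul e f => e.cost + f.cost + 1

def Test.holds (σ : State) : Test → Prop
  | ilt e f => e.eval σ < f.eval σ
  | ieq e f => e.eval σ = f.eval σ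
  | nlt e f => e.eval σ < f.eval σ
  | neq e f => e.eval σ = f.eval σ
  | neg b => ¬ b.holds σ
  | conj b d => b.holds σ ∧ d.holds σ

def Test.cost : Test → ℕ
  | ilt e f => e.cost + f.cost + 1
  | ieq e f => e.cost + f.cost + 1
  | nlt e f => e.cost + f.cost + 1
  | neq e f => e.cost + f.cost + 1
  | neg b => b.cost + 1
  | conj b d => b.cost + d.cost + 1

/-- `Runs p σ k τ`: started in state `σ`, the program `p` halts in state `τ` after `k` time
units. -/
inductive Runs : Prog → State → ℕ → State → Prop where
  | skip (σ : State) : Runs .skip σ 1 σ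
  | setI (x : ℕ) (e : IExp) (σ : State) :
      Runs (.setI x e) σ (e.cost + 1)
        { σ with ireg := Function.update σ.ireg x (e.eval σ) }
  | setN (x : ℕ) (e : NExp) (σ : State) :
      Runs (.setN x e) σ (e.cost + 1)
        { σ with nreg := Function.update σ.nreg x (e.eval σ) }
  | storeI (a : ℕ) (i e : IExp) (σ : State) :
      Runs (.storeI a i e) σ (i.cost + e.cost + 1)
        { σ with iarr :=
            Function.update σ.iarr a (Function.update (σ.iarr a) (i.eval σ) (e.eval σ)) }
  | storeN (a : ℕ) (i : IExp) (e : NExp) (σ : State) :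
      Runs (.storeN a i e) σ (i.cost + e.cost + 1)
        { σ with narr :=
            Function.update σ.narr a (Function.update (σ.narr a) (i.eval σ) (e.eval σ)) }
  | seq {p q : Prog} {σ τ ρ : State} {k l : ℕ} :
      Runs p σ k τ → Runs q τ l ρ → Runs (.seq p q) σ (k + l) ρ
  | condTrue {b : Test} {p q : Prog} {σ τ : State} {k : ℕ} :
      b.holds σ → Runs p σ k τ → Runs (.cond b p q) σ (b.cost + 1 + k) τ
  | condFalse {b : Test} {p q : Prog} {σ τ : State} {k : ℕ} :
      ¬ b.holds σ → Runs q σ k τ → Runs (.cond b p q) σ (b.cost + 1 + k) τ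
  | loopDone {b : Test} {p : Prog} {σ : State} :
      ¬ b.holds σ → Runs (.loop b p) σ (b.cost + 1) σ
  | loopStep {b : Test} {p : Prog} {σ τ ρ : State} {k l : ℕ} :
      b.holds σ → Runs p σ k τ → Runs (.loop b p) τ l ρ →
      Runs (.loop b p) σ (b.cost + 1 + k + l) ρ

end RAM

/-! ## Input and output of the single-source optimal walks problem -/

namespace OptWalks

open TemporalGraph

/-- The function `f`, extended by `0` beyond its domain. -/
def padded {R : Type*} [Zero R] {k : ℕ} (f : Fin k → R) (i : ℕ) : R :=
  if h : i < k then f ⟨i, h⟩ else 0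

/-- The state in which the input is presented. The vertices are `0, …, n - 1`, the time-arcs are
listed in an arbitrary order, `num i` being the arc at position `i`.
* Index registers `0, 1, 2` hold `|V|`, `|E|` and the source.
* Number register `0` holds the lifetime, number registers `1, …, 7` hold the coefficients.
* Index arrays `0, 1` hold the tails and heads of the arcs.
* Number arrays `0, 1, 2` hold the time stamps, transmission times and costs of the arcs.
* Number arrays `3, 4` hold the minimum and maximum waiting times of the vertices.

All other registers and array entries are zero. -/
def input {n : ℕ} (G : TemporalGraph (Fin n)) (num : Fin G.E.card ≃ G.E) (c : G.E → ℕ)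
    (δ : Fin 7 → ℚ≥0) (s : Fin n) : RAM.State where
  ireg
    | 0 => n
    | 1 => G.E.card
    | 2 => s
    | _ => 0
  nreg
    | 0 => G.T
    | x + 1 => padded (fun j => (δ j : ℚ)) x
  iarr
    | 0 => padded fun i => ((num i).1.src : ℕ)
    | 1 => padded fun i => ((num i).1.dst : ℕ)
    | _ => fun _ => 0
  narr
    | 0 => padded fun i => ((num i).1.time : ℚ)
    | 1 => padded fun i => ((num i).1.trans : ℚ)
    | 2 => padded fun i => (c (num i) : ℚ)
    | 3 => padded fun v => (G.α v : ℚ)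
    | 4 => padded fun v => (G.β v : ℚ)
    | _ => fun _ => 0

/-- `ReadOff num pred j P`: following the predecessor pointers `pred`, starting with pointer `j`,
yields the arc sequence `P` (from its last arc to its first). Pointer `i + 1` refers to the arc at
position `i`, pointer `0` is the null pointer. -/
inductive ReadOff {A : Type*} {m : ℕ} (num : Fin m → A) (pred : ℕ → ℕ) : ℕ → List A → Prop where
  | null : ReadOff num pred 0 []
  | arc (i : Fin m) (P : List A) :
      ReadOff num pred (pred i) P → ReadOff num pred (i + 1) (P ++ [num i])

/-- The state `τ` holds a solution: index array `2` holds for every vertex `v` a pointer to the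
last arc of an optimal walk from `s` to `v` (the null pointer if there is no walk), index array `3`
holds the predecessor pointers of the arcs, and number array `5` holds for every reachable `v` the
optimal value. -/
def IsSolution {n : ℕ} (G : TemporalGraph (Fin n)) (num : Fin G.E.card ≃ G.E) (c : G.E → ℕ)
    (δ : Fin 7 → ℚ≥0) (s : Fin n) (τ : RAM.State) : Prop :=
  ∀ v : Fin n,
    ((¬ ∃ P, G.IsWalk s v P) → τ.iarr 2 v = 0) ∧
    ((∃ P, G.IsWalk s v P) →
      ∃ P, ReadOff num (τ.iarr 3) (τ.iarr 2 v) P ∧ G.IsOptimal c δ s v P ∧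
        τ.narr 5 v = val c δ P)

end OptWalks

/-! The unknowns are attached to arcs, not to vertices: let `D f` be the least value of a walk from
the source whose last arc is `f`. Appending `f` to a walk of value `d` with last arc `e` gives the
value `d - rate * arr e + base f`, whatever the rest of the walk, because the departure term is
unaffected and the changes in arrival and waiting time involve only `e` and `f` (`val_concat`). So
`D f` is the minimum of `start f` and of `append (D e) e f` over the arcs `e` that `f` can follow.
Moreover this expression separates: the best predecessor is the one of least offset `D e - rate *
arr e`, independently of `f`. The possible predecessors enter the tail of `f` and arrive in a time
window, hence form an interval once the arcs are sorted by head and arrival time; a range minimum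
query finds the best one.

Departure times never decrease along a walk, so arcs are treated by time. Dependencies inside one
time step come only from arcs `e` with zero transmission time and zero minimum waiting time at their
head. There a Dijkstra argument applies, since appending an arc never lowers the value
(`Fol.le_append`). At each time step all arcs are first opened, that is, labelled from settled arcs
of earlier times or from the source; then labelled arcs are settled by increasing label, and each
settled arc of the above kind relaxes the block of arcs leaving its head at the same time.

A block is relaxed only once. All arcs that can relax it arrive at the same moment, and the first
one settled has the least label, so it dominates the later ones (`Inv.inactive`). Therefore every
arc is opened, settled and relaxed at most once. This gives at most `3 * m` steps, counted by
`Network.pot`, each of logarithmic cost because the queue and the range minima live in tournament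
trees with `m` leaves. The same trees do the sorting.

The invariant `Network.Inv` is preserved by `Inv.openArc`, `Inv.settle`, `Inv.improve` and
`Inv.advance`. At the end `Inv.final` supplies the inequalities of the recursion, which bound every
walk from below (`label_le_val`), while the predecessor pointers spell out walks attaining the
labels (`exists_walk_of_reach`).

Costs are handled by `Ter`: the time is at most the constant `Prog.weight` times a multiplicity `k`,
so one absolute constant covers the whole program, and only the multiplicities of loops have to be
estimated. -/

namespace RAM

/-! ## A cost-aware program logic -/

/-- The sum of the costs of all elementary operations occurring in a program. -/
def Prog.weight : Prog → ℕ
  | .skip => 1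
  | .setI _ e => e.cost + 1
  | .setN _ e => e.cost + 1
  | .storeI _ i e => i.cost + e.cost + 1
  | .storeN _ i e => i.cost + e.cost + 1
  | .seq p q => p.weight + q.weight
  | .cond b p q => b.cost + 1 + p.weight + q.weight
  | .loop b p => b.cost + 1 + p.weight

/-- Started in `σ`, the program `p` halts in a state satisfying `Q`, and every operation occurring
in `p` is executed at most `k` times on (weighted) average. -/
def Ter (p : Prog) (σ : State) (k : ℕ) (Q : State → Prop) : Prop :=
  ∃ c τ, Runs p σ c τ ∧ c ≤ p.weight * k ∧ Q τ

def State.setI (σ : State) (x v : ℕ) : State :=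
  { σ with ireg := Function.update σ.ireg x v }

def State.storeI (σ : State) (a i v : ℕ) : State :=
  { σ with iarr := Function.update σ.iarr a (Function.update (σ.iarr a) i v) }

def State.storeN (σ : State) (a i : ℕ) (v : ℚ) : State :=
  { σ with narr := Function.update σ.narr a (Function.update (σ.narr a) i v) }

section StateLemmas

variable (σ : State) (x v a i y : ℕ) (q : ℚ)

@[simp] theorem State.setI_ireg : (σ.setI x v).ireg y = if y = x then v else σ.ireg y := by
  simp [State.setI, Function.update_apply]
@[simp] theorem State.setI_nreg : (σ.setI x v).nreg = σ.nreg := rfl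
@[simp] theorem State.setI_iarr : (σ.setI x v).iarr = σ.iarr := rfl
@[simp] theorem State.setI_narr : (σ.setI x v).narr = σ.narr := rfl
@[simp] theorem State.storeI_ireg : (σ.storeI a i v).ireg = σ.ireg := rfl
@[simp] theorem State.storeI_iarr : (σ.storeI a i v).iarr y =
    if y = a then Function.update (σ.iarr a) i v else σ.iarr y := by
  by_cases h : y = a
  · subst h; simp [State.storeI]
  · simp [State.storeI, h]
@[simp] theorem State.storeI_nreg : (σ.storeI a i v).nreg = σ.nreg := rfl
@[simp] theorem State.storeI_narr : (σ.storeI a i v).narr = σ.narr := rfl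
@[simp] theorem State.storeN_ireg : (σ.storeN a i q).ireg = σ.ireg := rfl
@[simp] theorem State.storeN_nreg : (σ.storeN a i q).nreg = σ.nreg := rfl
@[simp] theorem State.storeN_iarr : (σ.storeN a i q).iarr = σ.iarr := rfl
@[simp] theorem State.storeN_narr : (σ.storeN a i q).narr y =
    if y = a then Function.update (σ.narr a) i q else σ.narr y := by
  by_cases h : y = a
  · subst h; simp [State.storeN]
  · simp [State.storeN, h]

end StateLemmas

theorem Ter.mono {p : Prog} {σ : State} {k k' : ℕ} {Q Q' : State → Prop} (h : Ter p σ k Q)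
    (hk : k ≤ k') (hQ : ∀ τ, Q τ → Q' τ) : Ter p σ k' Q' := by
  obtain ⟨c, τ, h1, h2, h3⟩ := h
  exact ⟨c, τ, h1, h2.trans (Nat.mul_le_mul_left _ hk), hQ _ h3⟩

theorem Ter.skip {σ : State} {k : ℕ} {Q : State → Prop} (hk : 1 ≤ k) (h : Q σ) :
    Ter .skip σ k Q :=
  ⟨1, σ, .skip σ, by simpa [Prog.weight] using hk, h⟩

theorem Ter.setI {σ : State} {k : ℕ} {Q : State → Prop} {x : ℕ} {e : IExp} (hk : 1 ≤ k)
    (h : Q (σ.setI x (e.eval σ))) : Ter (.setI x e) σ k Q :=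
  ⟨_, _, .setI x e σ, Nat.le_mul_of_pos_right _ hk, h⟩

theorem Ter.storeI {σ : State} {k : ℕ} {Q : State → Prop} {a : ℕ} {i e : IExp} (hk : 1 ≤ k)
    (h : Q (σ.storeI a (i.eval σ) (e.eval σ))) : Ter (.storeI a i e) σ k Q :=
  ⟨_, _, .storeI a i e σ, Nat.le_mul_of_pos_right _ hk, h⟩

theorem Ter.storeN {σ : State} {k : ℕ} {Q : State → Prop} {a : ℕ} {i : IExp} {e : NExp}
    (hk : 1 ≤ k) (h : Q (σ.storeN a (i.eval σ) (e.eval σ))) : Ter (.storeN a i e) σ k Q :=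
  ⟨_, _, .storeN a i e σ, Nat.le_mul_of_pos_right _ hk, h⟩

/-- Weights add under composition, so one multiplicity serves both parts and no constants
accumulate. -/
theorem Ter.seq {σ : State} {k : ℕ} {Q : State → Prop} {p q : Prog}
    (h : Ter p σ k fun τ => Ter q τ k Q) : Ter (.seq p q) σ k Q := by
  obtain ⟨c, τ, h1, h2, c', ρ, h3, h4, h5⟩ := h
  refine ⟨_, _, .seq h1 h3, ?_, h5⟩
  simp only [Prog.weight, add_mul]
  omega

theorem Ter.cond {σ : State} {k : ℕ} {Q : State → Prop} {b : Test} {p q : Prog} (hk : 1 ≤ k)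
    (hp : b.holds σ → Ter p σ k Q) (hq : ¬ b.holds σ → Ter q σ k Q) :
    Ter (.cond b p q) σ k Q := by
  have e := Nat.le_mul_of_pos_right (b.cost + 1) hk
  by_cases h : b.holds σ
  · obtain ⟨c, τ, h1, h2, h3⟩ := hp h
    refine ⟨_, _, .condTrue h h1, ?_, h3⟩
    simp only [Prog.weight, add_mul] at *
    omega
  · obtain ⟨c, τ, h1, h2, h3⟩ := hq h
    refine ⟨_, _, .condFalse h h1, ?_, h3⟩
    simp only [Prog.weight, add_mul] at *
    omega

/-- The loop rule; the potential `n` pays for the iterations. -/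
theorem Ter.loop {b : Test} {p : Prog} {k : ℕ} {Q : State → Prop} (I : ℕ → State → Prop)
    (hstep : ∀ n σ, I n σ → b.holds σ →
      ∃ n' u, 1 ≤ u ∧ n' + u ≤ n ∧ Ter p σ u (I n'))
    (hdone : ∀ n σ, I n σ → ¬ b.holds σ → Q σ) {σ : State} {n : ℕ} (h : I n σ) (hk : n + 1 ≤ k) :
    Ter (.loop b p) σ k Q := by
  refine Ter.mono (k := n + 1) (Q := Q) ?_ hk fun _ => id
  clear hk
  induction n using Nat.strong_induction_on generalizing σ with
  | _ n ih =>
    by_cases hb : b.holds σ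
    · obtain ⟨n', u, hu, hn, c, τ, h1, h2, h3⟩ := hstep n σ h hb
      obtain ⟨c', ρ, h4, h5, h6⟩ := ih n' (by omega) h3
      refine ⟨_, _, .loopStep hb h1 h4, ?_, h6⟩
      have e := Nat.le_mul_of_pos_right (b.cost + 1) hu
      have e2 : (b.cost + 1 + p.weight) * (u + (n' + 1)) ≤ (b.cost + 1 + p.weight) * (n + 1) :=
        Nat.mul_le_mul_left _ (by omega)
      simp only [Prog.weight, add_mul, mul_add] at *
      omega
    · refine ⟨_, _, .loopDone hb, ?_, hdone n σ h hb⟩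
      have e := Nat.le_mul_of_pos_right (b.cost + 1 + p.weight) (Nat.add_pos_right n one_pos)
      simp only [Prog.weight]
      omega

/-- Sequential composition of a list of programs. -/
def block : List Prog → Prog
  | [] => .skip
  | p :: ps => .seq p (block ps)

theorem Ter.cons {σ : State} {k : ℕ} {Q : State → Prop} {p : Prog} {ps : List Prog}
    (h : Ter p σ k fun τ => Ter (block ps) τ k Q) : Ter (block (p :: ps)) σ k Q :=
  Ter.seq h

theorem Ter.nil {σ : State} {k : ℕ} {Q : State → Prop} (hk : 1 ≤ k) (h : Q σ) :
    Ter (block []) σ k Q :=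
  Ter.skip hk h

/-! ### Lexicographic comparison of keys -/

/-- Disjunction of tests. -/
def Test.or (b d : Test) : Test := .neg (.conj (.neg b) (.neg d))

@[simp] theorem Test.or_holds (σ : State) (b d : Test) :
    (Test.or b d).holds σ ↔ b.holds σ ∨ d.holds σ := by
  simp only [Test.or, Test.holds]; tauto

/-- A component of a lexicographic sort key of the items whose numbers are in registers `21` and
`22`. -/
structure Column where
  lt : Test
  eq : Test
  val : State → ℕ → ℚ
  lt_iff : ∀ σ, lt.holds σ ↔ val σ (σ.ireg 21) < val σ (σ.ireg 22)
  eq_iff : ∀ σ, eq.holds σ ↔ val σ (σ.ireg 21) = val σ (σ.ireg 22)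

/-- Lexicographic comparison. -/
def lexTest : List Column → Test
  | [] => .ilt (.const 0) (.const 0)
  | c :: cs => .or c.lt (.conj c.eq (lexTest cs))

theorem lexTest_holds (cs : List Column) (σ : State) :
    (lexTest cs).holds σ ↔
      cs.map (fun c => c.val σ (σ.ireg 21)) < cs.map (fun c => c.val σ (σ.ireg 22)) := by
  induction cs with
  | nil => simp [lexTest, Test.holds]
  | cons c cs ih =>
    simp only [lexTest, Test.or_holds, Test.holds, ih, c.lt_iff, c.eq_iff, List.map_cons,
      List.cons_lt_cons_iff]

/-! ## Tournament trees -/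

section Tree

variable {K : Type*} [LinearOrder K]

/-- Node `j` of the tree `t` holds a winner among the two children of `j`. -/
def NodeOk (t : ℕ → ℕ) (key : ℕ → K) (j : ℕ) : Prop :=
  (t j = t (2 * j) ∨ t j = t (2 * j + 1)) ∧ key (t j) ≤ key (t (2 * j)) ∧
    key (t j) ≤ key (t (2 * j + 1))

/-- `t` is a tournament tree with `m` leaves, stored in heap order, leaf `i` holding `leaf i`. -/
def IsTree (m : ℕ) (t : ℕ → ℕ) (key : ℕ → K) (leaf : ℕ → ℕ) : Prop :=
  (∀ i < m, t (m + i) = leaf i) ∧ ∀ j, 1 ≤ j → j < m → NodeOk t key j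

variable {m : ℕ} {t : ℕ → ℕ} {key : ℕ → K} {leaf : ℕ → ℕ}

/-- Keys do not increase on the way from a node `x` to its parent `x / 2`. The number of leaves need
not be a power of two: every node from `1` to `m - 1` has both children below `2 * m`. -/
theorem IsTree.root_le (h : IsTree m t key leaf) {i : ℕ} (hi : i < m) :
    key (t 1) ≤ key (leaf i) := by
  have aux : ∀ x, 1 ≤ x → x < 2 * m → key (t 1) ≤ key (t x) := by
    intro x
    induction x using Nat.strong_induction_on with
    | _ x ih =>
      intro h1 h2
      rcases Nat.eq_or_lt_of_le h1 with rfl | h3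
      · exact le_rfl
      · refine (ih (x / 2) (by omega) (by omega) (by omega)).trans ?_
        have := (h.2 (x / 2) (by omega) (by omega)).2
        rcases Nat.even_or_odd' x with ⟨y, rfl | rfl⟩
        · rw [show 2 * y / 2 = y by omega] at *; exact this.1
        · rw [show (2 * y + 1) / 2 = y by omega] at *; exact this.2
  rw [← h.1 i hi]
  exact aux _ (by omega) (by omega)

/-- Descending to the child that supplied the winner ends in a leaf. The last clause records that
this leaf lies below `j`, which confines the effect of a key change to one path. -/
theorem IsTree.exists_leaf (h : IsTree m t key leaf) {j : ℕ} (h1 : 1 ≤ j) (h2 : j < 2 * m) :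
    ∃ i < m, t j = leaf i ∧ ∃ k, (m + i) / 2 ^ k = j := by
  obtain ⟨d, hd⟩ : ∃ d, d = 2 * m - j := ⟨_, rfl⟩
  induction d using Nat.strong_induction_on generalizing j with
  | _ d ih =>
    by_cases hj : m ≤ j
    · exact ⟨j - m, by omega, by rw [← h.1 _ (by omega)]; congr 1; omega, 0, by simp; omega⟩
    · have key : ∀ c, c / 2 = j → t j = t c → c < 2 * m →
          ∃ i < m, t j = leaf i ∧ ∃ k, (m + i) / 2 ^ k = j := by
        intro c hc ht hcm
        obtain ⟨i, hi, e, k, hk⟩ := ih (2 * m - c) (by omega) (by omega) hcm rfl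
        exact ⟨i, hi, ht.trans e, k + 1, by rw [pow_succ, ← Nat.div_div_eq_div_mul, hk, hc]⟩
      rcases (h.2 j h1 (by omega)).1 with e | e
      · exact key _ (by omega) e (by omega)
      · exact key _ (by omega) e (by omega)

/-- `t` is a tournament tree except possibly at the proper ancestors of node `x`. -/
def IsTreeExcept (m : ℕ) (t : ℕ → ℕ) (key : ℕ → K) (leaf : ℕ → ℕ) (x : ℕ) : Prop :=
  (∀ i < m, t (m + i) = leaf i) ∧
    ∀ j, 1 ≤ j → j < m → NodeOk t key j ∨ ∃ k, x / 2 ^ (k + 1) = j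

/-- A changed key matters only at nodes where the item, or a child holding it, takes part in the
comparison. By `exists_leaf` and injectivity of `leaf`, a node holding the item is on the path from
its leaf to the root. -/
theorem IsTree.except (h : IsTree m t key leaf) {key' : ℕ → K} {i : ℕ} (hi : i < m)
    (inj : ∀ i < m, ∀ j < m, leaf i = leaf j → i = j)
    (hk : ∀ j, j ≠ leaf i → key' j = key j) : IsTreeExcept m t key' leaf (m + i) := by
  refine ⟨h.1, fun j h1 h2 => ?_⟩
  by_cases hx : t j = leaf i ∨ t (2 * j) = leaf i ∨ t (2 * j + 1) = leaf i
  · right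
    have aux : ∀ c, 1 ≤ c → c < 2 * m → t c = leaf i → ∃ k, (m + i) / 2 ^ k = c := by
      intro c h1 h2 hc
      obtain ⟨i', hi', e, hk⟩ := h.exists_leaf h1 h2
      rwa [← inj _ hi' _ hi (e.symm.trans hc)]
    have aux2 : ∀ c, c / 2 = j → c < 2 * m → t c = leaf i → ∃ k, (m + i) / 2 ^ (k + 1) = j := by
      intro c h1 h2 hc
      obtain ⟨k, hk⟩ := aux c (by omega) h2 hc
      exact ⟨k, by rw [pow_succ, ← Nat.div_div_eq_div_mul, hk, h1]⟩
    rcases hx with e | e | e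
    · obtain ⟨k, hk⟩ := aux j h1 (by omega) e
      -- With `k = 0` the internal node `j` would be the leaf `m + i`.
      obtain _ | k := k
      · simp at hk; omega
      · exact ⟨k, hk⟩
    · exact aux2 _ (by omega) (by omega) e
    · exact aux2 _ (by omega) (by omega) e
  · push Not at hx
    left
    rw [NodeOk, hk _ hx.1, hk _ hx.2.1, hk _ hx.2.2]
    exact h.2 j h1 h2

end Tree

/-! ### Tournament trees on the machine -/

/-- A tournament tree in memory: the index array `arr` holds the nodes; `test` compares the keys of
the items whose numbers are in registers `21` and `22`. -/
structure Tournament where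
  arr : ℕ
  test : Test
  key : State → ℕ → List ℚ
  holds_iff : ∀ σ, test.holds σ ↔ key σ (σ.ireg 21) < key σ (σ.ireg 22)
  key_congr : ∀ σ τ : State, (∀ a, a ≠ arr → τ.iarr a = σ.iarr a) → τ.narr = σ.narr →
    key τ = key σ

/-- `τ` agrees with `σ` up to array `a` and the scratch registers `20, 21, …`. -/
structure SameBut (a : ℕ) (σ τ : State) : Prop where
  iarr : ∀ b, b ≠ a → τ.iarr b = σ.iarr b
  narr : τ.narr = σ.narr
  nreg : τ.nreg = σ.nreg
  ireg : ∀ r < 20, τ.ireg r = σ.ireg r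

theorem SameBut.trans {a : ℕ} {σ τ ρ : State} (h : SameBut a σ τ) (h' : SameBut a τ ρ) :
    SameBut a σ ρ :=
  ⟨fun b hb => (h'.iarr b hb).trans (h.iarr b hb), h'.narr.trans h.narr, h'.nreg.trans h.nreg,
    fun r hr => (h'.ireg r hr).trans (h.ireg r hr)⟩

namespace Tournament

variable (T : Tournament)

theorem key_same {T : Tournament} {σ τ : State} (h : SameBut T.arr σ τ) : T.key τ = T.key σ :=
  T.key_congr σ τ h.iarr h.narr

@[simp] theorem key_setI (σ : State) (x v : ℕ) : T.key (σ.setI x v) = T.key σ :=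
  T.key_congr σ (σ.setI x v) (fun _ _ => rfl) rfl

/-- Recompute the node in register `20` from its children. -/
def pull : Prog := block [
  .setI 21 (.load T.arr (.add (.reg 20) (.reg 20))),
  .setI 22 (.load T.arr (.add (.add (.reg 20) (.reg 20)) (.const 1))),
  .cond T.test (.storeI T.arr (.reg 20) (.reg 21)) (.storeI T.arr (.reg 20) (.reg 22))]

theorem pull_ter (σ : State) {k : ℕ} (hk : 1 ≤ k) :
    Ter T.pull σ k fun τ => SameBut T.arr σ τ ∧ τ.ireg 20 = σ.ireg 20 ∧
      ∃ w, τ.iarr T.arr = Function.update (σ.iarr T.arr) (σ.ireg 20) w ∧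
        (w = σ.iarr T.arr (2 * σ.ireg 20) ∨ w = σ.iarr T.arr (2 * σ.ireg 20 + 1)) ∧
        T.key σ w ≤ T.key σ (σ.iarr T.arr (2 * σ.ireg 20)) ∧
        T.key σ w ≤ T.key σ (σ.iarr T.arr (2 * σ.ireg 20 + 1)) := by
  refine Ter.cons (Ter.setI hk (Ter.cons (Ter.setI hk (Ter.cons (Ter.cond hk ?_ ?_)))))
  all_goals
    intro h
    rw [T.holds_iff] at h
    simp only [key_setI, IExp.eval, State.setI_ireg, State.setI_iarr, ← two_mul] at h
    norm_num at h
    refine Ter.storeI hk (Ter.nil hk ⟨⟨?_, rfl, rfl, ?_⟩, ?_, ?_⟩)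
    · intro b hb; simp [hb]
    · intro r hr; simp; rw [if_neg (by omega), if_neg (by omega)]
    · simp
  · refine ⟨σ.iarr T.arr (2 * σ.ireg 20), ?_, .inl rfl, le_rfl, h.le⟩
    simp [IExp.eval, ← two_mul]
  · refine ⟨σ.iarr T.arr (2 * σ.ireg 20 + 1), ?_, .inr rfl, h, le_rfl⟩
    simp [IExp.eval, ← two_mul]

/-- Restore the tournament tree after the key of its leaf at position `e` has changed. -/
def refresh (e : IExp) : Prog := block [
  .setI 20 (.add (.reg 1) e),
  .loop (.ilt (.const 1) (.reg 20)) (block [.setI 20 (.half (.reg 20)), T.pull])]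

theorem refresh_ter {σ : State} {k m i : ℕ} {leaf : ℕ → ℕ} {e : IExp} {key₀ : ℕ → List ℚ}
    (hm : σ.ireg 1 = m) (he : e.eval σ = i) (hi : i < m) (hk : 2 * m < 2 ^ k)
    (ht : IsTree m (σ.iarr T.arr) key₀ leaf)
    (inj : ∀ i < m, ∀ j < m, leaf i = leaf j → i = j)
    (hkey : ∀ j, j ≠ leaf i → T.key σ j = key₀ j) :
    Ter (T.refresh e) σ (k + 1) fun τ =>
      SameBut T.arr σ τ ∧ IsTree m (τ.iarr T.arr) (T.key τ) leaf := by
  have h1 : 1 ≤ k + 1 := by omega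
  refine Ter.cons (Ter.setI h1 (Ter.cons ?_))
  -- The measure `n` bounds the number of binary digits of the current node, so the root is reached
  -- after at most `k` halvings. Defects are confined to the proper ancestors of the current node,
  -- and the root has none.
  refine Ter.loop (fun n τ => SameBut T.arr σ τ ∧ τ.ireg 20 < 2 ^ n ∧ 1 ≤ τ.ireg 20 ∧
    τ.ireg 20 < 2 * m ∧ IsTreeExcept m (τ.iarr T.arr) (T.key τ) leaf (τ.ireg 20)) ?_ ?_
    (n := k) ?_ le_rfl
  · rintro (_ | n) τ ⟨hs, hn, hp, hp2, hx⟩ hb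
    · simp at hn; omega
    refine ⟨n, 1, le_rfl, le_rfl, Ter.cons (Ter.setI le_rfl (Ter.cons ?_))⟩
    simp only [Test.holds, IExp.eval] at hb
    generalize hj : τ.ireg 20 = j at *
    refine (T.pull_ter _ le_rfl).mono le_rfl ?_
    rintro ρ ⟨hs', hr, w, hw, hw1, hw2, hw3⟩
    refine Ter.nil le_rfl ?_
    simp [IExp.eval, hj] at hr hw hw1 hw2 hw3
    have hs2 : SameBut T.arr τ ρ :=
      ⟨by intro b hb; rw [hs'.iarr b hb]; rfl, hs'.narr, hs'.nreg,
        by intro r hr; rw [hs'.ireg r hr]; simp; omega⟩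
    refine ⟨hs.trans hs2, ?_, ?_, ?_, ?_, ?_⟩
    · rw [hr]; rw [pow_succ] at hn; omega
    · omega
    · omega
    · intro i hi
      rw [hw, Function.update_of_ne (by omega)]
      exact hx.1 i hi
    · intro l hl1 hl2
      rw [key_same hs2, hr]
      by_cases hlj : l = j / 2
      · left
        subst hlj
        simp only [NodeOk, hw, Function.update_self]
        rw [Function.update_of_ne (by omega), Function.update_of_ne (by omega)]
        exact ⟨hw1, hw2, hw3⟩
      -- The parent of the recomputed node has a changed child; it joins the remaining exceptions,
      -- as an ancestor of the new current node.
      · by_cases hlc : l = j / 2 / 2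
        · right; exact ⟨0, by simp [hlc]⟩
        · rcases hx.2 l hl1 hl2 with h | ⟨c, hc⟩
          · left
            simp only [NodeOk, hw]
            rw [Function.update_of_ne hlj, Function.update_of_ne (by omega),
              Function.update_of_ne (by omega)]
            exact h
          · right
            obtain _ | c := c
            · simp at hc; omega
            · exact ⟨c, by rw [← hc, Nat.div_div_eq_div_mul, ← pow_succ']⟩
  · rintro n τ ⟨hs, -, hp, -, hx⟩ hb
    refine Ter.nil h1 ⟨hs, hx.1, fun j hj1 hj2 => ?_⟩
    simp only [Test.holds, IExp.eval] at hb
    have e1 : τ.ireg 20 = 1 := by omega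
    rcases hx.2 j hj1 hj2 with h | ⟨c, hc⟩
    · exact h
    · rw [e1, Nat.div_eq_of_lt (Nat.one_lt_two_pow (by omega))] at hc
      omega
  · simp only [IExp.eval, he, hm]
    refine ⟨⟨fun _ _ => rfl, rfl, rfl, ?_⟩, ?_, ?_, ?_, ?_⟩
    · intro r hr; simp; omega
    · simp; omega
    · simp; omega
    · simp; omega
    · simp only [key_setI]
      simp only [State.setI_ireg, if_true]
      exact ht.except hi inj hkey

/-- Build a tournament tree, the leaf at the position in register `23` being given by `e`. -/
def build (e : IExp) : Prog := block [
  .setI 23 (.const 0),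
  .loop (.ilt (.reg 23) (.reg 1)) (block [
    .storeI T.arr (.add (.reg 1) (.reg 23)) e,
    .setI 23 (.add (.reg 23) (.const 1))]),
  .setI 20 (.reg 1),
  .loop (.ilt (.const 1) (.reg 20)) (block [.setI 20 (.sub (.reg 20) (.const 1)), T.pull])]

theorem build_ter {σ : State} {m : ℕ} {leaf : ℕ → ℕ} {e : IExp}
    (hm : σ.ireg 1 = m)
    (he : ∀ τ, SameBut T.arr σ τ → τ.ireg 23 < m → e.eval τ = leaf (τ.ireg 23)) :
    Ter (T.build e) σ (m + 1) fun τ =>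
      SameBut T.arr σ τ ∧ IsTree m (τ.iarr T.arr) (T.key τ) leaf := by
  have h1 : 1 ≤ m + 1 := by omega
  refine Ter.cons (Ter.setI h1 (Ter.cons ?_))
  refine Ter.loop (fun n τ => SameBut T.arr σ τ ∧ n + τ.ireg 23 = m ∧
    ∀ i < τ.ireg 23, τ.iarr T.arr (m + i) = leaf i) ?_ ?_ (n := m) ?_ le_rfl
  · rintro n τ ⟨hs, hn, hx⟩ hb
    simp only [Test.holds, IExp.eval, hs.ireg 1 (by omega), hm] at hb
    refine ⟨n - 1, 1, le_rfl, by omega, Ter.cons (Ter.storeI le_rfl (Ter.cons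
      (Ter.setI le_rfl (Ter.nil le_rfl ?_))))⟩
    simp only [he τ hs hb]
    refine ⟨⟨?_, hs.narr, hs.nreg, ?_⟩, ?_, ?_⟩
    · intro b hb; simp [hb, hs.iarr b hb]
    · intro r hr; simp [hs.ireg r hr]; omega
    · simp [IExp.eval]; omega
    · simp only [IExp.eval, State.setI_iarr, State.storeI_iarr, State.setI_ireg, if_true,
        State.storeI_ireg, hs.ireg 1 (by omega), hm]
      intro i hi
      by_cases hi' : i = τ.ireg 23
      · simp [hi']
      · rw [Function.update_of_ne (by omega)]
        exact hx i (by omega)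
  · rintro n τ ⟨hs, hn, hx⟩ hb
    simp only [Test.holds, IExp.eval, hs.ireg 1 (by omega), hm] at hb
    refine Ter.cons (Ter.setI h1 (Ter.cons ?_))
    -- Internal nodes are computed in decreasing order, so the children `2 * j` and `2 * j + 1` are
    -- final when `j` is computed.
    refine Ter.loop (fun n τ => SameBut T.arr σ τ ∧ τ.ireg 20 = n ∧ n ≤ m ∧
      (∀ i < m, τ.iarr T.arr (m + i) = leaf i) ∧
      ∀ j, 1 ≤ j → n ≤ j → j < m → NodeOk (τ.iarr T.arr) (T.key τ) j) ?_ ?_ (n := m) ?_ le_rfl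
    · rintro n τ ⟨hs, hn, hnm, hl, hx⟩ hb
      simp only [Test.holds, IExp.eval, hn] at hb
      refine ⟨n - 1, 1, le_rfl, by omega, Ter.cons (Ter.setI le_rfl (Ter.cons ?_))⟩
      refine (T.pull_ter _ le_rfl).mono le_rfl ?_
      rintro ρ ⟨hs', hr, w, hw, hw1, hw2, hw3⟩
      refine Ter.nil le_rfl ?_
      simp [IExp.eval, hn] at hr hw hw1 hw2 hw3
      have hs2 : SameBut T.arr τ ρ :=
        ⟨by intro b hb; rw [hs'.iarr b hb]; rfl, hs'.narr, hs'.nreg,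
          by intro r hr; rw [hs'.ireg r hr]; simp; omega⟩
      refine ⟨hs.trans hs2, hr, by omega, ?_, ?_⟩
      · intro i hi
        rw [hw, Function.update_of_ne (by omega)]
        exact hl i hi
      · intro j h1 h2 h3
        rw [key_same hs2]
        simp only [NodeOk, hw]
        rw [Function.update_of_ne (a := 2 * j) (by omega),
          Function.update_of_ne (a := 2 * j + 1) (by omega)]
        by_cases hj : j = n - 1
        · subst hj
          simp only [Function.update_self]
          exact ⟨hw1, hw2, hw3⟩
        · rw [Function.update_of_ne hj]
          exact hx j h1 (by omega) h3
    · rintro n τ ⟨hs, hn, hnm, hl, hx⟩ hb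
      simp only [Test.holds, IExp.eval, hn] at hb
      exact Ter.nil h1 ⟨hs, hl, fun j h1 h2 => hx j h1 (by omega) h2⟩
    · refine ⟨⟨hs.iarr, hs.narr, hs.nreg, ?_⟩, ?_, le_rfl, ?_, ?_⟩
      · intro r hr; simp [hs.ireg r hr]; omega
      · simp [IExp.eval, hs.ireg 1, hm]
      · intro i hi; exact hx i (by omega)
      · intro j _ h2 h3; omega
  · refine ⟨⟨fun _ _ => rfl, rfl, rfl, ?_⟩, ?_, ?_⟩
    · intro r hr; simp; omega
    · simp [IExp.eval]
    · simp [IExp.eval]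

end Tournament

end RAM

namespace RAM

theorem cons_le_cons_iff_rat (a b : ℚ) (l r : List ℚ) :
    a :: l ≤ b :: r ↔ a < b ∨ a = b ∧ l ≤ r := by
  rw [← not_lt, List.cons_lt_cons_iff, ← not_lt (a := r)]
  rcases lt_trichotomy a b with h | h | h
  · simp [h, h.le, h.ne']
  · simp [h]
  · simp [h, h.le, h.ne']

/-- `τ` agrees with `σ` up to the scratch registers `20, 21, …`. -/
structure Scratch (σ τ : State) : Prop where
  iarr : τ.iarr = σ.iarr
  narr : τ.narr = σ.narr
  nreg : τ.nreg = σ.nreg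
  ireg : ∀ r < 20, τ.ireg r = σ.ireg r

theorem Scratch.setI {σ τ : State} (h : Scratch σ τ) {x v : ℕ} (hx : 20 ≤ x) :
    Scratch σ (τ.setI x v) :=
  ⟨h.iarr, h.narr, h.nreg, fun r hr => by
    rw [State.setI_ireg, if_neg (by omega)]; exact h.ireg r hr⟩

theorem Scratch.refl (σ : State) : Scratch σ σ := ⟨rfl, rfl, rfl, fun _ _ => rfl⟩

theorem Scratch.key {T : Tournament} {σ τ : State} (h : Scratch σ τ) : T.key τ = T.key σ :=
  T.key_congr σ τ (fun a _ => by rw [h.iarr]) h.narr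

/-! ## Range queries -/

namespace Tournament

variable (T : Tournament)

/-- Replace the item in register `22` by the one in register `21` if the latter wins. -/
def improve : Prog := .cond T.test (.setI 22 (.reg 21)) .skip

theorem improve_ter (σ : State) {k : ℕ} (hk : 1 ≤ k) :
    Ter T.improve σ k fun τ => ∃ w, τ = σ.setI 22 w ∧ (w = σ.ireg 21 ∨ w = σ.ireg 22) ∧
      T.key σ w ≤ T.key σ (σ.ireg 21) ∧ T.key σ w ≤ T.key σ (σ.ireg 22) := by
  refine Ter.cond hk (fun h => Ter.setI hk ?_) (fun h => Ter.skip hk ?_)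
  · rw [T.holds_iff] at h
    exact ⟨_, rfl, .inl rfl, le_rfl, h.le⟩
  · rw [T.holds_iff, not_lt] at h
    exact ⟨σ.ireg 22, by simp [State.setI], .inr rfl, h, le_rfl⟩

/-- Find the winner among the leaves at positions `a, …, b - 1`, where `a` and `b` are the contents
of registers `lo` and `hi`; the result is left in register `22`. -/
def query (lo hi : ℕ) : Prog := block [
  .setI 24 (.add (.reg 1) (.reg lo)),
  .setI 25 (.add (.reg 1) (.reg hi)),
  .setI 22 (.load T.arr (.reg 24)),
  .loop (.ilt (.reg 24) (.reg 25)) (block [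
    .setI 21 (.load T.arr (.reg 24)),
    T.improve,
    .setI 21 (.load T.arr (.sub (.reg 25) (.const 1))),
    T.improve,
    .setI 24 (.half (.add (.reg 24) (.const 1))),
    .setI 25 (.half (.reg 25))])]

/-- The loop keeps a champion and an interval of nodes on one level of halving, all of whose items
come from the range; every leaf of the range is beaten by the champion or by a node of the interval.
Both end nodes are compared with the champion regardless of parity, which is harmless, and the inner
nodes are replaced by their parents. -/
theorem query_ter {σ : State} {k m a b lo hi : ℕ} {leaf : ℕ → ℕ} (hm : σ.ireg 1 = m)
    (hhi : hi < 20) (ha : σ.ireg lo = a) (hb : σ.ireg hi = b) (hab : a < b)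
    (hbm : b ≤ m) (hk : 2 * m < 2 ^ k)
    (ht : IsTree m (σ.iarr T.arr) (T.key σ) leaf) :
    Ter (T.query lo hi) σ (k + 1) fun τ => Scratch σ τ ∧
      ∃ i, a ≤ i ∧ i < b ∧ τ.ireg 22 = leaf i ∧
        ∀ j, a ≤ j → j < b → T.key σ (leaf i) ≤ T.key σ (leaf j) := by
  have h1 : 1 ≤ k + 1 := by omega
  refine Ter.cons (Ter.setI h1 (Ter.cons (Ter.setI h1 (Ter.cons (Ter.setI h1 (Ter.cons ?_))))))
  simp only [IExp.eval, hm, ha, State.setI_ireg, State.setI_iarr]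
  rw [if_neg (by omega), if_neg (by omega), hb]
  norm_num
  set t := σ.iarr T.arr with ht'
  set In : ℕ → Prop := fun w => ∃ i, a ≤ i ∧ i < b ∧ w = leaf i with hIn
  refine Ter.loop (fun n τ => Scratch σ τ ∧ τ.ireg 25 < 2 ^ n ∧ 1 ≤ τ.ireg 24 ∧
    τ.ireg 25 ≤ 2 * m ∧ In (τ.ireg 22) ∧
    (∀ j, τ.ireg 24 ≤ j → j < τ.ireg 25 → In (t j)) ∧
    ∀ i, a ≤ i → i < b → T.key σ (τ.ireg 22) ≤ T.key σ (leaf i) ∨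
      ∃ j, τ.ireg 24 ≤ j ∧ j < τ.ireg 25 ∧ T.key σ (t j) ≤ T.key σ (leaf i)) ?_ ?_ (n := k) ?_ le_rfl
  · rintro (_ | n) τ ⟨hs, hn, hl, hr, hi, hJ, hI⟩ hb
    · simp [Test.holds, IExp.eval] at hb hn; omega
    refine ⟨n, 1, le_rfl, le_rfl, ?_⟩
    simp only [Test.holds, IExp.eval] at hb
    generalize hl' : τ.ireg 24 = l at *
    generalize hr' : τ.ireg 25 = r at *
    generalize hw' : τ.ireg 22 = w at *
    refine Ter.cons (Ter.setI le_rfl (Ter.cons ((T.improve_ter _ le_rfl).mono le_rfl ?_)))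
    rintro τ₁ ⟨w₁, rfl, hw₁, hw₁a, hw₁b⟩
    refine Ter.cons (Ter.setI le_rfl (Ter.cons ((T.improve_ter _ le_rfl).mono le_rfl ?_)))
    rintro τ₂ ⟨w₂, rfl, hw₂, hw₂a, hw₂b⟩
    refine Ter.cons (Ter.setI le_rfl (Ter.cons (Ter.setI le_rfl (Ter.nil le_rfl ?_))))
    simp [IExp.eval, hl', hr', hw', hs.iarr, hs.key, ← ht'] at hw₁ hw₁a hw₁b hw₂ hw₂a hw₂b ⊢
    have hw₁i : In w₁ := by
      rcases hw₁ with rfl | rfl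
      · exact hJ l le_rfl hb
      · exact hi
    have hw₂i : In w₂ := by
      rcases hw₂ with rfl | rfl
      · exact hJ (r - 1) (by omega) (by omega)
      · exact hw₁i
    -- A node strictly inside the interval is represented by its parent, which lies in the next
    -- interval.
    have hpar : ∀ j, l < j → j < r - 1 → (t (j / 2) = t (2 * (j / 2)) ∨
        t (j / 2) = t (2 * (j / 2) + 1)) ∧ T.key σ (t (j / 2)) ≤ T.key σ (t j) := by
      intro j h1 h2
      have := ht.2 (j / 2) (by omega) (by omega)
      refine ⟨this.1, ?_⟩
      rcases Nat.even_or_odd' j with ⟨y, rfl | rfl⟩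
      · rw [show 2 * y / 2 = y by omega] at *; exact this.2.1
      · rw [show (2 * y + 1) / 2 = y by omega] at *; exact this.2.2
    refine ⟨?_, ?_, ?_, ?_, hw₂i, ?_, ?_⟩
    · exact (((((hs.setI (by omega)).setI (by omega)).setI (by omega)).setI (by omega)).setI
        (by omega)).setI (by omega)
    · rw [pow_succ] at hn; omega
    · omega
    · omega
    · intro j h1 h2
      rcases (ht.2 j (by omega) (by omega)).1 with e | e
      · rw [e]; exact hJ _ (by omega) (by omega)
      · rw [e]; exact hJ _ (by omega) (by omega)
    · intro i hi1 hi2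
      rcases hI i hi1 hi2 with h | ⟨j, h1, h2, h3⟩
      · exact .inl (hw₂b.trans (hw₁b.trans h))
      · by_cases hjl : j = l
        · subst hjl; exact .inl (hw₂b.trans (hw₁a.trans h3))
        by_cases hjr : j = r - 1
        · subst hjr; exact .inl (hw₂a.trans h3)
        exact .inr ⟨j / 2, by omega, by omega, (hpar j (by omega) (by omega)).2.trans h3⟩
  · rintro n τ ⟨hs, hn, hl, hr, ⟨i, hi1, hi2, hi3⟩, hJ, hI⟩ hb
    simp only [Test.holds, IExp.eval] at hb
    refine Ter.nil h1 ⟨hs, i, hi1, hi2, hi3, fun j hj1 hj2 => ?_⟩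
    rcases hI j hj1 hj2 with h | ⟨l, h1, h2, h3⟩
    · rwa [hi3] at h
    · omega
  · simp
    refine ⟨?_, ?_, ?_, ?_, ?_, ?_, ?_⟩
    · exact (((Scratch.refl σ).setI (by omega)).setI (by omega)).setI (by omega)
    · omega
    · omega
    · omega
    · exact ⟨a, le_rfl, hab, ht.1 a (by omega)⟩
    · intro j h1 h2
      exact ⟨j - m, by omega, by omega, by rw [← ht.1 _ (by omega)]; congr 1; omega⟩
    · intro i hi1 hi2
      exact .inr ⟨m + i, by omega, by omega, by rw [ht.1 _ (by omega)]⟩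

end Tournament

/-! ## Binary search -/

/-- Find the number of leading items of array `a` (of length given by register `1`) passing the
test `b`, to which each item is presented in register `21`; the result is left in register `24`. -/
def search (a : ℕ) (b : Test) : Prog := block [
  .setI 24 (.const 0),
  .setI 25 (.reg 1),
  .loop (.ilt (.reg 24) (.reg 25)) (block [
    .setI 20 (.half (.add (.reg 24) (.reg 25))),
    .setI 21 (.load a (.reg 20)),
    .cond b (.setI 24 (.add (.reg 20) (.const 1))) (.setI 25 (.reg 20))])]

/-- Since `P` holds on an initial segment of the sorted array, the entries left of the current
interval pass and those right of it fail; the length of the interval is halved each time. -/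
theorem search_ter {σ : State} {a m k : ℕ} {b : Test} (P : ℕ → Prop) (hm : σ.ireg 1 = m)
    (hk : m < 2 ^ k) (hb : ∀ τ, Scratch σ τ → (b.holds τ ↔ P (τ.ireg 21)))
    (mono : ∀ i j, i ≤ j → j < m → P (σ.iarr a j) → P (σ.iarr a i)) :
    Ter (search a b) σ (k + 1) fun τ => Scratch σ τ ∧ τ.ireg 24 ≤ m ∧
      ∀ i < m, P (σ.iarr a i) ↔ i < τ.ireg 24 := by
  have h1 : 1 ≤ k + 1 := by omega
  refine Ter.cons (Ter.setI h1 (Ter.cons (Ter.setI h1 (Ter.cons ?_))))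
  refine Ter.loop (fun n τ => Scratch σ τ ∧ τ.ireg 25 - τ.ireg 24 < 2 ^ n ∧
    τ.ireg 24 ≤ τ.ireg 25 ∧ τ.ireg 25 ≤ m ∧ (∀ i < τ.ireg 24, P (σ.iarr a i)) ∧
    ∀ i < m, τ.ireg 25 ≤ i → ¬ P (σ.iarr a i)) ?_ ?_ (n := k) ?_ le_rfl
  · rintro n τ ⟨hs, hn, hlr, hr, hP, hN⟩ ht
    simp only [Test.holds, IExp.eval] at ht
    obtain _ | n := n
    · simp at hn; omega
    refine ⟨n, 1, le_rfl, le_rfl, ?_⟩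
    rw [pow_succ] at hn
    generalize hl' : τ.ireg 24 = l at *
    generalize hr' : τ.ireg 25 = r at *
    have hs2 : Scratch σ ((τ.setI 20 ((l + r) / 2)).setI 21 (σ.iarr a ((l + r) / 2))) :=
      (hs.setI (by omega)).setI (by omega)
    have hb2 := hb _ hs2
    refine Ter.cons (Ter.setI le_rfl (Ter.cons (Ter.setI le_rfl (Ter.cons ?_))))
    simp [IExp.eval, hl', hr', hs.iarr] at hb2 ⊢
    refine Ter.cond le_rfl (fun h => ?_) (fun h => ?_)
    · rw [hb2] at h
      refine Ter.setI le_rfl (Ter.nil le_rfl ?_)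
      simp [IExp.eval, hr']
      refine ⟨hs2.setI (by omega), by omega, by omega, hr, fun i hi => ?_, hN⟩
      exact mono _ _ hi (by omega) h
    · rw [hb2] at h
      refine Ter.setI le_rfl (Ter.nil le_rfl ?_)
      simp [IExp.eval, hl']
      refine ⟨hs2.setI (by omega), by omega, by omega, by omega, hP, fun i hi h2 h3 => ?_⟩
      exact h (mono _ _ h2 hi h3)
  · rintro n τ ⟨hs, hn, hlr, hr, hP, hN⟩ ht
    simp only [Test.holds, IExp.eval] at ht
    refine Ter.nil h1 ⟨hs, by omega, fun i hi => ⟨fun h => ?_, hP i⟩⟩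
    by_contra h2
    exact hN i hi (by omega) h
  · simp [IExp.eval, hm]
    refine ⟨((Scratch.refl σ).setI (by omega)).setI (by omega), hk, by intros; omega⟩

/-! ## Sorting -/

/-- `out` lists the numbers below `m` in the order of their keys, and `rank` is the inverse of `out`
(counting from one). -/
structure SortedBy {K : Type*} [LinearOrder K] (m : ℕ) (key : ℕ → K) (out rank : ℕ → ℕ) :
    Prop where
  out_lt : ∀ q < m, out q < m
  rank_out : ∀ q < m, rank (out q) = q + 1
  rank_pos : ∀ x < m, 1 ≤ rank x
  rank_le : ∀ x < m, rank x ≤ m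
  out_rank : ∀ x < m, out (rank x - 1) = x
  mono : ∀ q r, q ≤ r → r < m → key (out q) ≤ key (out r)

/-- `τ` agrees with `σ` up to the given three arrays and the registers `10, 11, …`. -/
structure SameBut3 (a b c : ℕ) (σ τ : State) : Prop where
  iarr : ∀ d, d ≠ a → d ≠ b → d ≠ c → τ.iarr d = σ.iarr d
  narr : τ.narr = σ.narr
  nreg : τ.nreg = σ.nreg
  ireg : ∀ r < 10, τ.ireg r = σ.ireg r

/-- Tournament sort: repeatedly output the winner and give it a rank. -/
def Tournament.sort (T : Tournament) (out rank : ℕ) : Prog := block [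
  T.build (.reg 23),
  .setI 10 (.const 0),
  .loop (.ilt (.reg 10) (.reg 1)) (block [
    .setI 11 (.load T.arr (.const 1)),
    .storeI out (.reg 10) (.reg 11),
    .setI 10 (.add (.reg 10) (.const 1)),
    .storeI rank (.reg 11) (.reg 10),
    T.refresh (.reg 11)])]

/-- The rank is at once output and leading component of the key: an item that has been output gets a
positive rank and thereby loses against all items still of rank `0`. This is why the rank array must
start out zero and ranks count from one. -/
theorem Tournament.sort_ter (T : Tournament) {out rank m k : ℕ} {σ : State} {key : ℕ → List ℚ}
    (hm : σ.ireg 1 = m) (hk : 2 * m < 2 ^ k) (h1 : out ≠ T.arr) (h2 : rank ≠ T.arr)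
    (h3 : out ≠ rank) (h0 : ∀ i, σ.iarr rank i = 0)
    (hkey : ∀ τ, SameBut3 T.arr out rank σ τ →
      ∀ i, T.key τ i = (τ.iarr rank i : ℚ) :: key i) :
    Ter (T.sort out rank) σ ((m + 1) * (k + 1)) fun τ =>
      SameBut3 T.arr out rank σ τ ∧ SortedBy m key (τ.iarr out) (τ.iarr rank) := by
  have hK : m + 1 ≤ (m + 1) * (k + 1) := Nat.le_mul_of_pos_right _ (by omega)
  have hK1 : 1 ≤ (m + 1) * (k + 1) := by omega
  refine Ter.cons ((T.build_ter (m := m) (leaf := id) hm ?_).mono hK ?_)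
  · intro τ _ _; rfl
  rintro σ₁ ⟨hs₁, ht₁⟩
  have hs₁' : SameBut3 T.arr out rank σ σ₁ :=
    ⟨fun d hd _ _ => hs₁.iarr d hd, hs₁.narr, hs₁.nreg, fun r hr => hs₁.ireg r (by omega)⟩
  refine Ter.cons (Ter.setI hK1 (Ter.cons ?_))
  refine Ter.loop (fun n τ => SameBut3 T.arr out rank σ τ ∧ τ.ireg 10 ≤ m ∧
    n = (m - τ.ireg 10) * (k + 1) ∧ IsTree m (τ.iarr T.arr) (T.key τ) id ∧
    (∀ q < τ.ireg 10, τ.iarr out q < m ∧ τ.iarr rank (τ.iarr out q) = q + 1) ∧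
    (∀ x < m, τ.iarr rank x = 0 ∨ τ.iarr rank x ≤ τ.ireg 10 ∧
      τ.iarr out (τ.iarr rank x - 1) = x) ∧
    (∀ q r, q ≤ r → r < τ.ireg 10 → key (τ.iarr out q) ≤ key (τ.iarr out r)) ∧
    (∀ q < τ.ireg 10, ∀ x < m, τ.iarr rank x = 0 → key (τ.iarr out q) ≤ key x)) ?_ ?_
    (n := m * (k + 1)) ?_ (by rw [add_mul]; omega)
  · rintro n τ ⟨hs, him, hn, ht, ho, hr, hmono, hlow⟩ hb
    simp only [Test.holds, IExp.eval, hs.ireg 1 (by omega), hm] at hb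
    generalize hi : τ.ireg 10 = i at *
    refine ⟨(m - (i + 1)) * (k + 1), k + 1, by omega, ?_, ?_⟩
    · rw [hn, ← Nat.succ_mul]; exact Nat.mul_le_mul_right _ (by omega)
    have hk1 : 1 ≤ k + 1 := by omega
    obtain ⟨x, hx, hx1, -⟩ := ht.exists_leaf (j := 1) le_rfl (by omega)
    simp only [id] at hx1
    have hroot : ∀ y < m, (τ.iarr rank x : ℚ) :: key x ≤ (τ.iarr rank y : ℚ) :: key y := by
      intro y hy
      rw [← hkey τ hs, ← hkey τ hs, ← hx1]
      exact ht.root_le hy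
    -- Pigeonhole: if the winner had been output already, then so had every item, and `m` items
    -- would occupy `i < m` places of the output.
    have hx0 : τ.iarr rank x = 0 := by
      by_contra hne
      have hall : ∀ y < m, τ.iarr rank y ≠ 0 := by
        intro y hy hy0
        have := hroot y hy
        rw [cons_le_cons_iff_rat, hy0] at this
        have h5 : (0 : ℚ) < τ.iarr rank x := by exact_mod_cast Nat.pos_of_ne_zero hne
        rcases this with h | h
        · push_cast at h; linarith
        · push_cast at h; linarith [h.1]
      have := Finset.card_le_card_of_injOn (s := Finset.range m) (t := Finset.range i)
        (fun y => τ.iarr rank y - 1) ?_ ?_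
      · simp at this; omega
      · intro y hy
        simp at hy ⊢
        have h5 := hall y hy
        rcases hr y hy with h | h
        · exact absurd h h5
        · omega
      · intro y hy z hz hyz
        simp at hy hz hyz
        have h5 := hall y hy
        have h6 := hall z hz
        rcases hr y hy with h | h
        · exact absurd h h5
        rcases hr z hz with h' | h'
        · exact absurd h' h6
        rw [← h.2, ← h'.2, hyz]
    have hmin : ∀ y < m, τ.iarr rank y = 0 → key x ≤ key y := by
      intro y hy hy0
      have := hroot y hy
      rw [cons_le_cons_iff_rat, hy0, hx0] at this
      simpa using this
    refine Ter.cons (Ter.setI hk1 (Ter.cons (Ter.storeI hk1 (Ter.cons (Ter.setI hk1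
      (Ter.cons (Ter.storeI hk1 (Ter.cons ?_))))))))
    simp only [IExp.eval, State.setI_ireg, State.storeI_ireg, hx1, hi, if_true]
    norm_num
    set ρ := (((τ.setI 11 x).storeI out i x).setI 10 (i + 1)).storeI rank x (i + 1) with hρ
    have hρs : SameBut3 T.arr out rank σ ρ := by
      refine ⟨fun d h1 h2 h3 => ?_, hs.narr, hs.nreg, fun r hr => ?_⟩
      · simp [hρ, h2, h3, hs.iarr d h1 h2 h3]
      · simp [hρ]
        rw [if_neg (by omega), if_neg (by omega)]
        exact hs.ireg r hr
    have hρt : ρ.iarr T.arr = τ.iarr T.arr := by simp [hρ, h1.symm, h2.symm]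
    have hρo : ρ.iarr out = Function.update (τ.iarr out) i x := by simp [hρ, h3]
    have hρr : ρ.iarr rank = Function.update (τ.iarr rank) x (i + 1) := by simp [hρ, h3.symm]
    have hρ10 : ρ.ireg 10 = i + 1 := by simp [hρ]
    refine (T.refresh_ter (m := m) (i := x) (leaf := id) (key₀ := T.key τ) ?_ ?_ hx hk ?_ ?_
      ?_).mono le_rfl ?_
    · rw [hρs.ireg 1 (by omega), hm]
    · simp [IExp.eval, hρ]
    · rw [hρt]; exact ht
    · intro i _ j _ h; exact h
    · intro j hj
      rw [hkey _ hρs, hkey _ hs, hρr, Function.update_of_ne (by simpa using hj)]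
    · rintro υ ⟨hs', ht'⟩
      refine Ter.nil hk1 ?_
      rw [hs'.iarr _ h1, hs'.iarr _ h2, hs'.ireg 10 (by omega), hρ10, hρo, hρr]
      have hox : ∀ q < i, τ.iarr out q ≠ x := by
        intro q hq e
        have := (ho q hq).2
        rw [e, hx0] at this; omega
      refine ⟨⟨fun d h1 h2 h3 => ?_, ?_, ?_, fun r hr => ?_⟩, by omega, rfl, ht', ?_, ?_, ?_, ?_⟩
      · rw [hs'.iarr d h1, hρs.iarr d h1 h2 h3]
      · rw [hs'.narr, hρs.narr]
      · rw [hs'.nreg, hρs.nreg]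
      · rw [hs'.ireg r (by omega), hρs.ireg r hr]
      · intro q hq
        by_cases hqi : q = i
        · subst hqi; simp [hx]
        · have hqi' : q < i := by omega
          rw [Function.update_of_ne hqi, Function.update_of_ne (hox q hqi')]
          exact ho q hqi'
      · intro y hy
        by_cases hyx : y = x
        · subst hyx; simp
        · rw [Function.update_of_ne hyx]
          rcases hr y hy with h | h
          · exact .inl h
          · by_cases h0 : τ.iarr rank y = 0
            · exact .inl h0
            · rw [Function.update_of_ne (by omega)]
              exact .inr ⟨by omega, h.2⟩
      · intro q r hqr hri
        by_cases hri' : r = i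
        · subst hri'
          by_cases hqr' : q = r
          · rw [hqr']
          · rw [Function.update_of_ne hqr', Function.update_self]
            exact hlow q (by omega) x hx hx0
        · rw [Function.update_of_ne hri', Function.update_of_ne (by omega)]
          exact hmono q r hqr (by omega)
      · intro q hq y hy hy0
        have hyx : y ≠ x := by rintro rfl; simp at hy0
        rw [Function.update_of_ne hyx] at hy0
        by_cases hqi : q = i
        · rw [hqi, Function.update_self]
          exact hmin y hy hy0
        · rw [Function.update_of_ne hqi]
          exact hlow q (by omega) y hy hy0
  · rintro n τ ⟨hs, him, hn, ht, ho, hr, hmono, hlow⟩ hb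
    simp only [Test.holds, IExp.eval, hs.ireg 1 (by omega), hm] at hb
    have him' : τ.ireg 10 = m := by omega
    rw [him'] at ho hr hmono
    -- Pigeonhole again: the `m` distinct outputs cannot all avoid `x`.
    have hne : ∀ x < m, τ.iarr rank x ≠ 0 := by
      intro x hx hx0
      have := Finset.card_le_card_of_injOn (s := Finset.range m) (t := (Finset.range m).erase x)
        (τ.iarr out) ?_ ?_
      · rw [Finset.card_erase_of_mem (by simpa using hx)] at this
        simp at this; omega
      · intro q hq
        simp at hq ⊢
        refine ⟨(ho q hq).1, fun e => ?_⟩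
        have := (ho q hq).2
        rw [e, hx0] at this; omega
      · intro q hq r hr e
        simp at hq hr
        have h5 := (ho q hq).2
        rw [e, (ho r hr).2] at h5; omega
    have hr' : ∀ x < m, τ.iarr rank x ≤ m ∧ τ.iarr out (τ.iarr rank x - 1) = x := fun x hx =>
      (hr x hx).resolve_left (hne x hx)
    exact Ter.nil hK1 ⟨hs, fun q hq => (ho q hq).1, fun q hq => (ho q hq).2,
      fun x hx => Nat.pos_of_ne_zero (hne x hx), fun x hx => (hr' x hx).1,
      fun x hx => (hr' x hx).2, hmono⟩
  · simp [IExp.eval]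
    have hrk : σ₁.iarr rank = σ.iarr rank := hs₁.iarr _ h2
    refine ⟨⟨hs₁'.iarr, hs₁'.narr, hs₁'.nreg, fun r hr => ?_⟩, ht₁, fun x hx => .inl ?_⟩
    · simp; rw [if_neg (by omega)]; exact hs₁'.ireg r hr
    · rw [hrk, h0]

end RAM

/-! ## Correctness of the label setting algorithm -/

/-- The data of a single-source optimal walks problem, as seen by the machine. -/
structure Network where
  m : ℕ
  source : ℕ
  src : ℕ → ℕ
  dst : ℕ → ℕ
  time : ℕ → ℚ
  trans : ℕ → ℚ
  cost : ℕ → ℚ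
  α : ℕ → ℚ
  β : ℕ → ℚ
  δ : ℕ → ℚ
  trans_nonneg : ∀ i, 0 ≤ trans i
  cost_nonneg : ∀ i, 0 ≤ cost i
  α_nonneg : ∀ i, 0 ≤ α i
  β_nonneg : ∀ i, 0 ≤ β i
  δ_nonneg : ∀ i, 0 ≤ δ i

namespace Network

variable (N : Network)

/-- Arrival time of an arc. -/
def arr (e : ℕ) : ℚ := N.time e + N.trans e

/-- The arc `f` may directly follow the arc `e`. -/
def Fol (e f : ℕ) : Prop :=
  N.dst e = N.src f ∧ N.arr e + N.α (N.dst e) ≤ N.time f ∧ N.time f ≤ N.arr e + N.β (N.dst e)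

/-- The value of the walk consisting of the single arc `f`. -/
def start (f : ℕ) : ℚ :=
  N.δ 0 * N.arr f - N.δ 1 * N.time f + N.δ 2 * N.trans f + N.δ 3 * N.trans f
    + N.δ 4 * N.cost f + N.δ 5

/-- The value of one unit of time between two arcs. -/
def rate : ℚ := N.δ 0 + N.δ 2 + N.δ 6

/-- The part of the cost of appending the arc `f` to a walk that depends on `f` only. -/
def base (f : ℕ) : ℚ :=
  (N.δ 0 + N.δ 2) * N.arr f + N.δ 6 * N.time f + N.δ 3 * N.trans f + N.δ 4 * N.cost f + N.δ 5

/-- The value of a walk obtained by appending the arc `f` to a walk of value `d` that ends with the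
arc `e`. -/
def append (d : ℚ) (e f : ℕ) : ℚ := d - N.rate * N.arr e + N.base f

/-- The place where and the time when an arc departs. -/
def depKey (f : ℕ) : List ℚ := [(N.src f : ℚ), N.time f]

/-- The head and the departure time of an arc. -/
def headKey (e : ℕ) : List ℚ := [(N.dst e : ℚ), N.time e]

variable {N}

theorem depKey_eq_headKey {f e : ℕ} :
    N.depKey f = N.headKey e ↔ N.src f = N.dst e ∧ N.time f = N.time e := by
  simp [depKey, headKey]

/-- The increment is a sum of nonnegative terms: the time from the arrival of `e` to the departure
of `f` weighted by `rate`, then transmission time, cost and hop. Values themselves may be negative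
because of the departure term, but Dijkstra's order needs only this monotonicity. -/
theorem Fol.le_append {e f : ℕ} (h : N.Fol e f) (d : ℚ) : d ≤ N.append d e f := by
  obtain ⟨-, h1, -⟩ := h
  have a := N.α_nonneg (N.dst e)
  have t := N.trans_nonneg f
  have e1 : 0 ≤ (N.δ 0 + N.δ 2 + N.δ 6) * (N.time f - N.arr e) :=
    mul_nonneg (by linarith [N.δ_nonneg 0, N.δ_nonneg 2, N.δ_nonneg 6]) (by linarith)
  have e2 : 0 ≤ (N.δ 0 + N.δ 2) * N.trans f :=
    mul_nonneg (by linarith [N.δ_nonneg 0, N.δ_nonneg 2]) t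
  have e3 := mul_nonneg (N.δ_nonneg 3) t
  have e4 := mul_nonneg (N.δ_nonneg 4) (N.cost_nonneg f)
  have e5 := N.δ_nonneg 5
  simp only [append, rate, base, arr] at *
  linarith

/-- Among predecessors with a common arrival time only the label counts; this is what makes one
relaxation of a block sufficient. -/
theorem append_le_append {d d' : ℚ} (h : d ≤ d') {e e' : ℕ} (f : ℕ) (he : N.arr e = N.arr e') :
    N.append d e f ≤ N.append d' e' f := by
  simp only [append, he]; linarith

variable (N) in
/-- Following the predecessor pointers from the settled arc `i` yields a walk from the source, of
value `D i`. -/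
inductive Reach (st pred : ℕ → ℕ) (D : ℕ → ℚ) : ℕ → Prop
  | start (i : ℕ) : i < N.m → st i = 3 → N.src i = N.source → pred i = 0 → D i = N.start i →
      Reach st pred D i
  | step (e i : ℕ) : i < N.m → st i = 3 → Reach st pred D e → N.Fol e i → pred i = e + 1 →
      D i = N.append (D e) e i → Reach st pred D i

theorem Reach.settled {st pred : ℕ → ℕ} {D : ℕ → ℚ} {i : ℕ} (h : N.Reach st pred D i) :
    i < N.m ∧ st i = 3 := by
  cases h with
  | start _ h1 h2 => exact ⟨h1, h2⟩
  | step e _ h1 h2 => exact ⟨h1, h2⟩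

/-- A pointer chain visits settled arcs only, and their labels and pointers are frozen. -/
theorem Reach.congr {st pred st' pred' : ℕ → ℕ} {D D' : ℕ → ℚ}
    (hc : ∀ i, st i = 3 → st' i = 3 ∧ pred' i = pred i ∧ D' i = D i) {i : ℕ}
    (h : N.Reach st pred D i) : N.Reach st' pred' D' i := by
  induction h with
  | start i h1 h2 h3 h4 h5 =>
    obtain ⟨a, b, c⟩ := hc i h2
    exact .start i h1 a h3 (b.trans h4) (c.trans h5)
  | step e i h1 h2 h3 h4 h5 h6 ih =>
    obtain ⟨a, b, c⟩ := hc i h2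
    obtain ⟨-, -, c'⟩ := hc e h3.settled.2
    exact .step e i h1 a ih h4 (b.trans h5) (by rw [c, c', h6])

variable (N) in
/-- The arc `f` has a label, which is no worse than that obtained from the arc `e`. -/
def Good (st : ℕ → ℕ) (D : ℕ → ℚ) (e f : ℕ) : Prop :=
  (st f = 1 ∨ st f = 3) ∧ D f ≤ N.append (D e) e f

variable (N) in
/-- The invariant of the main loop. The status `st i` of an arc `i` is `0` (untouched), `1`
(labelled, in the queue), `2` (no walk found yet) or `3` (settled). The arcs at positions from `p`
on that can follow `cur` at the same time step have not been relaxed yet. -/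
structure Inv (S st done pred : ℕ → ℕ) (D : ℕ → ℚ) (cur p : ℕ) : Prop where
  st_le : ∀ i < N.m, st i ≤ 3
  reach : ∀ i < N.m, st i = 3 → N.Reach st pred D i
  label : ∀ i < N.m, st i = 1 → (pred i = 0 ∧ N.src i = N.source ∧ D i = N.start i) ∨
    ∃ e < N.m, st e = 3 ∧ N.Fol e i ∧ pred i = e + 1 ∧ D i = N.append (D e) e i
  ord_alive : ∀ e < N.m, st e = 3 → ∀ j < N.m, st j = 1 →
    N.time e < N.time j ∨ N.time e = N.time j ∧ D e ≤ D j
  ord_new : ∀ e < N.m, st e = 3 → ∀ j < N.m, st j = 0 → N.time e < N.time j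
  ord_open : ∀ f < N.m, 1 ≤ st f → ∀ j < N.m, st j ≤ 1 → N.time f ≤ N.time j
  closed : ∀ e < N.m, st e = 3 → ∀ f < N.m, 1 ≤ st f → N.Fol e f → N.Good st D e f ∨
    (e = cur ∧ N.depKey f = N.headKey cur ∧ ∃ q, p ≤ q ∧ q < N.m ∧ S q = f)
  source_le : ∀ f < N.m, 1 ≤ st f → N.src f = N.source →
    (st f = 1 ∨ st f = 3) ∧ D f ≤ N.start f
  done_good : ∀ f < N.m, done f ≠ 0 →
    ∃ e < N.m, st e = 3 ∧ N.arr e = N.time f ∧ N.depKey f = N.headKey e ∧ N.Good st D e f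
  uniform : ∀ q < N.m, ∀ r < N.m, N.depKey (S q) = N.depKey (S r) → done (S q) ≠ 0 →
    done (S r) = 0 → N.depKey (S q) = N.headKey cur ∧ q < p ∧ p ≤ r
  pend : p < N.m → cur < N.m ∧ st cur = 3 ∧ N.trans cur = 0 ∧ N.α (N.dst cur) = 0 ∧
    (∀ e < N.m, st e = 3 → N.time e < N.time cur ∨ N.time e = N.time cur ∧ D e ≤ D cur) ∧
    (∀ f < N.m, 1 ≤ st f → N.time f ≤ N.time cur) ∧
    (∀ q, p ≤ q → q < N.m → N.headKey cur ≤ N.depKey (S q)) ∧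
    (∀ q < p, N.depKey (S q) = N.headKey cur → done (S q) ≠ 0)

/-! ### Preservation of the invariant by opening, settling and relaxing arcs -/

variable {S rank st done pred : ℕ → ℕ} {D : ℕ → ℚ} {cur p : ℕ}

/-- If there is nothing left to relax, then there are no exceptions any more. -/
theorem Inv.inactive (h : N.Inv S st done pred D cur p) (hS : RAM.SortedBy N.m N.depKey S rank)
    (hp : ¬ (p < N.m ∧ N.depKey (S p) = N.headKey cur ∧ done (S p) = 0)) :
    N.Inv S st done pred D cur N.m := by
  by_cases hpm : p < N.m
  swap
  · refine { h with closed := ?_, uniform := ?_, pend := fun h => absurd h (lt_irrefl _) }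
    · intro e he h3 f hf h1 hef
      refine .inl ((h.closed e he h3 f hf h1 hef).resolve_right ?_)
      rintro ⟨-, -, q, h4, h5, -⟩; omega
    · intro q hq r hr h1 h2 h3
      have := h.uniform q hq r hr h1 h2 h3
      omega
  obtain ⟨hc, hc3, hct, hca, hmax, -, hle, -⟩ := h.pend hpm
  -- If the block of `cur` extends beyond `p`, then the arc at `p` is in it and is already done, and
  -- by uniformity so are all later ones. In other words, the block was relaxed before.
  have key : ∀ q, p ≤ q → q < N.m → N.depKey (S q) = N.headKey cur → done (S q) ≠ 0 := by
    intro q h1 h2 h3 h4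
    have e1 : N.depKey (S p) = N.headKey cur :=
      le_antisymm (h3 ▸ hS.mono p q h1 h2) (hle p le_rfl hpm)
    have := h.uniform p hpm q h2 (e1.trans h3.symm) (fun h0 => hp ⟨hpm, e1, h0⟩) h4
    omega
  refine { h with closed := ?_, uniform := ?_, pend := fun h => absurd h (lt_irrefl _) }
  · intro e he h3 f hf h1 hef
    rcases h.closed e he h3 f hf h1 hef with hg | ⟨rfl, hk, q, h4, h5, rfl⟩
    · exact .inl hg
    -- The arc `e'` which relaxed this block earlier arrives simultaneously with `cur` and was
    -- settled with a label no larger, so its offer is at least as good.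
    obtain ⟨e', he', h3', ha', hk', hg1, hg2⟩ := h.done_good _ hf (key q h4 h5 hk)
    refine .inl ⟨hg1, hg2.trans ?_⟩
    have e2 := (depKey_eq_headKey.1 hk).2
    have e3 := (depKey_eq_headKey.1 hk').2
    refine append_le_append ?_ _ (by rw [ha', e2, arr, hct, add_zero])
    rcases hmax e' he' h3' with h | h
    · linarith
    · exact h.2
  · intro q hq r hr h1 h2 h3
    obtain ⟨h4, h5, h6⟩ := h.uniform q hq r hr h1 h2 h3
    exact absurd h3 (key r h6 hr (h1 ▸ h4))

theorem Inv.change_cur (h : N.Inv S st done pred D cur N.m) (cur' : ℕ) :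
    N.Inv S st done pred D cur' N.m := by
  refine { h with closed := ?_, uniform := ?_, pend := fun h => absurd h (lt_irrefl _) }
  · intro e he h3 f hf h1 hef
    refine .inl ((h.closed e he h3 f hf h1 hef).resolve_right ?_)
    rintro ⟨-, -, q, h4, h5, -⟩; omega
  · intro q hq r hr h1 h2 h3
    have := h.uniform q hq r hr h1 h2 h3
    omega

/-- Nothing opened departs later than `x`, so the only opened arcs that can follow `x` form its
same-time block, and they exist only if `x` takes no time. The position `p'` is the start of this
block, or `N.m` if there is nothing to relax. -/
theorem Inv.settle (h : N.Inv S st done pred D cur N.m) (hS : RAM.SortedBy N.m N.depKey S rank)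
    {x : ℕ} (hx : x < N.m) (hx1 : st x = 1)
    (hmin : ∀ j < N.m, st j ≤ 1 →
      N.time x < N.time j ∨ N.time x = N.time j ∧ st j = 1 ∧ D x ≤ D j)
    {p' : ℕ}
    (hp : (p' = N.m ∧ ¬ (N.trans x = 0 ∧ N.α (N.dst x) = 0)) ∨
      ((N.trans x = 0 ∧ N.α (N.dst x) = 0) ∧
        ∀ q < N.m, N.depKey (S q) < N.headKey x ↔ q < p')) :
    N.Inv S (Function.update st x 3) done pred D x p' := by
  have hst : ∀ i, i ≠ x → Function.update st x 3 i = st i := fun i hi =>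
    Function.update_of_ne hi _ _
  have hstx : Function.update st x 3 x = 3 := Function.update_self ..
  have h3 : ∀ i, Function.update st x 3 i = 3 → i = x ∨ st i = 3 := by
    intro i hi
    by_cases hix : i = x
    · exact .inl hix
    · exact .inr (by rwa [hst i hix] at hi)
  have h1 : ∀ i, Function.update st x 3 i ≤ 1 → i ≠ x ∧ st i ≤ 1 := by
    intro i hi
    by_cases hix : i = x
    · subst hix; rw [hstx] at hi; omega
    · exact ⟨hix, by rwa [hst i hix] at hi⟩
  have hop : ∀ i, 1 ≤ Function.update st x 3 i → 1 ≤ st i := by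
    intro i hi
    by_cases hix : i = x
    · subst hix; omega
    · rwa [hst i hix] at hi
  have hhas : ∀ i, (st i = 1 ∨ st i = 3) →
      (Function.update st x 3 i = 1 ∨ Function.update st x 3 i = 3) := by
    intro i hi
    by_cases hix : i = x
    · subst hix; exact .inr hstx
    · rwa [hst i hix]
  have hreach : ∀ i, N.Reach st pred D i → N.Reach (Function.update st x 3) pred D i := by
    intro i hi
    refine hi.congr fun j hj => ⟨?_, rfl, rfl⟩
    rwa [hst j (by rintro rfl; omega)]
  constructor
  · intro i hi
    by_cases hix : i = x
    · subst hix; rw [hstx]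
    · rw [hst i hix]; exact h.st_le i hi
  · intro i hi hi3
    rcases h3 i hi3 with rfl | hi3'
    · rcases h.label i hi hx1 with ⟨a, b, c⟩ | ⟨e, a, b, c, d, f⟩
      · exact .start i hi hi3 b a c
      · exact .step e i hi hi3 (hreach e (h.reach e a b)) c d f
    · exact hreach i (h.reach i hi hi3')
  · intro i hi hi1
    obtain ⟨hix, -⟩ := h1 i hi1.le
    rw [hst i hix] at hi1
    rcases h.label i hi hi1 with a | ⟨e, a, b, c⟩
    · exact .inl a
    · exact .inr ⟨e, a, by rwa [hst e (by rintro rfl; omega)], c⟩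
  · intro e he he3 j hj hj1
    obtain ⟨hjx, -⟩ := h1 j hj1.le
    rw [hst j hjx] at hj1
    rcases h3 e he3 with rfl | he3'
    · rcases hmin j hj hj1.le with a | a
      · exact .inl a
      · exact .inr ⟨a.1, a.2.2⟩
    · exact h.ord_alive e he he3' j hj hj1
  · intro e he he3 j hj hj0
    obtain ⟨hjx, -⟩ := h1 j (by omega)
    rw [hst j hjx] at hj0
    rcases h3 e he3 with rfl | he3'
    · rcases hmin j hj (by omega) with a | a
      · exact a
      · omega
    · exact h.ord_new e he he3' j hj hj0
  · intro f hf hf1 j hj hj1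
    exact h.ord_open f hf (hop f hf1) j hj (h1 j hj1).2
  · intro e he he3 f hf hf1 hef
    rcases h3 e he3 with rfl | he3'
    -- The arc `f` departs no later than `e` by the opening order and no earlier because it follows
    -- `e`; hence transmission and minimum waiting time vanish.
    · have t1 := h.ord_open f hf (hop f hf1) e he hx1.le
      have t2 := hef.2.1
      have t3 := N.trans_nonneg e
      have t4 := N.α_nonneg (N.dst e)
      rw [arr] at t2
      have hz : N.trans e = 0 ∧ N.α (N.dst e) = 0 := ⟨by linarith, by linarith⟩
      rcases hp with hp | hp
      · exact absurd hz hp.2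
      have hk : N.depKey f = N.headKey e := depKey_eq_headKey.2 ⟨hef.1.symm, by linarith⟩
      have hr1 := hS.rank_pos f hf
      have hr2 := hS.rank_le f hf
      have hr3 := hS.out_rank f hf
      refine .inr ⟨rfl, hk, rank f - 1, ?_, by omega, hr3⟩
      by_contra hlt
      have := (hp.2 (rank f - 1) (by omega)).2 (by omega)
      rw [hr3, hk] at this
      exact lt_irrefl _ this
    · refine .inl ?_
      have := (h.closed e he he3' f hf (hop f hf1) hef).resolve_right
        (by rintro ⟨-, -, q, h4, h5, -⟩; omega)
      exact ⟨hhas f this.1, this.2⟩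
  · intro f hf hf1 hfs
    have := h.source_le f hf (hop f hf1) hfs
    exact ⟨hhas f this.1, this.2⟩
  · intro f hf hfd
    obtain ⟨e, he, he3, ha, hk, hg⟩ := h.done_good f hf hfd
    exact ⟨e, he, by rwa [hst e (by rintro rfl; omega)], ha, hk, hhas f hg.1, hg.2⟩
  · intro q hq r hr a b c
    have := h.uniform q hq r hr a b c
    omega
  · intro hpm
    rcases hp with hp | ⟨⟨hz1, hz2⟩, hp⟩
    · omega
    refine ⟨hx, hstx, hz1, hz2, ?_, ?_, ?_, ?_⟩
    · intro e he he3
      rcases h3 e he3 with rfl | he3'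
      · exact .inr ⟨rfl, le_rfl⟩
      · exact h.ord_alive e he he3' x hx hx1
    · intro f hf hf1
      exact h.ord_open f hf (hop f hf1) x hx hx1.le
    · intro q h4 h5
      by_contra hlt
      have := (hp q h5).1 (not_le.1 hlt)
      omega
    · intro q h4 h5
      have := (hp q (by omega)).2 h4
      rw [h5] at this
      exact absurd this (lt_irrefl _)

/-- Settled arcs all departed strictly before the untouched arc `x`, so any new label respects the
settling order. It only has to be the best among the start label and the offers of the settled
predecessors. -/
theorem Inv.openArc (h : N.Inv S st done pred D cur N.m) {x : ℕ} (hx : x < N.m) (hx0 : st x = 0)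
    (hmin : ∀ j < N.m, st j ≤ 1 → N.time x ≤ N.time j) {sx px : ℕ} {dx : ℚ}
    (hsx : sx = 1 ∨ sx = 2)
    (hl : sx = 1 → (px = 0 ∧ N.src x = N.source ∧ dx = N.start x) ∨
      ∃ e < N.m, st e = 3 ∧ N.Fol e x ∧ px = e + 1 ∧ dx = N.append (D e) e x)
    (hs : N.src x = N.source → sx = 1 ∧ dx ≤ N.start x)
    (he : ∀ e < N.m, st e = 3 → N.Fol e x → sx = 1 ∧ dx ≤ N.append (D e) e x) :
    N.Inv S (Function.update st x sx) done (Function.update pred x px) (Function.update D x dx)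
      cur N.m := by
  have hst : ∀ i, i ≠ x → Function.update st x sx i = st i := fun i hi =>
    Function.update_of_ne hi _ _
  have hstx : Function.update st x sx x = sx := Function.update_self ..
  have hD : ∀ i, i ≠ x → Function.update D x dx i = D i := fun i hi =>
    Function.update_of_ne hi _ _
  have hDx : Function.update D x dx x = dx := Function.update_self ..
  have hpr : ∀ i, i ≠ x → Function.update pred x px i = pred i := fun i hi =>
    Function.update_of_ne hi _ _
  have hprx : Function.update pred x px x = px := Function.update_self ..
  have h3 : ∀ i, Function.update st x sx i = 3 → i ≠ x ∧ st i = 3 := by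
    intro i hi
    by_cases hix : i = x
    · rw [hix, hstx] at hi; clear hmin hl hs he; omega
    · exact ⟨hix, by rwa [hst i hix] at hi⟩
  have h0 : ∀ i, Function.update st x sx i = 0 → i ≠ x ∧ st i = 0 := by
    intro i hi
    by_cases hix : i = x
    · rw [hix, hstx] at hi; clear hmin hl hs he; omega
    · exact ⟨hix, by rwa [hst i hix] at hi⟩
  have h1 : ∀ i, Function.update st x sx i ≤ 1 → st i ≤ 1 := by
    intro i hi
    by_cases hix : i = x
    · subst hix; omega
    · rwa [hst i hix] at hi
  have h3' : ∀ i, st i = 3 → i ≠ x ∧ Function.update st x sx i = 3 := by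
    intro i hi
    have hix : i ≠ x := by rintro rfl; omega
    exact ⟨hix, by rwa [hst i hix]⟩
  have hgood : ∀ e f, st e = 3 → N.Good st D e f →
      N.Good (Function.update st x sx) (Function.update D x dx) e f := by
    intro e f he3 hg
    have hfx : f ≠ x := by rintro rfl; have := hg.1; omega
    rw [Good, hst f hfx, hD f hfx, hD e (h3' e he3).1]
    exact hg
  constructor
  · intro i hi
    by_cases hix : i = x
    · rw [hix, hstx]; clear hmin hl hs he; omega
    · rw [hst i hix]; exact h.st_le i hi
  · intro i hi hi3
    refine (h.reach i hi (h3 i hi3).2).congr fun j hj => ?_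
    obtain ⟨a, b⟩ := h3' j hj
    exact ⟨b, hpr j a, hD j a⟩
  · intro i hi hi1
    by_cases hix : i = x
    · subst hix
      rw [hstx] at hi1
      rw [hprx, hDx]
      rcases hl hi1 with a | ⟨e, a, b, c⟩
      · exact .inl a
      · obtain ⟨b1, b2⟩ := h3' e b
        exact .inr ⟨e, a, b2, by rwa [hD e b1]⟩
    · rw [hst i hix] at hi1
      rw [hpr i hix, hD i hix]
      rcases h.label i hi hi1 with a | ⟨e, a, b, c⟩
      · exact .inl a
      · obtain ⟨b1, b2⟩ := h3' e b
        exact .inr ⟨e, a, b2, by rwa [hD e b1]⟩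
  · intro e he' he3 j hj hj1
    obtain ⟨a, b⟩ := h3 e he3
    by_cases hjx : j = x
    · subst hjx
      exact .inl (h.ord_new e he' b j hj hx0)
    · rw [hst j hjx] at hj1
      rw [hD e a, hD j hjx]
      exact h.ord_alive e he' b j hj hj1
  · intro e he' he3 j hj hj0
    exact h.ord_new e he' (h3 e he3).2 j hj (h0 j hj0).2
  · intro f hf hf1 j hj hj1
    by_cases hfx : f = x
    · subst hfx
      exact hmin j hj (h1 j hj1)
    · rw [hst f hfx] at hf1
      exact h.ord_open f hf hf1 j hj (h1 j hj1)
  · intro e he' he3 f hf hf1 hef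
    obtain ⟨a, b⟩ := h3 e he3
    by_cases hfx : f = x
    · subst hfx
      obtain ⟨c, d⟩ := he e he' b hef
      exact .inl ⟨.inl (hstx.trans c), by rw [hDx, hD e a]; exact d⟩
    · rw [hst f hfx] at hf1
      exact .inl (hgood e f b ((h.closed e he' b f hf hf1 hef).resolve_right
        (by rintro ⟨-, -, q, h4, h5, -⟩; omega)))
  · intro f hf hf1 hfs
    by_cases hfx : f = x
    · subst hfx
      rw [hstx, hDx]
      exact ⟨.inl (hs hfs).1, (hs hfs).2⟩
    · rw [hst f hfx] at hf1 ⊢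
      rw [hD f hfx]
      exact h.source_le f hf hf1 hfs
  · intro f hf hfd
    obtain ⟨e, he', he3, ha, hk, hg⟩ := h.done_good f hf hfd
    exact ⟨e, he', (h3' e he3).2, ha, hk, hgood e f he3 hg⟩
  · exact h.uniform
  · intro hm; exact absurd hm (lt_irrefl _)

theorem fol_of_depKey_eq {e f : ℕ} (ht : N.trans e = 0) (ha : N.α (N.dst e) = 0)
    (hk : N.depKey f = N.headKey e) : N.Fol e f := by
  obtain ⟨h1, h2⟩ := depKey_eq_headKey.1 hk
  have := N.β_nonneg (N.dst e)
  refine ⟨h1.symm, ?_, ?_⟩ <;> rw [arr] <;> linarith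

/-- The Dijkstra step: `x` departs together with `cur`, whose label is the largest among the settled
arcs of that time, and the new label is no smaller than that of `cur`. Since the label of `x`
decreases or is its first one, all earlier guarantees for `x` persist. -/
theorem Inv.improve (h : N.Inv S st done pred D cur p) (hS : RAM.SortedBy N.m N.depKey S rank)
    (hp : p < N.m) (hk : N.depKey (S p) = N.headKey cur) {x : ℕ} (hx : S p = x)
    (himp : st x = 2 ∨ st x = 1 ∧ N.append (D cur) cur x < D x) :
    N.Inv S (Function.update st x 1) done (Function.update pred x (cur + 1))
      (Function.update D x (N.append (D cur) cur x)) cur p := by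
  obtain ⟨hc, hc3, hct, hca, hmax, hmax', hle, hpd⟩ := h.pend hp
  have hxm : x < N.m := hx ▸ hS.out_lt p hp
  rw [hx] at hk
  have hfol := fol_of_depKey_eq hct hca hk
  obtain ⟨hk1, hk2⟩ := depKey_eq_headKey.1 hk
  set d := N.append (D cur) cur x with hd
  have hst : ∀ i, i ≠ x → Function.update st x 1 i = st i := fun i hi =>
    Function.update_of_ne hi _ _
  have hstx : Function.update st x 1 x = 1 := Function.update_self ..
  have hD : ∀ i, i ≠ x → Function.update D x d i = D i := fun i hi =>
    Function.update_of_ne hi _ _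
  have hDx : Function.update D x d x = d := Function.update_self ..
  have hpr : ∀ i, i ≠ x → Function.update pred x (cur + 1) i = pred i := fun i hi =>
    Function.update_of_ne hi _ _
  have hprx : Function.update pred x (cur + 1) x = cur + 1 := Function.update_self ..
  have h3 : ∀ i, Function.update st x 1 i = 3 → i ≠ x ∧ st i = 3 := by
    intro i hi
    by_cases hix : i = x
    · subst hix; rw [hstx] at hi; omega
    · exact ⟨hix, by rwa [hst i hix] at hi⟩
  have h0 : ∀ i, Function.update st x 1 i = 0 → i ≠ x ∧ st i = 0 := by
    intro i hi
    by_cases hix : i = x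
    · subst hix; rw [hstx] at hi; omega
    · exact ⟨hix, by rwa [hst i hix] at hi⟩
  have hop : ∀ i, 1 ≤ Function.update st x 1 i → 1 ≤ st i := by
    intro i hi
    by_cases hix : i = x
    · subst hix; omega
    · rwa [hst i hix] at hi
  have h3' : ∀ i, st i = 3 → i ≠ x ∧ Function.update st x 1 i = 3 := by
    intro i hi
    have hix : i ≠ x := by rintro rfl; omega
    exact ⟨hix, by rwa [hst i hix]⟩
  have hhas : ∀ i v, (st i = 1 ∨ st i = 3) ∧ D i ≤ v →
      (Function.update st x 1 i = 1 ∨ Function.update st x 1 i = 3) ∧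
        Function.update D x d i ≤ v := by
    rintro i v ⟨hi, hv⟩
    by_cases hix : i = x
    · subst hix
      rw [hstx, hDx]
      refine ⟨.inl rfl, ?_⟩
      have : d < D i := by
        rcases himp with a | a
        · omega
        · exact a.2
      linarith
    · rw [hst i hix, hD i hix]; exact ⟨hi, hv⟩
  have hgood : ∀ e f, st e = 3 → N.Good st D e f →
      N.Good (Function.update st x 1) (Function.update D x d) e f := by
    intro e f he3 hg
    rw [Good, hD e (h3' e he3).1]
    exact hhas f _ hg
  constructor
  · intro i hi
    by_cases hix : i = x
    · subst hix; omega
    · rw [hst i hix]; exact h.st_le i hi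
  · intro i hi hi3
    refine (h.reach i hi (h3 i hi3).2).congr fun j hj => ?_
    obtain ⟨a, b⟩ := h3' j hj
    exact ⟨b, hpr j a, hD j a⟩
  · intro i hi hi1
    by_cases hix : i = x
    · subst hix
      obtain ⟨b1, b2⟩ := h3' cur hc3
      exact .inr ⟨cur, hc, b2, hfol, hprx, by rw [hDx, hD cur b1]⟩
    · rw [hst i hix] at hi1
      rw [hpr i hix, hD i hix]
      rcases h.label i hi hi1 with a | ⟨e, a, b, c⟩
      · exact .inl a
      · obtain ⟨b1, b2⟩ := h3' e b
        exact .inr ⟨e, a, b2, by rwa [hD e b1]⟩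
  · intro e he' he3 j hj hj1
    obtain ⟨a, b⟩ := h3 e he3
    by_cases hjx : j = x
    · subst hjx
      rw [hD e a, hDx, hk2]
      rcases hmax e he' b with c | c
      · exact .inl c
      · exact .inr ⟨c.1, c.2.trans (hfol.le_append _)⟩
    · rw [hst j hjx] at hj1
      rw [hD e a, hD j hjx]
      exact h.ord_alive e he' b j hj hj1
  · intro e he' he3 j hj hj0
    exact h.ord_new e he' (h3 e he3).2 j hj (h0 j hj0).2
  · intro f hf hf1 j hj hj1
    by_cases hjx : j = x
    · subst hjx
      rw [hk2]
      exact hmax' f hf (hop f hf1)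
    · rw [hst j hjx] at hj1
      exact h.ord_open f hf (hop f hf1) j hj hj1
  · intro e he' he3 f hf hf1 hef
    obtain ⟨a, b⟩ := h3 e he3
    rcases h.closed e he' b f hf (hop f hf1) hef with hg | hg
    · exact .inl (hgood e f b hg)
    · exact .inr hg
  · intro f hf hf1 hfs
    exact hhas f _ (h.source_le f hf (hop f hf1) hfs)
  · intro f hf hfd
    obtain ⟨e, he', he3, ha, hk, hg⟩ := h.done_good f hf hfd
    exact ⟨e, he', (h3' e he3).2, ha, hk, hgood e f he3 hg⟩
  · exact h.uniform
  · intro _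
    obtain ⟨b1, b2⟩ := h3' cur hc3
    refine ⟨hc, b2, hct, hca, ?_, fun f hf hf1 => hmax' f hf (hop f hf1), hle, hpd⟩
    intro e he he3
    obtain ⟨c1, c2⟩ := h3 e he3
    rw [hD e c1, hD cur b1]
    exact hmax e he c2

theorem Inv.advance (h : N.Inv S st done pred D cur p) (hS : RAM.SortedBy N.m N.depKey S rank)
    (hp : p < N.m) (hk : N.depKey (S p) = N.headKey cur) {x : ℕ} (hx : S p = x)
    (hg : N.Good st D cur x) :
    N.Inv S st (Function.update done x 1) pred D cur (p + 1) := by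
  obtain ⟨hc, hc3, hct, hca, hmax, hmax', hle, hpd⟩ := h.pend hp
  have hdx : Function.update done x 1 x = 1 := Function.update_self ..
  have hd : ∀ i, i ≠ x → Function.update done x 1 i = done i := fun i hi =>
    Function.update_of_ne hi _ _
  have hinj : ∀ q < N.m, S q = x → q = p := by
    intro q hq e
    have h1 := hS.rank_out q hq
    rw [e, ← hx, hS.rank_out p hp] at h1
    omega
  refine { h with closed := ?_, done_good := ?_, uniform := ?_, pend := ?_ }
  · intro e he h3 f hf h1 hef
    rcases h.closed e he h3 f hf h1 hef with a | ⟨rfl, a, q, b, c, rfl⟩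
    · exact .inl a
    · by_cases hqp : q = p
      · subst hqp; exact .inl (hx ▸ hg)
      · exact .inr ⟨rfl, a, q, by omega, c, rfl⟩
  · intro f hf hfd
    by_cases hfx : f = x
    · subst hfx
      rw [hx] at hk
      exact ⟨cur, hc, hc3, by rw [arr, hct, add_zero, (depKey_eq_headKey.1 hk).2], hk, hg⟩
    · rw [hd f hfx] at hfd
      exact h.done_good f hf hfd
  · intro q hq r hr a b c
    have hrx : S r ≠ x := by intro e; rw [e, hdx] at c; omega
    rw [hd _ hrx] at c
    have hrp : r ≠ p := by rintro rfl; exact hrx hx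
    by_cases hqp : q = p
    · subst hqp
      refine ⟨hk, by omega, ?_⟩
      -- An undone arc of this block at a position before `p` would contradict the last clause of
      -- `pend`.
      by_contra hlt
      exact hpd r (by omega) (a ▸ hk) c
    · rw [hd _ fun e => hqp (hinj q hq e)] at b
      obtain ⟨d1, d2, d3⟩ := h.uniform q hq r hr a b c
      exact ⟨d1, by omega, by omega⟩
  · intro hp1
    refine ⟨hc, hc3, hct, hca, hmax, hmax', fun q h1 h2 => hle q (by omega) h2, ?_⟩
    intro q hq hqk
    by_cases hqp : q = p
    · subst hqp; rw [hx, hdx]; omega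
    · rw [hd _ fun e => hqp (hinj q (by omega) e)]
      exact hpd q (by omega) hqk

/-- The arc `x` cannot be untouched, as those depart later than `cur`. If it is settled, its label
is at most that of `cur`, hence at most the offer of `cur`. -/
theorem Inv.good_of_not_improve (h : N.Inv S st done pred D cur p)
    (hS : RAM.SortedBy N.m N.depKey S rank)
    (hp : p < N.m) (hk : N.depKey (S p) = N.headKey cur) {x : ℕ} (hx : S p = x)
    (himp : ¬ (st x = 2 ∨ st x = 1 ∧ N.append (D cur) cur x < D x)) : N.Good st D cur x := by
  obtain ⟨hc, hc3, hct, hca, hmax, -, -, -⟩ := h.pend hp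
  have hxm : x < N.m := hx ▸ hS.out_lt p hp
  rw [hx] at hk
  have hfol := fol_of_depKey_eq hct hca hk
  have hk2 := (depKey_eq_headKey.1 hk).2
  have h0 : st x ≠ 0 := fun h0 => by
    have := h.ord_new cur hc hc3 x hxm h0
    linarith
  have h3 := h.st_le x hxm
  push Not at himp
  by_cases h1 : st x = 1
  · exact ⟨.inl h1, himp.2 h1⟩
  · have hx3 : st x = 3 := by have := himp.1; omega
    refine ⟨.inr hx3, ?_⟩
    rcases hmax x hxm hx3 with a | a
    · linarith
    · exact a.2.trans (hfol.le_append _)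

theorem Inv.initial (N : Network) (S : ℕ → ℕ) (D : ℕ → ℚ) (cur : ℕ) :
    N.Inv S (fun _ => 0) (fun _ => 0) (fun _ => 0) D cur N.m := by
  constructor <;> simp

/-! ### The best settled arc into each vertex, and the completed labelling -/

variable (N) in
/-- `out v` points to the last arc of a walk to `v` of least value `val v` among the settled arcs. -/
def OutOk (st : ℕ → ℕ) (D : ℕ → ℚ) (out : ℕ → ℕ) (val : ℕ → ℚ) : Prop :=
  ∀ v, (out v = 0 ∧ ∀ e < N.m, st e = 3 → N.dst e ≠ v) ∨
    ∃ e < N.m, st e = 3 ∧ N.dst e = v ∧ out v = e + 1 ∧ val v = D e ∧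
      ∀ e' < N.m, st e' = 3 → N.dst e' = v → D e ≤ D e'

theorem OutOk.update {out : ℕ → ℕ} {val : ℕ → ℚ} (h : N.OutOk st D out val) {x sx : ℕ} {dx : ℚ}
    (hx : st x ≠ 3) (hsx : sx ≠ 3) :
    N.OutOk (Function.update st x sx) (Function.update D x dx) out val := by
  have h3 : ∀ i, Function.update st x sx i = 3 ↔ st i = 3 := by
    intro i
    by_cases hix : i = x
    · subst hix; simp [hx, hsx]
    · rw [Function.update_of_ne hix]
  have hD : ∀ i, st i = 3 → Function.update D x dx i = D i := by
    intro i hi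
    rw [Function.update_of_ne (by rintro rfl; exact hx hi)]
  intro v
  rcases h v with ⟨a, b⟩ | ⟨e, a, b, c, d, f, g⟩
  · exact .inl ⟨a, fun e he he3 => b e he ((h3 e).1 he3)⟩
  · refine .inr ⟨e, a, (h3 e).2 b, c, d, by rw [hD e b, f], fun e' he' he3 hv => ?_⟩
    rw [hD e b, hD e' ((h3 e').1 he3)]
    exact g e' he' ((h3 e').1 he3) hv

/-- The null pointer plays the role of an infinite value. The comparison of values is essential:
arcs are settled by time first, so a later arc into the same vertex may be better. -/
theorem OutOk.settle {out : ℕ → ℕ} {val : ℕ → ℚ} (h : N.OutOk st D out val) {x : ℕ}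
    (hx : x < N.m) (hx3 : st x ≠ 3) :
    ((out (N.dst x) = 0 ∨ D x < val (N.dst x)) →
      N.OutOk (Function.update st x 3) D (Function.update out (N.dst x) (x + 1))
        (Function.update val (N.dst x) (D x))) ∧
    (¬ (out (N.dst x) = 0 ∨ D x < val (N.dst x)) → N.OutOk (Function.update st x 3) D out val) := by
  have hst : ∀ i, i ≠ x → Function.update st x 3 i = st i := fun i hi =>
    Function.update_of_ne hi _ _
  have hstx : Function.update st x 3 x = 3 := Function.update_self ..
  have h3 : ∀ i, Function.update st x 3 i = 3 → i = x ∨ st i = 3 := by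
    intro i hi
    by_cases hix : i = x
    · exact .inl hix
    · exact .inr (by rwa [hst i hix] at hi)
  have hother : ∀ v, v ≠ N.dst x → (out v = 0 ∧ ∀ e < N.m, Function.update st x 3 e = 3 →
        N.dst e ≠ v) ∨
      ∃ e < N.m, Function.update st x 3 e = 3 ∧ N.dst e = v ∧ out v = e + 1 ∧ val v = D e ∧
        ∀ e' < N.m, Function.update st x 3 e' = 3 → N.dst e' = v → D e ≤ D e' := by
    intro v hv
    rcases h v with ⟨a, b⟩ | ⟨e, a, b, c, d, f, g⟩
    · refine .inl ⟨a, fun e he he3 => ?_⟩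
      rcases h3 e he3 with rfl | he3
      · exact hv.symm
      · exact b e he he3
    · refine .inr ⟨e, a, by rwa [hst e (by rintro rfl; exact hx3 b)], c, d, f, ?_⟩
      intro e' he' he3 hv'
      rcases h3 e' he3 with rfl | he3
      · exact absurd hv'.symm hv
      · exact g e' he' he3 hv'
  constructor
  · intro himp v
    by_cases hv : v = N.dst x
    · subst hv
      refine .inr ⟨x, hx, hstx, rfl, by simp, by simp, fun e' he' he3 hv => ?_⟩
      rcases h3 e' he3 with rfl | he3
      · exact le_rfl
      rcases h (N.dst x) with ⟨a, b⟩ | ⟨e, a, b, c, d, f, g⟩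
      · exact absurd hv (b e' he' he3)
      · have := g e' he' he3 hv
        rcases himp with i | i
        · omega
        · linarith
    · rw [Function.update_of_ne hv, Function.update_of_ne hv]
      exact hother v hv
  · intro himp v
    by_cases hv : v = N.dst x
    · subst hv
      push Not at himp
      rcases h (N.dst x) with ⟨a, b⟩ | ⟨e, a, b, c, d, f, g⟩
      · exact absurd a himp.1
      · refine .inr ⟨e, a, by rwa [hst e (by rintro rfl; exact hx3 b)], c, d, f, ?_⟩
        intro e' he' he3 hv'
        rcases h3 e' he3 with rfl | he3
        · rw [← f]; exact himp.2
        · exact g e' he' he3 hv'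
    · exact hother v hv

/-- A complete set of labels: all arcs that continue a walk from the source are settled. -/
theorem Inv.final (h : N.Inv S st done pred D cur N.m) (hd : ∀ i < N.m, 2 ≤ st i) :
    (∀ f < N.m, N.src f = N.source → st f = 3 ∧ D f ≤ N.start f) ∧
    (∀ e < N.m, st e = 3 → ∀ f < N.m, N.Fol e f → st f = 3 ∧ D f ≤ N.append (D e) e f) := by
  constructor
  · intro f hf hs
    have h2 := hd f hf
    obtain ⟨a, b⟩ := h.source_le f hf (by omega) hs
    exact ⟨by omega, b⟩
  · intro e he h3 f hf hef
    have h2 := hd f hf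
    obtain ⟨a, b⟩ := (h.closed e he h3 f hf (by omega) hef).resolve_right
      (by rintro ⟨-, -, q, h4, h5, -⟩; omega)
    exact ⟨by omega, b⟩

end Network

/-! ## The program -/

namespace RAM

/-- The column of a sort key held in index array `a`. -/
def icol (a : ℕ) : Column where
  lt := .ilt (.load a (.reg 21)) (.load a (.reg 22))
  eq := .ieq (.load a (.reg 21)) (.load a (.reg 22))
  val σ i := σ.iarr a i
  lt_iff σ := by simp [Test.holds, IExp.eval]
  eq_iff σ := by simp [Test.holds, IExp.eval]

/-- The column of a sort key held in number array `a`. -/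
def ncol (a : ℕ) : Column where
  lt := .nlt (.load a (.reg 21)) (.load a (.reg 22))
  eq := .neq (.load a (.reg 21)) (.load a (.reg 22))
  val σ i := σ.narr a i
  lt_iff σ := by simp [Test.holds, NExp.eval, IExp.eval]
  eq_iff σ := by simp [Test.holds, NExp.eval, IExp.eval]

/-- The arrival time of the arc in register `r`. -/
def arrE (r : ℕ) : NExp := .add (.load 0 (.reg r)) (.load 1 (.reg r))

/-- Sort by arrival time. -/
def arrCol : Column where
  lt := .nlt (arrE 21) (arrE 22)
  eq := .neq (arrE 21) (arrE 22)
  val σ i := σ.narr 0 i + σ.narr 1 i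
  lt_iff σ := by simp [Test.holds, arrE, NExp.eval, IExp.eval]
  eq_iff σ := by simp [Test.holds, arrE, NExp.eval, IExp.eval]

/-- Arcs of status `0` and `1` come first. -/
def queuedCol : Column where
  lt := .ilt (.half (.load 10 (.reg 21))) (.half (.load 10 (.reg 22)))
  eq := .ieq (.half (.load 10 (.reg 21))) (.half (.load 10 (.reg 22)))
  val σ i := (σ.iarr 10 i / 2 : ℕ)
  lt_iff σ := by simp [Test.holds, IExp.eval]
  eq_iff σ := by simp [Test.holds, IExp.eval]

/-- The number `0` for settled arcs (status `3`), and `1` for all others. -/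
def unsettledE (r : ℕ) : IExp :=
  .sub (.const 1) (.half (.half (.add (.load 10 (.reg r)) (.const 1))))

/-- Settled arcs come first. -/
def settledCol : Column where
  lt := .ilt (unsettledE 21) (unsettledE 22)
  eq := .ieq (unsettledE 21) (unsettledE 22)
  val σ i := (1 - (σ.iarr 10 i + 1) / 2 / 2 : ℕ)
  lt_iff σ := by simp [Test.holds, unsettledE, IExp.eval]
  eq_iff σ := by simp [Test.holds, unsettledE, IExp.eval]

/-- The tournament in index array `a` for a lexicographic key. -/
def Tournament.ofColumns (a : ℕ) (cs : List Column)
    (h : ∀ c ∈ cs, ∀ σ τ : State, (∀ b, b ≠ a → τ.iarr b = σ.iarr b) → τ.narr = σ.narr →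
      c.val τ = c.val σ) : Tournament where
  arr := a
  test := lexTest cs
  key σ i := cs.map fun c => c.val σ i
  holds_iff σ := lexTest_holds cs σ
  key_congr σ τ h1 h2 := by
    funext i
    exact List.map_congr_left fun c hc => by rw [h c hc σ τ h1 h2]

/-- The tournament for sorting by tail and departure time. -/
def depSorter : Tournament := .ofColumns 8 [icol 5, icol 0, ncol 0] (by
  intro c hc σ τ h1 h2
  simp only [List.mem_cons, List.not_mem_nil, or_false] at hc
  rcases hc with rfl | rfl | rfl <;> funext i <;> simp [icol, ncol, h1, h2])

/-- The tournament for sorting by head and arrival time. -/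
def arrSorter : Tournament := .ofColumns 9 [icol 7, icol 1, arrCol] (by
  intro c hc σ τ h1 h2
  simp only [List.mem_cons, List.not_mem_nil, or_false] at hc
  rcases hc with rfl | rfl | rfl <;> funext i <;> simp [icol, arrCol, h1, h2])

/-- The queue of the arcs of status `0` and `1`, ordered by time, status and label. -/
def queue : Tournament := .ofColumns 12 [queuedCol, ncol 0, icol 10, ncol 6] (by
  intro c hc σ τ h1 h2
  simp only [List.mem_cons, List.not_mem_nil, or_false] at hc
  rcases hc with rfl | rfl | rfl | rfl <;> funext i <;> simp [queuedCol, icol, ncol, h1, h2])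

/-- The tree for range minima over the settled arcs, sorted by head and arrival time. -/
def ranges : Tournament := .ofColumns 13 [settledCol, ncol 7] (by
  intro c hc σ τ h1 h2
  simp only [List.mem_cons, List.not_mem_nil, or_false] at hc
  rcases hc with rfl | rfl <;> funext i <;> simp [settledCol, ncol, h1, h2])

/-- Value of a unit of time between arcs. -/
def rateE : NExp := .add (.add (.reg 1) (.reg 3)) (.reg 7)

/-- Value of the walk consisting of the arc in register `10`. -/
def startE : NExp :=
  .add (.add (.add (.add (.sub (.mul (.reg 1) (arrE 10)) (.mul (.reg 2) (.load 0 (.reg 10))))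
    (.mul (.reg 3) (.load 1 (.reg 10)))) (.mul (.reg 4) (.load 1 (.reg 10))))
    (.mul (.reg 5) (.load 2 (.reg 10)))) (.reg 6)

/-- The contribution of the arc in register `10` when it is appended to a walk. -/
def baseE : NExp :=
  .add (.add (.add (.add (.mul (.add (.reg 1) (.reg 3)) (arrE 10))
    (.mul (.reg 7) (.load 0 (.reg 10)))) (.mul (.reg 4) (.load 1 (.reg 10))))
    (.mul (.reg 5) (.load 2 (.reg 10)))) (.reg 6)

/-- Value of the best walk ending with the arc in register `r`, minus the value of its arrival
time. -/
def offsetE (r : ℕ) : NExp := .sub (.load 6 (.reg r)) (.mul rateE (arrE r))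

/-- Value of the walk to the arc in register `r`, extended by the arc in register `10`. -/
def appendE (r : ℕ) : NExp := .add (offsetE r) baseE

/-- Use the arc in register `r` as predecessor of the arc in register `10` if this is better. -/
def improveLabel (r : ℕ) : Prog :=
  .cond (.or (.ieq (.load 10 (.reg 10)) (.const 2))
      (.conj (.ieq (.load 10 (.reg 10)) (.const 1)) (.nlt (appendE r) (.load 6 (.reg 10)))))
    (block [
      .storeN 6 (.reg 10) (appendE r),
      .storeI 3 (.reg 10) (.add (.reg r) (.const 1)),
      .storeI 10 (.reg 10) (.const 1)])
    .skip

/-- Label the arc in register `10` if it departs from the source. -/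
def labelStart : Prog :=
  .cond (.ieq (.load 0 (.reg 10)) (.reg 2))
    (block [
      .storeN 6 (.reg 10) startE,
      .storeI 3 (.reg 10) (.const 0),
      .storeI 10 (.reg 10) (.const 1)])
    .skip

/-- The arc in register `21` arrives before the arcs that the arc in register `10` can follow. -/
def beforeWindow : Test :=
  .or (.ilt (.load 1 (.reg 21)) (.load 0 (.reg 10)))
    (.conj (.ieq (.load 1 (.reg 21)) (.load 0 (.reg 10)))
      (.nlt (.add (arrE 21) (.load 4 (.load 0 (.reg 10)))) (.load 0 (.reg 10))))

/-- The arc in register `21` does not arrive after the arcs that the arc in register `10` can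
follow. -/
def upToWindow : Test :=
  .or (.ilt (.load 1 (.reg 21)) (.load 0 (.reg 10)))
    (.conj (.ieq (.load 1 (.reg 21)) (.load 0 (.reg 10)))
      (.neg (.nlt (.load 0 (.reg 10)) (.add (arrE 21) (.load 3 (.load 0 (.reg 10)))))))

/-- The departure of the arc in register `21` comes before the arcs leaving the head of the arc in
register `10` at the same time step. -/
def beforeBlock : Test :=
  .or (.ilt (.load 0 (.reg 21)) (.load 1 (.reg 10)))
    (.conj (.ieq (.load 0 (.reg 21)) (.load 1 (.reg 10)))
      (.nlt (.load 0 (.reg 21)) (.load 0 (.reg 10))))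

/-- Label the arc in register `10` by means of the best settled predecessor. -/
def labelPred : Prog := block [
  search 6 beforeWindow,
  .setI 13 (.reg 24),
  search 6 upToWindow,
  .setI 14 (.reg 24),
  .cond (.ilt (.reg 13) (.reg 14))
    (block [
      ranges.query 13 14,
      .setI 15 (.reg 22),
      .cond (.ieq (.load 10 (.reg 15)) (.const 3)) (improveLabel 15) .skip])
    .skip]

/-- Compute the first label of the arc in register `10`. -/
def openArc : Prog := block [
  .storeI 10 (.reg 10) (.const 2),
  labelStart,
  labelPred,
  .setI 11 (.reg 1),
  queue.refresh (.reg 10)]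

/-- Record the arc in register `10` as last arc of a walk to its head if this is better. -/
def recordArc : Prog :=
  .cond (.or (.ieq (.load 2 (.load 1 (.reg 10))) (.const 0))
      (.nlt (.load 6 (.reg 10)) (.load 5 (.load 1 (.reg 10)))))
    (block [
      .storeI 2 (.load 1 (.reg 10)) (.add (.reg 10) (.const 1)),
      .storeN 5 (.load 1 (.reg 10)) (.load 6 (.reg 10))])
    .skip

/-- Find the arcs that can follow the arc in register `10` at the same time step. -/
def findBlock : Prog :=
  .cond (.conj (.neq (.load 1 (.reg 10)) (.const 0))
      (.neq (.load 3 (.load 1 (.reg 10))) (.const 0)))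
    (block [search 4 beforeBlock, .setI 11 (.reg 24)])
    (.setI 11 (.reg 1))

/-- Settle the arc in register `10`. -/
def settleArc : Prog := block [
  .storeI 10 (.reg 10) (.const 3),
  .storeN 7 (.reg 10) (offsetE 10),
  recordArc,
  .setI 12 (.reg 10),
  findBlock,
  queue.refresh (.reg 10),
  ranges.refresh (.sub (.load 7 (.reg 10)) (.const 1))]

/-- Relax the next arc that can follow the arc in register `12` at the same time step. -/
def relaxArc : Prog := block [
  .setI 10 (.load 4 (.reg 11)),
  improveLabel 12,
  .storeI 11 (.reg 10) (.const 1),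
  .setI 11 (.add (.reg 11) (.const 1)),
  queue.refresh (.reg 10)]

/-- There is an arc to relax. -/
def activeTest : Test :=
  .conj (.ilt (.reg 11) (.reg 1))
    (.conj (.conj (.ieq (.load 0 (.load 4 (.reg 11))) (.load 1 (.reg 12)))
      (.neq (.load 0 (.load 4 (.reg 11))) (.load 0 (.reg 12))))
      (.ieq (.load 11 (.load 4 (.reg 11))) (.const 0)))

/-- The queue is not empty. -/
def queueTest : Test := .ilt (.half (.load 10 (.load 12 (.const 1)))) (.const 1)

/-- The label setting algorithm. -/
def mainLoop : Prog :=
  .loop (.or activeTest queueTest)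
    (.cond activeTest relaxArc
      (block [
        .setI 10 (.load 12 (.const 1)),
        .cond (.ieq (.load 10 (.reg 10)) (.const 0)) openArc settleArc]))

/-- The whole program. -/
def optWalks : Prog :=
  .cond (.ieq (.reg 1) (.const 0)) .skip
    (block [
      depSorter.sort 4 5,
      arrSorter.sort 6 7,
      queue.build (.reg 23),
      ranges.build (.load 6 (.reg 23)),
      .setI 11 (.reg 1),
      mainLoop])

/-! ## Verification of the program -/

/-- The state `σ` contains the data of `N`. -/
structure Presents (N : Network) (σ : State) : Prop where
  m : σ.ireg 1 = N.m
  source : σ.ireg 2 = N.source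
  src : σ.iarr 0 = N.src
  dst : σ.iarr 1 = N.dst
  time : σ.narr 0 = N.time
  trans : σ.narr 1 = N.trans
  cost : σ.narr 2 = N.cost
  α : σ.narr 3 = N.α
  β : σ.narr 4 = N.β
  δ : ∀ j < 7, σ.nreg (j + 1) = N.δ j

variable {N : Network} {σ τ : State}

theorem Presents.congr (h : Presents N σ) (h0 : ∀ r < 10, τ.ireg r = σ.ireg r)
    (h1 : τ.iarr 0 = σ.iarr 0) (h2 : τ.iarr 1 = σ.iarr 1) (h3 : ∀ a < 5, τ.narr a = σ.narr a)
    (h4 : τ.nreg = σ.nreg) : Presents N τ := by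
  constructor
  · rw [h0 1 (by omega), h.m]
  · rw [h0 2 (by omega), h.source]
  · rw [h1, h.src]
  · rw [h2, h.dst]
  · rw [h3 0 (by omega), h.time]
  · rw [h3 1 (by omega), h.trans]
  · rw [h3 2 (by omega), h.cost]
  · rw [h3 3 (by omega), h.α]
  · rw [h3 4 (by omega), h.β]
  · rw [h4]; exact h.δ

theorem Presents.sameBut (h : Presents N σ) {a : ℕ} (ha : 2 ≤ a) (hs : SameBut a σ τ) :
    Presents N τ :=
  h.congr (fun r hr => hs.ireg r (by omega)) (hs.iarr 0 (by omega)) (hs.iarr 1 (by omega))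
    (fun b _ => by rw [hs.narr]) hs.nreg

theorem Presents.scratch (h : Presents N σ) (hs : Scratch σ τ) : Presents N τ :=
  h.congr (fun r hr => hs.ireg r (by omega)) (by rw [hs.iarr]) (by rw [hs.iarr])
    (fun b _ => by rw [hs.narr]) hs.nreg

theorem Presents.arrE_eval (h : Presents N σ) (r : ℕ) :
    (arrE r).eval σ = N.arr (σ.ireg r) := by
  simp [arrE, NExp.eval, IExp.eval, Network.arr, h.time, h.trans]

theorem Presents.rateE_eval (h : Presents N σ) : rateE.eval σ = N.rate := by
  have h0 := h.δ 0 (by omega)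
  have h2 := h.δ 2 (by omega)
  have h6 := h.δ 6 (by omega)
  norm_num at h0 h2 h6
  simp [rateE, NExp.eval, Network.rate, h0, h2, h6]

theorem Presents.startE_eval (h : Presents N σ) : startE.eval σ = N.start (σ.ireg 10) := by
  have h0 := h.δ 0 (by omega)
  have h1 := h.δ 1 (by omega)
  have h2 := h.δ 2 (by omega)
  have h3 := h.δ 3 (by omega)
  have h4 := h.δ 4 (by omega)
  have h5 := h.δ 5 (by omega)
  norm_num at h0 h1 h2 h3 h4 h5
  simp [startE, NExp.eval, Network.start, h.arrE_eval, IExp.eval, h0, h1, h2, h3, h4, h5, h.time,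
    h.trans, h.cost]

theorem Presents.baseE_eval (h : Presents N σ) : baseE.eval σ = N.base (σ.ireg 10) := by
  have h0 := h.δ 0 (by omega)
  have h2 := h.δ 2 (by omega)
  have h3 := h.δ 3 (by omega)
  have h4 := h.δ 4 (by omega)
  have h5 := h.δ 5 (by omega)
  have h6 := h.δ 6 (by omega)
  norm_num at h0 h2 h3 h4 h5 h6
  simp [baseE, NExp.eval, Network.base, h.arrE_eval, IExp.eval, h0, h2, h3, h4, h5, h6, h.time,
    h.trans, h.cost]

theorem Presents.offsetE_eval (h : Presents N σ) (r : ℕ) :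
    (offsetE r).eval σ = σ.narr 6 (σ.ireg r) - N.rate * N.arr (σ.ireg r) := by
  simp [offsetE, NExp.eval, IExp.eval, h.arrE_eval, h.rateE_eval]

theorem Presents.appendE_eval (h : Presents N σ) (r : ℕ) :
    (appendE r).eval σ = N.append (σ.narr 6 (σ.ireg r)) (σ.ireg r) (σ.ireg 10) := by
  simp [appendE, NExp.eval, h.offsetE_eval, h.baseE_eval, Network.append]

/-- The state `τ` arises from `σ` by changing the label of the arc `x`. -/
structure Relabel (x sx px : ℕ) (dx : ℚ) (σ τ : State) : Prop where
  st : τ.iarr 10 = Function.update (σ.iarr 10) x sx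
  pred : τ.iarr 3 = Function.update (σ.iarr 3) x px
  D : τ.narr 6 = Function.update (σ.narr 6) x dx
  iarr : ∀ a, a ≠ 3 → a ≠ 10 → τ.iarr a = σ.iarr a
  narr : ∀ a, a ≠ 6 → τ.narr a = σ.narr a
  nreg : τ.nreg = σ.nreg
  ireg : ∀ r < 13, τ.ireg r = σ.ireg r

theorem Relabel.refl (x : ℕ) (σ : State) :
    Relabel x (σ.iarr 10 x) (σ.iarr 3 x) (σ.narr 6 x) σ σ :=
  ⟨by simp, by simp, by simp, fun _ _ _ => rfl, fun _ _ => rfl, rfl, fun _ _ => rfl⟩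

theorem Relabel.trans {x sx px sx' px' : ℕ} {dx dx' : ℚ} {ρ : State}
    (h : Relabel x sx px dx σ τ) (h' : Relabel x sx' px' dx' τ ρ) :
    Relabel x sx' px' dx' σ ρ :=
  ⟨by rw [h'.st, h.st, Function.update_idem], by rw [h'.pred, h.pred, Function.update_idem],
    by rw [h'.D, h.D, Function.update_idem],
    fun a h1 h2 => (h'.iarr a h1 h2).trans (h.iarr a h1 h2),
    fun a h1 => (h'.narr a h1).trans (h.narr a h1), h'.nreg.trans h.nreg,
    fun r hr => (h'.ireg r hr).trans (h.ireg r hr)⟩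

theorem Relabel.scratch {x sx px : ℕ} {dx : ℚ} {ρ : State}
    (h : Relabel x sx px dx σ τ) (h' : Scratch τ ρ) : Relabel x sx px dx σ ρ :=
  ⟨by rw [h'.iarr, h.st], by rw [h'.iarr, h.pred], by rw [h'.narr, h.D],
    by rw [h'.iarr]; exact h.iarr, by rw [h'.narr]; exact h.narr, h'.nreg.trans h.nreg,
    fun r hr => (h'.ireg r (by omega)).trans (h.ireg r hr)⟩

theorem Relabel.setI {x sx px : ℕ} {dx : ℚ} (h : Relabel x sx px dx σ τ) {y v : ℕ} (hy : 13 ≤ y) :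
    Relabel x sx px dx σ (τ.setI y v) :=
  ⟨h.st, h.pred, h.D, h.iarr, h.narr, h.nreg, fun r hr => by
    rw [State.setI_ireg, if_neg (by omega)]; exact h.ireg r hr⟩

theorem Relabel.presents {x sx px : ℕ} {dx : ℚ} (h : Relabel x sx px dx σ τ) (hp : Presents N σ) :
    Presents N τ :=
  hp.congr (fun r hr => h.ireg r (by omega)) (h.iarr 0 (by omega) (by omega))
    (h.iarr 1 (by omega) (by omega)) (fun b _ => h.narr b (by omega)) h.nreg

theorem improveLabel_ter (hp : Presents N σ) {r x e k : ℕ} (hx : σ.ireg 10 = x)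
    (he : σ.ireg r = e) (hk : 1 ≤ k) :
    Ter (improveLabel r) σ k fun τ =>
      ((σ.iarr 10 x = 2 ∨ σ.iarr 10 x = 1 ∧ N.append (σ.narr 6 e) e x < σ.narr 6 x) ∧
        Relabel x 1 (e + 1) (N.append (σ.narr 6 e) e x) σ τ) ∨
      (¬ (σ.iarr 10 x = 2 ∨ σ.iarr 10 x = 1 ∧ N.append (σ.narr 6 e) e x < σ.narr 6 x) ∧
        τ = σ) := by
  have hE : (appendE r).eval σ = N.append (σ.narr 6 e) e x := by
    rw [hp.appendE_eval, he, hx]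
  refine Ter.cond hk (fun h => ?_) (fun h => Ter.skip hk (.inr ⟨?_, rfl⟩))
  · refine Ter.cons (Ter.storeN hk (Ter.cons (Ter.storeI hk (Ter.cons (Ter.storeI hk
      (Ter.nil hk (.inl ⟨?_, ?_⟩)))))))
    · simpa [Test.holds, NExp.eval, IExp.eval, hE, hx] using h
    · constructor <;> simp [IExp.eval, hx, hE, he] <;> intros <;> first | contradiction | simp [*]
  · simpa [Test.holds, NExp.eval, IExp.eval, hE, hx] using h

theorem labelStart_ter (hp : Presents N σ) {x k : ℕ} (hx : σ.ireg 10 = x) (hk : 1 ≤ k) :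
    Ter labelStart σ k fun τ =>
      (N.src x = N.source ∧ Relabel x 1 0 (N.start x) σ τ) ∨ (N.src x ≠ N.source ∧ τ = σ) := by
  have hE : startE.eval σ = N.start x := by rw [hp.startE_eval, hx]
  refine Ter.cond hk (fun h => ?_) (fun h => Ter.skip hk (.inr ⟨?_, rfl⟩))
  · refine Ter.cons (Ter.storeN hk (Ter.cons (Ter.storeI hk (Ter.cons (Ter.storeI hk
      (Ter.nil hk (.inl ⟨?_, ?_⟩)))))))
    · simpa [Test.holds, IExp.eval, hx, hp.src, hp.source] using h
    · constructor <;> simp [IExp.eval, hx, hE] <;> intros <;> first | contradiction | simp [*]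
  · simpa [Test.holds, IExp.eval, hx, hp.src, hp.source] using h

end RAM

/-! ### The potential, the invariant on machine states, and relaxation -/

namespace Network

variable (N : Network)

/-- The place where and the time when an arc arrives. -/
def arrKey (e : ℕ) : List ℚ := [(N.dst e : ℚ), N.arr e]

/-- The potential of the main loop. -/
def pot (st done : ℕ → ℕ) : ℕ :=
  ∑ i ∈ Finset.range N.m, (if st i = 0 then 2 else if st i = 3 then 0 else 1) +
    ∑ i ∈ Finset.range N.m, if done i = 0 then 1 else 0

end Network

/-- The additive form avoids truncated subtraction in the accounting of the potential. -/
theorem sum_update_add {m x : ℕ} (hx : x < m) (g : ℕ → ℕ) (f : ℕ → ℕ) (v : ℕ) :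
    ∑ i ∈ Finset.range m, g (Function.update f x v i) + g (f x) =
      ∑ i ∈ Finset.range m, g (f i) + g v := by
  have hx' : x ∈ Finset.range m := by simpa using hx
  rw [← Finset.add_sum_erase _ _ hx', ← Finset.add_sum_erase _ (fun i => g (f i)) hx']
  have : ∑ i ∈ (Finset.range m).erase x, g (Function.update f x v i) =
      ∑ i ∈ (Finset.range m).erase x, g (f i) := by
    refine Finset.sum_congr rfl fun i hi => ?_
    rw [Function.update_of_ne (Finset.ne_of_mem_erase hi)]
  simp [this]; omega

theorem Network.pot_update_st {N : Network} {st done : ℕ → ℕ} {x : ℕ} (hx : x < N.m) (v : ℕ) :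
    N.pot (Function.update st x v) done + (if st x = 0 then 2 else if st x = 3 then 0 else 1) =
      N.pot st done + (if v = 0 then 2 else if v = 3 then 0 else 1) := by
  have := sum_update_add hx (fun s => if s = 0 then 2 else if s = 3 then 0 else 1) st v
  simp only [Network.pot]
  omega

theorem Network.pot_update_done {N : Network} {st done : ℕ → ℕ} {x : ℕ} (hx : x < N.m) (v : ℕ) :
    N.pot st (Function.update done x v) + (if done x = 0 then 1 else 0) =
      N.pot st done + (if v = 0 then 1 else 0) := by
  have := sum_update_add hx (fun s => if s = 0 then 1 else 0) done v
  simp only [Network.pot]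
  omega

namespace RAM

variable {N : Network} {σ τ : State}

/-- The invariant of the main loop, without the trees. -/
structure Core (N : Network) (σ : State) : Prop where
  pres : Presents N σ
  dep : SortedBy N.m N.depKey (σ.iarr 4) (σ.iarr 5)
  arr : SortedBy N.m N.arrKey (σ.iarr 6) (σ.iarr 7)
  inv : N.Inv (σ.iarr 4) (σ.iarr 10) (σ.iarr 11) (σ.iarr 3) (σ.narr 6) (σ.ireg 12) (σ.ireg 11)
  out : N.OutOk (σ.iarr 10) (σ.narr 6) (σ.iarr 2) (σ.narr 5)
  offset : ∀ i < N.m, σ.iarr 10 i = 3 → σ.narr 7 i = σ.narr 6 i - N.rate * N.arr i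

theorem Core.sameBut (h : Core N σ) {a : ℕ} (ha : 12 ≤ a) (hs : SameBut a σ τ) : Core N τ := by
  have e : ∀ b < 12, τ.iarr b = σ.iarr b := fun b hb => hs.iarr b (by omega)
  constructor
  · exact h.pres.sameBut (by omega) hs
  · rw [e 4 (by omega), e 5 (by omega)]; exact h.dep
  · rw [e 6 (by omega), e 7 (by omega)]; exact h.arr
  · rw [e 4 (by omega), e 10 (by omega), e 11 (by omega), e 3 (by omega), hs.narr,
      hs.ireg 12 (by omega), hs.ireg 11 (by omega)]
    exact h.inv
  · rw [e 10 (by omega), e 2 (by omega), hs.narr]; exact h.out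
  · rw [e 10 (by omega), hs.narr]; exact h.offset

/-- The queue is well-formed. -/
def QueueOk (N : Network) (σ : State) : Prop := IsTree N.m (σ.iarr 12) (queue.key σ) id

/-- The range minimum tree is well-formed. -/
def RangesOk (N : Network) (σ : State) : Prop := IsTree N.m (σ.iarr 13) (ranges.key σ) (σ.iarr 6)

theorem queue_key (σ : State) (i : ℕ) : queue.key σ i =
    [((σ.iarr 10 i / 2 : ℕ) : ℚ), σ.narr 0 i, (σ.iarr 10 i : ℚ), σ.narr 6 i] := rfl

theorem ranges_key (σ : State) (i : ℕ) : ranges.key σ i =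
    [((1 - (σ.iarr 10 i + 1) / 2 / 2 : ℕ) : ℚ), σ.narr 7 i] := rfl

theorem ranges_key_congr (h1 : τ.iarr 10 = σ.iarr 10) (h2 : τ.narr 7 = σ.narr 7) :
    ranges.key τ = ranges.key σ := by
  funext i; rw [ranges_key, ranges_key, h1, h2]

theorem RangesOk.sameBut (h : RangesOk N σ) (hs : SameBut 12 σ τ) : RangesOk N τ := by
  rw [RangesOk, hs.iarr 13 (by omega), hs.iarr 6 (by omega),
    ranges_key_congr (hs.iarr 10 (by omega)) (by rw [hs.narr])]
  exact h

theorem QueueOk.sameBut (h : QueueOk N σ) (hs : SameBut 13 σ τ) : QueueOk N τ := by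
  have : queue.key τ = queue.key σ := by
    funext i; rw [queue_key, queue_key, hs.iarr 10 (by omega), hs.narr]
  rw [QueueOk, hs.iarr 12 (by omega), this]
  exact h

/-- Repair of the queue after the key of the arc in register `10` has changed. -/
theorem queue_refresh_ter {ρ : State} {x k : ℕ} (hQ : QueueOk N σ) (hc : Core N ρ)
    (hx : ρ.ireg 10 = x) (hxm : x < N.m) (hk : 2 * N.m < 2 ^ k) (ht : ρ.iarr 12 = σ.iarr 12)
    (hst : ∀ j, j ≠ x → ρ.iarr 10 j = σ.iarr 10 j) (htime : ρ.narr 0 = σ.narr 0)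
    (hD : ∀ j, j ≠ x → ρ.narr 6 j = σ.narr 6 j) :
    Ter (queue.refresh (.reg 10)) ρ (k + 1) fun τ => SameBut 12 ρ τ ∧ Core N τ ∧ QueueOk N τ := by
  refine (queue.refresh_ter (m := N.m) (i := x) (leaf := id) (key₀ := queue.key σ) hc.pres.m
    ?_ hxm hk ?_ ?_ ?_).mono le_rfl ?_
  · simpa [IExp.eval] using hx
  · change IsTree N.m (ρ.iarr 12) _ _
    rw [ht]; exact hQ
  · intro i _ j _ h; exact h
  · intro j hj
    rw [queue_key, queue_key, hst j hj, htime, hD j hj]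
  · rintro τ ⟨hs, ht'⟩
    exact ⟨hs, hc.sameBut le_rfl hs, ht'⟩

theorem activeTest_holds (hp : Presents N σ) : activeTest.holds σ ↔
    σ.ireg 11 < N.m ∧ N.depKey (σ.iarr 4 (σ.ireg 11)) = N.headKey (σ.ireg 12) ∧
      σ.iarr 11 (σ.iarr 4 (σ.ireg 11)) = 0 := by
  simp [activeTest, Test.holds, IExp.eval, NExp.eval, hp.m, hp.src, hp.dst, hp.time,
    Network.depKey_eq_headKey]

/-- The step is paid for by marking `x` as done. A change of status from `2` back to `1` is free, as
both carry the same potential. -/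
theorem relaxArc_ter {k : ℕ} (hk : 2 * N.m < 2 ^ k) (hc : Core N σ) (hQ : QueueOk N σ)
    (hR : RangesOk N σ) (ha : activeTest.holds σ) :
    Ter relaxArc σ (k + 1) fun τ => Core N τ ∧ QueueOk N τ ∧ RangesOk N τ ∧
      N.pot (τ.iarr 10) (τ.iarr 11) + 1 ≤ N.pot (σ.iarr 10) (σ.iarr 11) := by
  have h1 : 1 ≤ k + 1 := by omega
  rw [activeTest_holds hc.pres] at ha
  obtain ⟨hp, hkey, hd⟩ := ha
  set p := σ.ireg 11 with hp'
  set e := σ.ireg 12 with he'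
  obtain ⟨x, hx⟩ : ∃ x, σ.iarr 4 p = x := ⟨_, rfl⟩
  have hxm : x < N.m := hx ▸ hc.dep.out_lt p hp
  rw [hx] at hd
  refine Ter.cons (Ter.setI h1 (Ter.cons ?_))
  simp only [IExp.eval, ← hp', hx]
  have hs1 : Presents N (σ.setI 10 x) := hc.pres.congr
    (fun r hr => by rw [State.setI_ireg, if_neg (by omega)]) rfl rfl (fun _ _ => rfl) rfl
  refine (improveLabel_ter (x := x) (e := e) hs1 (by simp) (by simp [he']) h1).mono le_rfl ?_
  intro ρ hρ
  simp only [State.setI_iarr, State.setI_narr] at hρ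
  -- the common part of both cases
  have key : ∀ sx px dx, Relabel x sx px dx (σ.setI 10 x) ρ →
      (σ.iarr 10 x ≠ 3 ∧ sx ≠ 3 ∧ sx ≠ 0 ∧ σ.iarr 10 x ≠ 0 ∨ sx = σ.iarr 10 x ∧ dx = σ.narr 6 x) →
      N.Inv (σ.iarr 4) (Function.update (σ.iarr 10) x sx) (Function.update (σ.iarr 11) x 1)
        (Function.update (σ.iarr 3) x px) (Function.update (σ.narr 6) x dx) e (p + 1) →
      Ter (block [.storeI 11 (.reg 10) (.const 1), .setI 11 (.add (.reg 11) (.const 1)),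
        queue.refresh (.reg 10)]) ρ (k + 1) fun τ => Core N τ ∧ QueueOk N τ ∧ RangesOk N τ ∧
          N.pot (τ.iarr 10) (τ.iarr 11) + 1 ≤ N.pot (σ.iarr 10) (σ.iarr 11) := by
    intro sx px dx hr hsx hinv
    refine Ter.cons (Ter.storeI h1 (Ter.cons (Ter.setI h1 (Ter.cons ?_))))
    have hρ10 : ρ.ireg 10 = x := by rw [hr.ireg 10 (by omega)]; simp
    have hρ11 : ρ.ireg 11 = p := by rw [hr.ireg 11 (by omega)]; simp [hp']
    have hρ12 : ρ.ireg 12 = e := by rw [hr.ireg 12 (by omega)]; simp [he']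
    have hi : ∀ a, a ≠ 3 → a ≠ 10 → ρ.iarr a = σ.iarr a := hr.iarr
    have hst : ρ.iarr 10 = Function.update (σ.iarr 10) x sx := hr.st
    have hpr : ρ.iarr 3 = Function.update (σ.iarr 3) x px := hr.pred
    have hD : ρ.narr 6 = Function.update (σ.narr 6) x dx := hr.D
    have hn : ∀ a, a ≠ 6 → ρ.narr a = σ.narr a := hr.narr
    have hpres : Presents N ρ := hr.presents hs1
    simp only [IExp.eval, State.storeI_ireg, hρ10, hρ11]
    set υ := (ρ.storeI 11 x 1).setI 11 (p + 1) with hυ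
    have hυd : υ.iarr 11 = Function.update (σ.iarr 11) x 1 := by
      simp [hυ, hi 11 (by omega) (by omega)]
    have hυi : ∀ a, a ≠ 11 → υ.iarr a = ρ.iarr a := by intro a ha; simp [hυ, ha]
    have hυn : υ.narr = ρ.narr := rfl
    have hυc : Core N υ := by
      constructor
      · exact hpres.congr (fun r hr => by simp [hυ]; omega) (hυi 0 (by omega)) (hυi 1 (by omega))
          (fun _ _ => rfl) rfl
      · rw [hυi 4 (by omega), hυi 5 (by omega), hi 4 (by omega) (by omega),
          hi 5 (by omega) (by omega)]
        exact hc.dep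
      · rw [hυi 6 (by omega), hυi 7 (by omega), hi 6 (by omega) (by omega),
          hi 7 (by omega) (by omega)]
        exact hc.arr
      · rw [hυi 4 (by omega), hυi 10 (by omega), hυd, hυi 3 (by omega),
          hi 4 (by omega) (by omega), hst, hpr, hυn, hD]
        have e11 : υ.ireg 11 = p + 1 := by simp [hυ]
        have e12 : υ.ireg 12 = e := by simp [hυ, hρ12]
        rw [e11, e12]
        exact hinv
      · rw [hυi 10 (by omega), hυi 2 (by omega), hυn, hst, hD, hi 2 (by omega) (by omega),
          hn 5 (by omega)]
        rcases hsx with ⟨a, b, -, -⟩ | ⟨rfl, rfl⟩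
        · exact hc.out.update a b
        · simpa using hc.out
      · rw [hυi 10 (by omega), hυn, hst, hD, hn 7 (by omega)]
        intro i him hi3
        by_cases hix : i = x
        · subst hix
          rcases hsx with ⟨a, b, -, -⟩ | ⟨rfl, rfl⟩
          · simp at hi3; omega
          · simp at hi3 ⊢; exact hc.offset i him hi3
        · rw [Function.update_of_ne hix] at hi3 ⊢
          exact hc.offset i him hi3
    refine (queue_refresh_ter hQ hυc (by simp [hυ, hρ10]) hxm hk ?_ ?_ ?_ ?_).mono le_rfl ?_
    · rw [hυi 12 (by omega), hi 12 (by omega) (by omega)]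
    · intro j hj; rw [hυi 10 (by omega), hst, Function.update_of_ne hj]
    · rw [hυn, hn 0 (by omega)]
    · intro j hj; rw [hυn, hD, Function.update_of_ne hj]
    · rintro τ ⟨hs, hτc, hτq⟩
      refine Ter.nil h1 ⟨hτc, hτq, RangesOk.sameBut ?_ hs, ?_⟩
      · rw [RangesOk, hυi 13 (by omega), hυi 6 (by omega), hi 13 (by omega) (by omega),
          hi 6 (by omega) (by omega)]
        -- The range tree distinguishes only settled from unsettled arcs and uses the offsets stored
        -- on settling, so relabelling an unsettled arc leaves its keys unchanged.
        have hkeq : ranges.key υ = ranges.key σ := by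
          funext i
          rw [ranges_key, ranges_key, hυi 10 (by omega), hst, hυn, hn 7 (by omega)]
          by_cases hix : i = x
          · subst hix
            rw [Function.update_self]
            rcases hsx with ⟨a, b, -, -⟩ | ⟨rfl, rfl⟩
            · have h3 : σ.iarr 10 i ≤ 3 := hc.inv.st_le i hxm
              have h3' : sx ≤ 3 := by
                have := hinv.st_le i hxm; rwa [Function.update_self] at this
              rw [show (sx + 1) / 2 / 2 = 0 by omega, show (σ.iarr 10 i + 1) / 2 / 2 = 0 by omega]
            · rfl
          · rw [Function.update_of_ne hix]
        rw [hkeq]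
        exact hR
      · rw [hs.iarr 10 (by omega), hs.iarr 11 (by omega), hυi 10 (by omega), hυd, hst]
        have e1 := N.pot_update_st (st := σ.iarr 10) (done := Function.update (σ.iarr 11) x 1) hxm sx
        have e2 := N.pot_update_done (st := σ.iarr 10) (done := σ.iarr 11) hxm 1
        rw [if_pos hd, if_neg (by omega)] at e2
        rcases hsx with ⟨a, b, c, d⟩ | ⟨rfl, rfl⟩
        · rw [if_neg d, if_neg a, if_neg c, if_neg b] at e1; omega
        · omega
  rcases hρ with ⟨himp, hr⟩ | ⟨himp, rfl⟩
  · refine key _ _ _ hr (.inl (by omega)) ?_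
    have hinv := hc.inv.improve hc.dep hp hkey hx himp
    refine hinv.advance hc.dep hp hkey hx ⟨.inl (by simp), ?_⟩
    -- The relaxing arc is settled, the relabelled one is not; hence the label of `e` in the offer
    -- is unaffected by the update.
    have hex : e ≠ x := by
      rintro h
      have := (hc.inv.pend hp).2.1
      rw [← he', h] at this
      omega
    change _ ≤ N.append (Function.update (σ.narr 6) x _ e) e x
    rw [Function.update_of_ne hex]
    simp [← he']
  · refine key _ _ _ (Relabel.refl x _) (.inr ⟨rfl, rfl⟩) ?_
    simp only [State.setI_iarr, State.setI_narr, Function.update_eq_self]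
    exact hc.inv.advance hc.dep hp hkey hx (hc.inv.good_of_not_improve hc.dep hp hkey hx himp)

end RAM

/-! ### Settling and opening arcs on the machine, and the main loop -/

namespace RAM

variable {N : Network} {σ τ : State}

theorem ranges_refresh_ter {ρ : State} {x k : ℕ} {e : IExp} (hR : RangesOk N σ) (hc : Core N ρ)
    (hQ : QueueOk N ρ) (he : e.eval ρ = ρ.iarr 7 x - 1) (hxm : x < N.m) (hk : 2 * N.m < 2 ^ k)
    (ht : ρ.iarr 13 = σ.iarr 13) (ho : ρ.iarr 6 = σ.iarr 6)
    (hst : ∀ j, j ≠ x → ρ.iarr 10 j = σ.iarr 10 j) (hD : ∀ j, j ≠ x → ρ.narr 7 j = σ.narr 7 j) :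
    Ter (ranges.refresh e) ρ (k + 1) fun τ => SameBut 13 ρ τ ∧ Core N τ ∧ QueueOk N τ ∧
      RangesOk N τ := by
  have h1 := hc.arr.rank_pos x hxm
  have h2 := hc.arr.rank_le x hxm
  refine (ranges.refresh_ter (m := N.m) (i := ρ.iarr 7 x - 1) (leaf := ρ.iarr 6)
    (key₀ := ranges.key σ) hc.pres.m he (by omega) hk ?_ ?_ ?_).mono le_rfl ?_
  · change IsTree N.m (ρ.iarr 13) _ _
    rw [ht, ho]; exact hR
  · intro i hi j hj h
    have := hc.arr.rank_out i hi
    rw [h, hc.arr.rank_out j hj] at this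
    omega
  · intro j hj
    rw [hc.arr.out_rank x hxm] at hj
    rw [ranges_key, ranges_key, hst j hj, hD j hj]
  · rintro τ ⟨hs, ht'⟩
    refine ⟨hs, hc.sameBut (a := 13) (by omega) hs, hQ.sameBut hs, ?_⟩
    have : τ.iarr 6 = ρ.iarr 6 := hs.iarr 6 (by decide)
    rw [RangesOk, this]
    exact ht'

theorem recordArc_ter {k : ℕ} (hp : Presents N σ) {st : ℕ → ℕ} (hk : 1 ≤ k) {x : ℕ}
    (hx : σ.ireg 10 = x) (hxm : x < N.m) (hx3 : st x ≠ 3)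
    (ho : N.OutOk st (σ.narr 6) (σ.iarr 2) (σ.narr 5)) :
    Ter recordArc σ k fun τ => τ.ireg = σ.ireg ∧ τ.nreg = σ.nreg ∧
      (∀ a, a ≠ 2 → τ.iarr a = σ.iarr a) ∧ (∀ a, a ≠ 5 → τ.narr a = σ.narr a) ∧
      N.OutOk (Function.update st x 3) (σ.narr 6) (τ.iarr 2) (τ.narr 5) := by
  obtain ⟨h1, h2⟩ := ho.settle hxm hx3
  refine Ter.cond hk (fun h => ?_) (fun h => Ter.skip hk ⟨rfl, rfl, fun _ _ => rfl,
    fun _ _ => rfl, h2 ?_⟩)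
  · refine Ter.cons (Ter.storeI hk (Ter.cons (Ter.storeN hk (Ter.nil hk ⟨rfl, rfl, ?_, ?_, ?_⟩))))
    · intro a ha; simp [ha]
    · intro a ha; simp [ha]
    · simp [Test.holds, NExp.eval, IExp.eval, hx, hp.dst] at h ⊢
      exact h1 h
  · simpa [Test.holds, NExp.eval, IExp.eval, hx, hp.dst] using h

theorem findBlock_ter {k : ℕ} (hp : Presents N σ) (hk : 2 * N.m < 2 ^ k) {x : ℕ}
    (hx : σ.ireg 10 = x) (hS : SortedBy N.m N.depKey (σ.iarr 4) (σ.iarr 5)) :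
    Ter findBlock σ (k + 1) fun τ => ∃ ρ p', Scratch σ ρ ∧ τ = ρ.setI 11 p' ∧
      ((p' = N.m ∧ ¬ (N.trans x = 0 ∧ N.α (N.dst x) = 0)) ∨
        ((N.trans x = 0 ∧ N.α (N.dst x) = 0) ∧
          ∀ q < N.m, N.depKey (σ.iarr 4 q) < N.headKey x ↔ q < p')) := by
  have h1 : 1 ≤ k + 1 := by omega
  refine Ter.cond h1 (fun h => ?_) (fun h => Ter.setI h1 ?_)
  · refine Ter.cons ((search_ter (a := 4) (m := N.m) (k := k) (σ := σ)
      (fun i => N.depKey i < N.headKey x) hp.m (by omega) ?_ ?_).mono le_rfl ?_)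
    · intro τ hs
      have hτ := hp.scratch hs
      simp [beforeBlock, Test.holds, NExp.eval, IExp.eval, hτ.src, hτ.dst, hτ.time,
        hs.ireg 10, hx, Network.depKey, Network.headKey, List.cons_lt_cons_iff]
    · intro i j hij hj hlt
      exact (hS.mono i j hij hj).trans_lt hlt
    · rintro τ ⟨hs, hle, hq⟩
      refine Ter.cons (Ter.setI h1 (Ter.nil h1 ⟨τ, _, hs, rfl, .inr ⟨?_, hq⟩⟩))
      simpa [Test.holds, NExp.eval, IExp.eval, hx, hp.dst, hp.trans, hp.α] using h
  · refine ⟨σ, _, Scratch.refl σ, rfl, .inl ⟨hp.m, ?_⟩⟩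
    simpa [Test.holds, NExp.eval, IExp.eval, hx, hp.dst, hp.trans, hp.α] using h

theorem settleArc_ter {k x : ℕ} (hk : 2 * N.m < 2 ^ k) (hc : Core N σ) (hQ : QueueOk N σ)
    (hR : RangesOk N σ) (ha : ¬ activeTest.holds σ) (hx : σ.ireg 10 = x) (hxm : x < N.m)
    (hx1 : σ.iarr 10 x = 1)
    (hmin : ∀ j < N.m, σ.iarr 10 j ≤ 1 → N.time x < N.time j ∨
      N.time x = N.time j ∧ σ.iarr 10 j = 1 ∧ σ.narr 6 x ≤ σ.narr 6 j) :
    Ter settleArc σ (k + 1) fun τ => Core N τ ∧ QueueOk N τ ∧ RangesOk N τ ∧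
      N.pot (τ.iarr 10) (τ.iarr 11) + 1 ≤ N.pot (σ.iarr 10) (σ.iarr 11) := by
  have h1 : 1 ≤ k + 1 := by omega
  rw [activeTest_holds hc.pres] at ha
  have hinv := hc.inv.inactive hc.dep ha
  refine Ter.cons (Ter.storeI h1 (Ter.cons (Ter.storeN h1 (Ter.cons ?_))))
  have hpres1 : Presents N (σ.storeI 10 x 3) :=
    hc.pres.congr (fun r hr => rfl) (by simp) (by simp) (fun _ _ => rfl) rfl
  simp only [IExp.eval, State.storeI_ireg, hx, hpres1.offsetE_eval, State.storeI_narr]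
  set d := σ.narr 6 x - N.rate * N.arr x with hd
  set σ₁ := (σ.storeI 10 x 3).storeN 7 x d with hσ₁
  have hpres : Presents N σ₁ :=
    hc.pres.congr (fun r hr => rfl) (by simp [hσ₁]) (by simp [hσ₁])
      (fun a ha => by simp [hσ₁]; intro; omega) rfl
  have i1 : ∀ a, a ≠ 10 → σ₁.iarr a = σ.iarr a := by intro a ha; simp [hσ₁, ha]
  have n1 : ∀ a, a ≠ 7 → σ₁.narr a = σ.narr a := by intro a ha; simp [hσ₁, ha]
  have st1 : σ₁.iarr 10 = Function.update (σ.iarr 10) x 3 := by simp [hσ₁]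
  have k1 : σ₁.narr 7 = Function.update (σ.narr 7) x d := by simp [hσ₁]
  have r1 : σ₁.ireg = σ.ireg := rfl
  clear_value σ₁
  refine (recordArc_ter (st := σ.iarr 10) hpres h1 (x := x) (by rw [r1, hx]) hxm (by omega)
    ?_).mono le_rfl ?_
  · rw [n1 6 (by omega), n1 5 (by omega), i1 2 (by omega)]; exact hc.out
  rintro σ₂ ⟨r2, g2, i2, n2, ho2⟩
  have hpres2 : Presents N σ₂ := hpres.congr (fun r _ => by rw [r2]) (i2 0 (by omega))
    (i2 1 (by omega)) (fun a ha => n2 a (by omega)) g2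
  refine Ter.cons (Ter.setI h1 (Ter.cons ?_))
  have hev : IExp.eval σ₂ (.reg 10) = x := by rw [IExp.eval, r2, r1, hx]
  rw [hev]
  have hpres3 : Presents N (σ₂.setI 12 x) := hpres2.congr
    (fun r hr => by rw [State.setI_ireg, if_neg (by omega)]) rfl rfl (fun _ _ => rfl) rfl
  refine (findBlock_ter (x := x) hpres3 hk (by simp [r2, r1, hx]) ?_).mono le_rfl ?_
  · simp only [State.setI_iarr]
    rw [i2 4 (by omega), i2 5 (by omega), i1 4 (by omega), i1 5 (by omega)]
    exact hc.dep
  rintro υ ⟨σ₃, p', hs3, rfl, hp'⟩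
  have i3 : ∀ a, a ≠ 2 → a ≠ 10 → (σ₃.setI 11 p').iarr a = σ.iarr a := by
    intro a h2 h10
    simp only [State.setI_iarr, hs3.iarr, i2 a h2, i1 a h10]
  have st3 : (σ₃.setI 11 p').iarr 10 = Function.update (σ.iarr 10) x 3 := by
    simp only [State.setI_iarr, hs3.iarr, i2 10 (by omega), st1]
  have n3 : ∀ a, a ≠ 5 → a ≠ 7 → (σ₃.setI 11 p').narr a = σ.narr a := by
    intro a h5 h7
    simp only [State.setI_narr, hs3.narr, n2 a h5, n1 a h7]
  have k3 : (σ₃.setI 11 p').narr 7 = Function.update (σ.narr 7) x d := by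
    simp only [State.setI_narr, hs3.narr, n2 7 (by omega), k1]
  have ho3 : N.OutOk (Function.update (σ.iarr 10) x 3) (σ.narr 6) ((σ₃.setI 11 p').iarr 2)
      ((σ₃.setI 11 p').narr 5) := by
    simp only [State.setI_iarr, State.setI_narr, hs3.iarr, hs3.narr]
    rwa [n1 6 (by omega)] at ho2
  have hpres4 : Presents N (σ₃.setI 11 p') := (hpres3.scratch hs3).congr
    (fun r hr => by rw [State.setI_ireg, if_neg (by omega)]) rfl rfl (fun _ _ => rfl) rfl
  have r10 : (σ₃.setI 11 p').ireg 10 = x := by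
    simp [hs3.ireg 10 (by omega), r2, r1, hx]
  have r11 : (σ₃.setI 11 p').ireg 11 = p' := by simp
  have r12 : (σ₃.setI 11 p').ireg 12 = x := by simp [hs3.ireg 12 (by omega)]
  simp only [State.setI_iarr, i2 4 (show 4 ≠ 2 by omega), i1 4 (show 4 ≠ 10 by omega)] at hp'
  generalize σ₃.setI 11 p' = υ at *
  have hcυ : Core N υ := by
    constructor
    · exact hpres4
    · rw [i3 4 (by omega) (by omega), i3 5 (by omega) (by omega)]; exact hc.dep
    · rw [i3 6 (by omega) (by omega), i3 7 (by omega) (by omega)]; exact hc.arr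
    · rw [i3 4 (by omega) (by omega), i3 11 (by omega) (by omega), i3 3 (by omega) (by omega),
        st3, n3 6 (by omega) (by omega), r11, r12]
      exact hinv.settle hc.dep hxm hx1 hmin hp'
    · rw [st3, n3 6 (by omega) (by omega)]; exact ho3
    · rw [st3, n3 6 (by omega) (by omega), k3]
      intro i hi hi3
      by_cases hix : i = x
      · subst hix; simp [hd]
      · rw [Function.update_of_ne hix] at hi3 ⊢
        exact hc.offset i hi hi3
  refine Ter.cons ((queue_refresh_ter hQ hcυ r10 hxm hk (i3 12 (by omega) (by omega)) ?_
    (n3 0 (by omega) (by omega)) ?_).mono le_rfl ?_)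
  · intro j hj; rw [st3, Function.update_of_ne hj]
  · intro j hj; rw [n3 6 (by omega) (by omega)]
  rintro ρ ⟨hsρ, hcρ, hqρ⟩
  refine Ter.cons ((ranges_refresh_ter (x := x) hR hcρ hqρ ?_ hxm hk ?_ ?_ ?_ ?_).mono le_rfl ?_)
  · simp [IExp.eval, hsρ.ireg 10, r10]
  · rw [hsρ.iarr 13 (by omega), i3 13 (by omega) (by omega)]
  · rw [hsρ.iarr 6 (by omega), i3 6 (by omega) (by omega)]
  · intro j hj; rw [hsρ.iarr 10 (by omega), st3, Function.update_of_ne hj]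
  · intro j hj; rw [hsρ.narr, k3, Function.update_of_ne hj]
  rintro τ ⟨hsτ, hcτ, hqτ, hrτ⟩
  refine Ter.nil h1 ⟨hcτ, hqτ, hrτ, ?_⟩
  rw [hsτ.iarr 10 (by omega), hsτ.iarr 11 (by omega), hsρ.iarr 10 (by omega),
    hsρ.iarr 11 (by omega), st3, i3 11 (by omega) (by omega)]
  have := N.pot_update_st (st := σ.iarr 10) (done := σ.iarr 11) hxm 3
  rw [hx1] at this
  simp at this
  omega

/-- Everything is stated relative to the state `σ` before `x` was opened, so that start label and
predecessor label merge into a single relabelling, as `Inv.openArc` requires. -/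
theorem labelPred_ter {k x sx px : ℕ} {dx : ℚ} (hk : 2 * N.m < 2 ^ k) (hc : Core N σ)
    (hR : RangesOk N σ) (hx : σ.ireg 10 = x) (hx0 : σ.iarr 10 x = 0) (hsx : sx = 1 ∨ sx = 2)
    {τ : State} (hτ : Relabel x sx px dx σ τ) :
    Ter labelPred τ (k + 1) fun ρ => ∃ sx' px' dx', Relabel x sx' px' dx' σ ρ ∧
      (sx' = 1 ∨ sx' = 2) ∧ (sx = 1 → sx' = 1 ∧ dx' ≤ dx) ∧
      ((sx', px', dx') = (sx, px, dx) ∨ sx' = 1 ∧ ∃ e < N.m, σ.iarr 10 e = 3 ∧ N.Fol e x ∧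
        px' = e + 1 ∧ dx' = N.append (σ.narr 6 e) e x) ∧
      ∀ e < N.m, σ.iarr 10 e = 3 → N.Fol e x → sx' = 1 ∧ dx' ≤ N.append (σ.narr 6 e) e x := by
  have h1 : 1 ≤ k + 1 := by omega
  have hp := hτ.presents hc.pres
  have h6 : τ.iarr 6 = σ.iarr 6 := hτ.iarr 6 (by omega) (by omega)
  have hx' : τ.ireg 10 = x := by rw [hτ.ireg 10 (by omega), hx]
  have hA := hc.arr
  set A := σ.iarr 6 with hA'
  -- the two binary searches
  refine Ter.cons ((search_ter (a := 6) (m := N.m) (k := k) (σ := τ)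
    (fun i => N.arrKey i < [(N.src x : ℚ), N.time x - N.β (N.src x)]) hp.m (by omega) ?_ ?_).mono
    le_rfl ?_)
  · intro ρ hs
    have hρ := hp.scratch hs
    simp [beforeWindow, Test.holds, NExp.eval, IExp.eval, hρ.src, hρ.dst, hρ.time, hρ.arrE_eval,
      hρ.β, hs.ireg 10, hx', Network.arrKey, List.cons_lt_cons_iff, lt_sub_iff_add_lt]
  · intro i j hij hj hlt
    rw [h6] at *
    exact (hA.mono i j hij hj).trans_lt hlt
  rintro τ₁ ⟨hs₁, hle₁, hlo⟩
  rw [h6] at hlo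
  refine Ter.cons (Ter.setI h1 (Ter.cons ?_))
  simp only [IExp.eval]
  generalize τ₁.ireg 24 = lo at *
  have hτ₂ : Relabel x sx px dx σ (τ₁.setI 13 lo) := (hτ.scratch hs₁).setI (by omega)
  have r13 : (τ₁.setI 13 lo).ireg 13 = lo := by simp
  generalize τ₁.setI 13 lo = τ₂ at *
  have hp₂ := hτ₂.presents hc.pres
  have hx₂ : τ₂.ireg 10 = x := by rw [hτ₂.ireg 10 (by omega), hx]
  have h6₂ : τ₂.iarr 6 = A := hτ₂.iarr 6 (by omega) (by omega)
  refine (search_ter (a := 6) (m := N.m) (k := k) (σ := τ₂)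
    (fun i => N.arrKey i ≤ [(N.src x : ℚ), N.time x - N.α (N.src x)]) hp₂.m (by omega) ?_ ?_).mono
    le_rfl ?_
  · intro ρ hs
    have hρ := hp₂.scratch hs
    simp [upToWindow, Test.holds, NExp.eval, IExp.eval, hρ.src, hρ.dst, hρ.time, hρ.arrE_eval,
      hρ.α, hs.ireg 10, hx₂, Network.arrKey, cons_le_cons_iff_rat]
    simp only [← le_iff_lt_or_eq, le_sub_iff_add_le]
  · intro i j hij hj hlt
    rw [h6₂] at *
    exact (hA.mono i j hij hj).trans hlt
  rintro τ₃ ⟨hs₃, hle₃, hhi⟩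
  rw [h6₂] at hhi
  refine Ter.cons (Ter.setI h1 (Ter.cons ?_))
  simp only [IExp.eval]
  generalize τ₃.ireg 24 = hi at *
  have hτ₄ : Relabel x sx px dx σ (τ₃.setI 14 hi) := (hτ₂.scratch hs₃).setI (by omega)
  have r13' : (τ₃.setI 14 hi).ireg 13 = lo := by simp [hs₃.ireg 13, r13]
  have r14 : (τ₃.setI 14 hi).ireg 14 = hi := by simp
  generalize τ₃.setI 14 hi = τ₄ at *
  -- the arcs in the window
  have hwin : ∀ q < N.m, (lo ≤ q ∧ q < hi) ↔ N.Fol (A q) x := by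
    intro q hq
    rw [← not_lt, ← hlo q hq, ← hhi q hq, not_lt]
    simp only [Network.arrKey, cons_le_cons_iff_rat, Network.Fol, le_refl, and_true]
    have e1 : ∀ a b : ℚ, (a < b ∨ a = b) ↔ a ≤ b := fun a b => le_iff_lt_or_eq.symm
    rw [e1, e1]
    constructor
    · rintro ⟨a, b⟩
      have hd : (N.dst (A q) : ℚ) = N.src x := by
        rcases a with a | a <;> rcases b with b | b
        · linarith
        · exact b.1
        · exact a.1.symm
        · exact b.1
      have hd' : N.dst (A q) = N.src x := by exact_mod_cast hd
      rw [hd'] at a b ⊢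
      simp at a b
      exact ⟨rfl, by linarith, by linarith⟩
    · rintro ⟨a, b, c⟩
      rw [a] at b c ⊢
      exact ⟨.inr ⟨rfl, by linarith⟩, .inr ⟨rfl, by linarith⟩⟩
  have hwin' : ∀ e < N.m, N.Fol e x → ∃ q < N.m, lo ≤ q ∧ q < hi ∧ A q = e := by
    intro e he hf
    have e1 := hA.rank_pos e he
    have e2 := hA.rank_le e he
    have e3 := hA.out_rank e he
    have e4 := (hwin (σ.iarr 7 e - 1) (by omega)).2 (by rw [e3]; exact hf)
    exact ⟨_, by omega, e4.1, e4.2, e3⟩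
  refine Ter.cond h1 (fun h => ?_) (fun h => Ter.skip h1 (Ter.nil h1 ?_))
  swap
  · simp only [Test.holds, IExp.eval, r13', r14] at h
    refine ⟨sx, px, dx, hτ₄, hsx, fun h => ⟨h, le_rfl⟩, .inl rfl, fun e he he3 hf => ?_⟩
    obtain ⟨q, -, h2, h3, -⟩ := hwin' e he hf
    omega
  simp only [Test.holds, IExp.eval, r13', r14] at h
  have hp₄ := hτ₄.presents hc.pres
  have st₄ : τ₄.iarr 10 = Function.update (σ.iarr 10) x sx := hτ₄.st
  have hkeys : ranges.key τ₄ = ranges.key σ := by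
    funext i
    rw [ranges_key, ranges_key, st₄, hτ₄.narr 7 (by omega)]
    by_cases hix : i = x
    · subst hix
      rw [Function.update_self]
      rw [hx0, show (sx + 1) / 2 / 2 = 0 by omega]
    · rw [Function.update_of_ne hix]
  refine Ter.cons ((ranges.query_ter (m := N.m) (k := k) (leaf := A) hp₄.m (by omega) r13' r14 h hle₃
    hk ?_).mono le_rfl ?_)
  · change IsTree N.m (τ₄.iarr 13) (ranges.key τ₄) A
    rw [hτ₄.iarr 13 (by omega) (by omega), hkeys]
    exact hR
  rintro τ₅ ⟨hs₅, q, hq1, hq2, hq3, hq4⟩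
  rw [hkeys] at hq4
  obtain ⟨b, hb⟩ : ∃ b, A q = b := ⟨_, rfl⟩
  have hqm : q < N.m := by omega
  have hbm : b < N.m := hb ▸ hA.out_lt q hqm
  have hbf : N.Fol b x := hb ▸ (hwin q hqm).1 ⟨hq1, hq2⟩
  rw [hb] at hq3 hq4
  refine Ter.cons (Ter.setI h1 (Ter.cons ?_))
  simp only [IExp.eval, hq3]
  have hτ₆ : Relabel x sx px dx σ (τ₅.setI 15 b) := (hτ₄.scratch hs₅).setI (by omega)
  have r15 : (τ₅.setI 15 b).ireg 15 = b := by simp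
  generalize τ₅.setI 15 b = τ₆ at *
  have hp₆ := hτ₆.presents hc.pres
  have hx₆ : τ₆.ireg 10 = x := by rw [hτ₆.ireg 10 (by omega), hx]
  have hstx : τ₆.iarr 10 x = sx := by rw [hτ₆.st, Function.update_self]
  have hDx : τ₆.narr 6 x = dx := by rw [hτ₆.D, Function.update_self]
  have hst : ∀ e, e ≠ x → τ₆.iarr 10 e = σ.iarr 10 e := fun e he => by
    rw [hτ₆.st, Function.update_of_ne he]
  have hD : ∀ e, e ≠ x → τ₆.narr 6 e = σ.narr 6 e := fun e he => by
    rw [hτ₆.D, Function.update_of_ne he]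
  have h3x : ∀ e, σ.iarr 10 e = 3 → e ≠ x := by rintro e h rfl; omega
  have hst3 : τ₆.iarr 10 b = 3 ↔ σ.iarr 10 b = 3 := by
    by_cases hbx : b = x
    · rw [hbx, hstx]; omega
    · rw [hst b hbx]
  -- A settled arc has leading key component `0`, so if the window contains one, the winner is
  -- settled as well. Among settled arcs least offset means least appended value, as `rate * arr` is
  -- already subtracted and `base x` is common to all.
  have hbest : ∀ e < N.m, σ.iarr 10 e = 3 → N.Fol e x → σ.iarr 10 b = 3 ∧
      N.append (σ.narr 6 b) b x ≤ N.append (σ.narr 6 e) e x := by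
    intro e he he3 hf
    obtain ⟨r, hr, hr1, hr2, hre⟩ := hwin' e he hf
    have := hq4 r hr1 hr2
    rw [hre, ranges_key, ranges_key, he3] at this
    norm_num [cons_le_cons_iff_rat] at this
    have h3 := hc.inv.st_le b hbm
    rcases this with h0 | ⟨h0, h4⟩
    · linarith [(Nat.cast_nonneg (1 - (σ.iarr 10 b + 1) / 2 / 2) : (0 : ℚ) ≤ _)]
    · have hb3 : σ.iarr 10 b = 3 := by omega
      refine ⟨hb3, ?_⟩
      rw [hc.offset b hbm hb3, hc.offset e he he3] at h4
      simp only [Network.append]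
      rw [← le_iff_lt_or_eq] at h4
      linarith
  refine Ter.cond h1 (fun h => ?_) (fun h => Ter.skip h1 (Ter.nil h1 (Ter.nil h1 ?_)))
  · simp only [Test.holds, IExp.eval, r15, hst3] at h
    have hbx := h3x b h
    refine (improveLabel_ter hp₆ hx₆ r15 h1).mono le_rfl ?_
    rw [hstx, hDx, hD b hbx]
    rintro ρ (⟨himp, hr⟩ | ⟨himp, rfl⟩)
    · refine Ter.nil h1 (Ter.nil h1 ⟨1, b + 1, _, hτ₆.trans hr, .inl rfl, fun hs => ⟨rfl, ?_⟩,
        .inr ⟨rfl, b, hbm, h, hbf, rfl, rfl⟩, fun e he he3 hf => ⟨rfl, (hbest e he he3 hf).2⟩⟩)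
      rcases himp with hi | hi
      · omega
      · exact hi.2.le
    · push Not at himp
      have hs1 : sx = 1 := hsx.resolve_right himp.1
      exact Ter.nil h1 (Ter.nil h1 ⟨sx, px, dx, hτ₆, hsx, fun h => ⟨h, le_rfl⟩, .inl rfl,
        fun e he he3 hf => ⟨hs1, (himp.2 hs1).trans (hbest e he he3 hf).2⟩⟩)
  · simp only [Test.holds, IExp.eval, r15, hst3] at h
    exact ⟨sx, px, dx, hτ₆, hsx, fun h => ⟨h, le_rfl⟩, .inl rfl,
      fun e he he3 hf => absurd (hbest e he he3 hf).1 h⟩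

theorem openArc_ter {k x : ℕ} (hk : 2 * N.m < 2 ^ k) (hc : Core N σ) (hQ : QueueOk N σ)
    (hR : RangesOk N σ) (ha : ¬ activeTest.holds σ) (hx : σ.ireg 10 = x) (hxm : x < N.m)
    (hx0 : σ.iarr 10 x = 0)
    (hmin : ∀ j < N.m, σ.iarr 10 j ≤ 1 → N.time x ≤ N.time j) :
    Ter openArc σ (k + 1) fun τ => Core N τ ∧ QueueOk N τ ∧ RangesOk N τ ∧
      N.pot (τ.iarr 10) (τ.iarr 11) + 1 ≤ N.pot (σ.iarr 10) (σ.iarr 11) := by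
  have h1 : 1 ≤ k + 1 := by omega
  rw [activeTest_holds hc.pres] at ha
  have hinv := hc.inv.inactive hc.dep ha
  refine Ter.cons (Ter.storeI h1 (Ter.cons ?_))
  simp only [IExp.eval, hx]
  have hr₁ : Relabel x 2 (σ.iarr 3 x) (σ.narr 6 x) σ (σ.storeI 10 x 2) :=
    ⟨by simp, by simp, by simp, fun a _ h => by simp [h], fun _ _ => rfl, rfl, fun _ _ => rfl⟩
  generalize σ.storeI 10 x 2 = σ₁ at *
  refine (labelStart_ter (hr₁.presents hc.pres) (x := x) (by rw [hr₁.ireg 10 (by omega), hx])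
    h1).mono le_rfl ?_
  intro σ₂ h₂
  have hlab : ∃ sx px dx, Relabel x sx px dx σ σ₂ ∧ (sx = 1 ∨ sx = 2) ∧
      (sx = 1 → px = 0 ∧ N.src x = N.source ∧ dx = N.start x) ∧
      (N.src x = N.source → sx = 1 ∧ dx ≤ N.start x) := by
    rcases h₂ with ⟨hs, hr⟩ | ⟨hs, rfl⟩
    · exact ⟨1, 0, _, hr₁.trans hr, .inl rfl, fun _ => ⟨rfl, hs, rfl⟩, fun _ => ⟨rfl, le_rfl⟩⟩
    · exact ⟨2, _, _, hr₁, .inr rfl, fun h => by omega, fun h => absurd h hs⟩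
  obtain ⟨sx, px, dx, hr₂, hsx, hl1, hl2⟩ := hlab
  refine Ter.cons ((labelPred_ter hk hc hR hx hx0 hsx hr₂).mono le_rfl ?_)
  rintro σ₃ ⟨sx', px', dx', hr₃, hsx', hle, hl3, hl4⟩
  refine Ter.cons (Ter.setI h1 (Ter.cons ?_))
  have hp₃ := hr₃.presents hc.pres
  simp only [IExp.eval, hp₃.m]
  set υ := σ₃.setI 11 N.m with hυ
  have st₃ : υ.iarr 10 = Function.update (σ.iarr 10) x sx' := hr₃.st
  have pr₃ : υ.iarr 3 = Function.update (σ.iarr 3) x px' := hr₃.pred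
  have D₃ : υ.narr 6 = Function.update (σ.narr 6) x dx' := hr₃.D
  have i₃ : ∀ a, a ≠ 3 → a ≠ 10 → υ.iarr a = σ.iarr a := hr₃.iarr
  have n₃ : ∀ a, a ≠ 6 → υ.narr a = σ.narr a := hr₃.narr
  have r10 : υ.ireg 10 = x := by simp [hυ, hr₃.ireg 10, hx]
  have r11 : υ.ireg 11 = N.m := by simp [hυ]
  have hpυ : Presents N υ := hp₃.congr
    (fun r hr => by rw [hυ, State.setI_ireg, if_neg (by omega)]) rfl rfl (fun _ _ => rfl) rfl
  clear_value υ
  have hcυ : Core N υ := by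
    constructor
    · exact hpυ
    · rw [i₃ 4 (by omega) (by omega), i₃ 5 (by omega) (by omega)]; exact hc.dep
    · rw [i₃ 6 (by omega) (by omega), i₃ 7 (by omega) (by omega)]; exact hc.arr
    · rw [i₃ 4 (by omega) (by omega), i₃ 11 (by omega) (by omega), pr₃, st₃, D₃, r11]
      refine (hinv.change_cur _).openArc hxm hx0 hmin hsx' ?_ ?_ hl4
      · intro h
        rcases hl3 with h3 | h3
        · simp only [Prod.mk.injEq] at h3
          obtain ⟨rfl, rfl, rfl⟩ := h3
          exact .inl (hl1 h)
        · exact .inr h3.2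
      · intro h
        obtain ⟨a, b⟩ := hl2 h
        obtain ⟨c, d⟩ := hle a
        exact ⟨c, d.trans b⟩
    · rw [st₃, D₃, i₃ 2 (by omega) (by omega), n₃ 5 (by omega)]
      exact hc.out.update (by omega) (by omega)
    · rw [st₃, D₃, n₃ 7 (by omega)]
      intro i hi hi3
      have hix : i ≠ x := by rintro rfl; rw [Function.update_self] at hi3; omega
      rw [Function.update_of_ne hix] at hi3 ⊢
      exact hc.offset i hi hi3
  refine (queue_refresh_ter hQ hcυ r10 hxm hk (i₃ 12 (by omega) (by omega)) ?_
    (n₃ 0 (by omega)) ?_).mono le_rfl ?_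
  · intro j hj; rw [st₃, Function.update_of_ne hj]
  · intro j hj; rw [D₃, Function.update_of_ne hj]
  rintro τ ⟨hs, hτc, hτq⟩
  refine Ter.nil h1 ⟨hτc, hτq, RangesOk.sameBut ?_ hs, ?_⟩
  · rw [RangesOk, i₃ 13 (by omega) (by omega), i₃ 6 (by omega) (by omega)]
    have hkeq : ranges.key υ = ranges.key σ := by
      funext i
      rw [ranges_key, ranges_key, st₃, n₃ 7 (by omega)]
      by_cases hix : i = x
      · subst hix
        rw [Function.update_self, hx0, show (sx' + 1) / 2 / 2 = 0 by omega]
      · rw [Function.update_of_ne hix]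
    rw [hkeq]
    exact hR
  · rw [hs.iarr 10 (by omega), hs.iarr 11 (by omega), st₃, i₃ 11 (by omega) (by omega)]
    have := N.pot_update_st (st := σ.iarr 10) (done := σ.iarr 11) hxm sx'
    rw [if_pos hx0, if_neg (by omega), if_neg (by omega)] at this
    omega

/-- The state `τ` holds labels from which an optimal solution can be read off. -/
def Solved (N : Network) (τ : State) : Prop :=
  ∃ (st : ℕ → ℕ) (D : ℕ → ℚ),
    (∀ f < N.m, N.src f = N.source → st f = 3 ∧ D f ≤ N.start f) ∧
    (∀ e < N.m, st e = 3 → ∀ f < N.m, N.Fol e f → st f = 3 ∧ D f ≤ N.append (D e) e f) ∧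
    (∀ i < N.m, st i = 3 → N.Reach st (τ.iarr 3) D i) ∧
    N.OutOk st D (τ.iarr 2) (τ.narr 5)

theorem mainLoop_ter {k : ℕ} (hm : 1 ≤ N.m) (hk : 2 * N.m < 2 ^ k) (hc : Core N σ)
    (hQ : QueueOk N σ) (hR : RangesOk N σ) :
    Ter mainLoop σ ((k + 1) * N.pot (σ.iarr 10) (σ.iarr 11) + 1) (Solved N) := by
  have h1 : 1 ≤ k + 1 := by omega
  have hroot : ∀ τ, QueueOk N τ → τ.iarr 12 1 < N.m ∧
      ∀ j < N.m, queue.key τ (τ.iarr 12 1) ≤ queue.key τ j := by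
    intro τ hq
    obtain ⟨i, hi, he, -⟩ := hq.exists_leaf (j := 1) le_rfl (by omega)
    exact ⟨he ▸ hi, fun j hj => hq.root_le hj⟩
  have hqueue : ∀ τ, queueTest.holds τ ↔ τ.iarr 10 (τ.iarr 12 1) ≤ 1 := by
    intro τ; simp only [queueTest, Test.holds, IExp.eval]; omega
  refine Ter.loop (fun n τ => Core N τ ∧ QueueOk N τ ∧ RangesOk N τ ∧
    (k + 1) * N.pot (τ.iarr 10) (τ.iarr 11) ≤ n) ?_ ?_ ⟨hc, hQ, hR, le_rfl⟩ le_rfl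
  · rintro n τ ⟨hc, hQ, hR, hn⟩ hb
    suffices step : Ter (.cond activeTest relaxArc (block [.setI 10 (.load 12 (.const 1)),
        .cond (.ieq (.load 10 (.reg 10)) (.const 0)) openArc settleArc])) τ (k + 1)
        fun ρ => Core N ρ ∧ QueueOk N ρ ∧ RangesOk N ρ ∧
          N.pot (ρ.iarr 10) (ρ.iarr 11) + 1 ≤ N.pot (τ.iarr 10) (τ.iarr 11) by
      -- The step lowers a natural number by one, so that number was positive.
      have hpos : 1 ≤ N.pot (τ.iarr 10) (τ.iarr 11) := by
        obtain ⟨_, _, -, -, -, -, -, h⟩ := step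
        omega
      obtain ⟨w, hw⟩ := Nat.exists_eq_add_of_le' hpos
      rw [hw, mul_add, mul_one] at hn
      refine ⟨(k + 1) * w, k + 1, h1, hn, step.mono le_rfl ?_⟩
      rintro ρ ⟨a, b, c, d⟩
      exact ⟨a, b, c, Nat.mul_le_mul_left _ (by omega)⟩
    refine Ter.cond h1 (relaxArc_ter hk hc hQ hR) (fun ha => ?_)
    rw [Test.or_holds, hqueue] at hb
    have hx1 := hb.resolve_left ha
    obtain ⟨hxm, hmin⟩ := hroot τ hQ
    refine Ter.cons (Ter.setI h1 (Ter.cons ?_))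
    simp only [IExp.eval]
    generalize τ.iarr 12 1 = x at *
    have hmin' : ∀ j < N.m, τ.iarr 10 j ≤ 1 → N.time x < N.time j ∨ N.time x = N.time j ∧
        (τ.iarr 10 x < τ.iarr 10 j ∨ τ.iarr 10 x = τ.iarr 10 j ∧ τ.narr 6 x ≤ τ.narr 6 j) := by
      intro j hj hj1
      have := hmin j hj
      rw [queue_key, queue_key, show τ.iarr 10 x / 2 = 0 by omega,
        show τ.iarr 10 j / 2 = 0 by omega, hc.pres.time] at this
      simpa [cons_le_cons_iff_rat, ← le_iff_lt_or_eq] using this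
    have ha' : ¬ activeTest.holds (τ.setI 10 x) := by
      simpa [activeTest, Test.holds, IExp.eval, NExp.eval] using ha
    have hs : ∀ r, r ≠ 10 → (τ.setI 10 x).ireg r = τ.ireg r := fun r hr => by
      rw [State.setI_ireg, if_neg hr]
    have hc' : Core N (τ.setI 10 x) := by
      constructor
      · exact hc.pres.congr (fun r hr => hs r (by omega)) rfl rfl (fun _ _ => rfl) rfl
      · exact hc.dep
      · exact hc.arr
      · rw [hs 12 (by omega), hs 11 (by omega)]; exact hc.inv
      · exact hc.out
      · exact hc.offset
    have fin : ∀ ρ, (Core N ρ ∧ QueueOk N ρ ∧ RangesOk N ρ ∧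
        N.pot (ρ.iarr 10) (ρ.iarr 11) + 1 ≤ N.pot (τ.iarr 10) (τ.iarr 11)) →
        Ter (block []) ρ (k + 1) fun ρ => Core N ρ ∧ QueueOk N ρ ∧ RangesOk N ρ ∧
          N.pot (ρ.iarr 10) (ρ.iarr 11) + 1 ≤ N.pot (τ.iarr 10) (τ.iarr 11) :=
      fun ρ h => Ter.nil h1 h
    refine Ter.cond h1 (fun h0 => ?_) (fun h0 => ?_)
    · simp only [Test.holds, IExp.eval, State.setI_ireg, State.setI_iarr, if_true] at h0
      refine (openArc_ter (x := x) hk hc' hQ hR ha' (by simp) hxm h0 ?_).mono le_rfl fin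
      intro j hj hj1
      rcases hmin' j hj hj1 with h | h
      · exact h.le
      · exact h.1.le
    · simp only [Test.holds, IExp.eval, State.setI_ireg, State.setI_iarr, if_true] at h0
      refine (settleArc_ter (x := x) hk hc' hQ hR ha' (by simp) hxm ?_ ?_).mono le_rfl fin
      · simp only [State.setI_iarr]; omega
      intro j hj hj1
      simp only [State.setI_iarr, State.setI_narr] at hj1 ⊢
      -- Untouched arcs precede labelled ones of the same time in the queue; as a labelled arc won,
      -- none of them is left at this time.
      rcases hmin' j hj hj1 with h | ⟨h, h' | h'⟩
      · exact .inl h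
      · omega
      · exact .inr ⟨h, by omega, h'.2⟩
  · rintro n τ ⟨hc, hQ, hR, -⟩ hb
    rw [Test.or_holds, not_or, activeTest_holds hc.pres, hqueue] at hb
    have hinv := hc.inv.inactive hc.dep hb.1
    obtain ⟨h2, h3⟩ := hinv.final fun i hi => by
      have := (hroot τ hQ).2 i hi
      rw [queue_key, queue_key, cons_le_cons_iff_rat] at this
      have h4 : τ.iarr 10 (τ.iarr 12 1) / 2 ≤ τ.iarr 10 i / 2 := by
        rcases this with h | h
        · exact_mod_cast h.le
        · exact_mod_cast h.1.le
      omega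
    exact ⟨_, _, h2, h3, hinv.reach, hc.out⟩

end RAM

/-! ### The whole program -/

namespace RAM

variable {N : Network} {σ : State}

theorem Presents.sameBut3 {τ : State} (h : Presents N σ) {a b c : ℕ} (ha : 2 ≤ a) (hb : 2 ≤ b)
    (hc : 2 ≤ c) (hs : SameBut3 a b c σ τ) : Presents N τ :=
  h.congr (fun r hr => hs.ireg r (by omega)) (hs.iarr 0 (by omega) (by omega) (by omega))
    (hs.iarr 1 (by omega) (by omega) (by omega)) (fun b _ => by rw [hs.narr]) hs.nreg

theorem optWalks_ter {k : ℕ} (hk : 2 * N.m < 2 ^ k) (hp : Presents N σ)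
    (h0 : ∀ a, 2 ≤ a → σ.iarr a = fun _ => 0) :
    Ter optWalks σ ((k + 1) * (3 * N.m) + 1) (Solved N) := by
  set K := (k + 1) * (3 * N.m) + 1 with hK
  have hK1 : 1 ≤ K := by omega
  -- Without arcs the trees would have no root; but then the zero memory already holds only null
  -- pointers.
  refine Ter.cond hK1 (fun h => Ter.skip hK1 ?_) (fun h => ?_)
  · simp only [Test.holds, IExp.eval, hp.m] at h
    refine ⟨fun _ => 0, fun _ => 0, ?_, ?_, ?_, fun v => .inl ⟨by rw [h0 2 le_rfl], ?_⟩⟩ <;>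
      simp [h]
  simp only [Test.holds, IExp.eval, hp.m] at h
  have hsort : (N.m + 1) * (k + 1) ≤ K := by
    have : (N.m + 1) * (k + 1) ≤ (3 * N.m) * (k + 1) := Nat.mul_le_mul_right _ (by omega)
    rw [hK, mul_comm (k + 1)]; omega
  have hbuild : N.m + 1 ≤ K := (Nat.le_mul_of_pos_right _ (by omega)).trans hsort
  refine Ter.cons ((depSorter.sort_ter (k := k) (key := N.depKey) hp.m hk (by decide) (by decide)
    (by decide) (fun i => by rw [h0 5 (by omega)]) ?_).mono hsort ?_)
  · intro τ hs i
    have hτ := hp.sameBut3 (a := 8) (by omega) (by omega) (by omega) hs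
    rw [Network.depKey, ← hτ.src, ← hτ.time]
    rfl
  rintro σ₁ ⟨hs₁, hdep⟩
  change SameBut3 8 4 5 σ σ₁ at hs₁
  have hp₁ := hp.sameBut3 (by omega) (by omega) (by omega) hs₁
  refine Ter.cons ((arrSorter.sort_ter (k := k) (key := N.arrKey) hp₁.m hk (by decide) (by decide)
    (by decide) (fun i => by rw [hs₁.iarr 7 (by omega) (by omega) (by omega), h0 7 (by omega)])
    ?_).mono hsort ?_)
  · intro τ hs i
    have hτ := hp₁.sameBut3 (a := 9) (by omega) (by omega) (by omega) hs
    rw [Network.arrKey, Network.arr, ← hτ.dst, ← hτ.time, ← hτ.trans]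
    rfl
  rintro σ₂ ⟨hs₂, harr⟩
  change SameBut3 9 6 7 σ₁ σ₂ at hs₂
  have hp₂ := hp₁.sameBut3 (by omega) (by omega) (by omega) hs₂
  refine Ter.cons ((queue.build_ter (leaf := id) hp₂.m ?_).mono hbuild ?_)
  · intro τ _ _; rfl
  rintro σ₃ ⟨hs₃, hq₃⟩
  change SameBut 12 σ₂ σ₃ at hs₃
  have hp₃ := hp₂.sameBut (by omega) hs₃
  refine Ter.cons ((ranges.build_ter (leaf := σ₃.iarr 6) hp₃.m ?_).mono hbuild ?_)
  · intro τ hs _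
    rw [IExp.eval, IExp.eval, hs.iarr 6 (by decide)]
  rintro σ₄ ⟨hs₄, hr₄⟩
  change SameBut 13 σ₃ σ₄ at hs₄
  have hp₄ := hp₃.sameBut (by omega) hs₄
  have hq₄ : QueueOk N σ₄ := QueueOk.sameBut (σ := σ₃) hq₃ hs₄
  have hr₄' : RangesOk N σ₄ := by
    rw [RangesOk, hs₄.iarr 6 (by omega)]; exact hr₄
  have hi : ∀ a, a < 12 → a ≠ 9 → a ≠ 6 → a ≠ 7 → σ₄.iarr a = σ₁.iarr a := fun a h h1 h2 h3 => by
    rw [hs₄.iarr a (by omega), hs₃.iarr a (by omega), hs₂.iarr a h1 h2 h3]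
  have hi0 : ∀ a, 2 ≤ a → a < 4 ∨ a = 10 ∨ a = 11 → σ₄.iarr a = fun _ => 0 := fun a h1 h2 => by
    rw [hi a (by omega) (by omega) (by omega) (by omega),
      hs₁.iarr a (by omega) (by omega) (by omega), h0 a h1]
  refine Ter.cons (Ter.setI hK1 (Ter.cons ?_))
  simp only [IExp.eval, hp₄.m]
  have hcore : Core N (σ₄.setI 11 N.m) := by
    constructor
    · exact hp₄.congr (fun r hr => by rw [State.setI_ireg, if_neg (by omega)]) rfl rfl
        (fun _ _ => rfl) rfl
    · simp only [State.setI_iarr]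
      rw [hi 4 (by omega) (by omega) (by omega) (by omega),
        hi 5 (by omega) (by omega) (by omega) (by omega)]
      exact hdep
    · simp only [State.setI_iarr]
      rw [hs₄.iarr 6 (by omega), hs₄.iarr 7 (by omega), hs₃.iarr 6 (by omega),
        hs₃.iarr 7 (by omega)]
      exact harr
    · simp only [State.setI_iarr, State.setI_ireg, if_true]
      rw [hi0 10 (by omega) (by omega), hi0 11 (by omega) (by omega), hi0 3 (by omega) (by omega)]
      exact Network.Inv.initial N _ _ _
    · simp only [State.setI_iarr]
      rw [hi0 10 (by omega) (by omega), hi0 2 (by omega) (by omega)]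
      intro v
      exact .inl ⟨rfl, by simp⟩
    · simp only [State.setI_iarr]
      rw [hi0 10 (by omega) (by omega)]
      simp
  refine (mainLoop_ter (k := k) (by omega) hk hcore hq₄ hr₄').mono ?_
    (fun τ hτ => Ter.nil hK1 hτ)
  simp only [State.setI_iarr]
  rw [hi0 10 (by omega) (by omega), hi0 11 (by omega) (by omega), hK]
  -- Initially each arc contributes two for its status, to be opened and settled, and one for its
  -- relaxation.
  simp only [Network.pot, if_true, Finset.sum_const, Finset.card_range, smul_eq_mul]
  rw [show N.m * 2 + N.m * 1 = 3 * N.m by omega]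

end RAM

/-! ## Walks and labels -/

namespace TemporalGraph

variable {V : Type*} {G : TemporalGraph V}

theorem waiting_concat (P : List G.E) {e : G.E} (f : G.E) (h : P.getLast? = some e) :
    waiting (P ++ [f]) = waiting P + ((f.1.time : ℚ) - (e.1.time + e.1.trans)) := by
  induction P with
  | nil => simp at h
  | cons a P ih =>
    cases P with
    | nil =>
      simp at h
      subst h
      simp [waiting]
    | cons b P =>
      have := ih (by simpa using h)
      simp only [waiting, List.cons_append, List.tail_cons, List.zipWith_cons_cons,
        List.sum_cons] at this ⊢
      rw [this]; ring

/-- The departure time is inherited from `P`, so the increment depends on the last arc `e` and the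
new arc `f` alone; this is the basis of the recursion for labels. -/
theorem val_concat (c : G.E → ℕ) (δ : Fin 7 → ℚ≥0) (P : List G.E) {e : G.E} (f : G.E)
    (h : P.getLast? = some e) :
    val c δ (P ++ [f]) = val c δ P
      + (δ 0 + δ 2) * ((f.1.time : ℚ) + f.1.trans - (e.1.time + e.1.trans))
      + δ 3 * f.1.trans + δ 4 * c f + δ 5
      + δ 6 * ((f.1.time : ℚ) - (e.1.time + e.1.trans)) := by
  have hd : departure (P ++ [f]) = departure P := by
    cases P with
    | nil => simp at h
    | cons a P => simp [departure]
  have ha : arrival P = (e.1.time : ℚ) + e.1.trans := by simp [arrival, h]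
  have ha' : arrival (P ++ [f]) = (f.1.time : ℚ) + f.1.trans := by simp [arrival]
  have ht : transmission (P ++ [f]) = transmission P + f.1.trans := by simp [transmission]
  have hc : totalCost c (P ++ [f]) = totalCost c P + c f := by simp [totalCost]
  have hl : ((P ++ [f]).length : ℚ) = P.length + 1 := by simp
  simp only [val, hd, ha, ha', ht, hc, hl, waiting_concat P f h]
  ring

theorem val_singleton (c : G.E → ℕ) (δ : Fin 7 → ℚ≥0) (f : G.E) :
    val c δ [f] = δ 0 * ((f.1.time : ℚ) + f.1.trans) - δ 1 * f.1.time + δ 2 * f.1.trans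
      + δ 3 * f.1.trans + δ 4 * c f + δ 5 := by
  simp [val, arrival, departure, transmission, totalCost, waiting]
  ring

end TemporalGraph

/-! ### From labels and pointers to optimal walks -/

namespace OptWalks

open TemporalGraph

theorem padded_nonneg {k : ℕ} {f : Fin k → ℚ} (h : ∀ i, 0 ≤ f i) (i : ℕ) : 0 ≤ padded f i := by
  unfold padded; split
  · exact h _
  · exact le_rfl

@[simp] theorem padded_val {R : Type*} [Zero R] {k : ℕ} (f : Fin k → R) (i : Fin k) :
    padded f i = f i := by
  simp [padded]

variable {n : ℕ} (G : TemporalGraph (Fin n)) (num : Fin G.E.card ≃ G.E) (c : G.E → ℕ)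
  (δ : Fin 7 → ℚ≥0) (s : Fin n)

/-- The input in the form used for the verification of the program. -/
def network : Network where
  m := G.E.card
  source := s
  src := padded fun i => ((num i).1.src : ℕ)
  dst := padded fun i => ((num i).1.dst : ℕ)
  time := padded fun i => ((num i).1.time : ℚ)
  trans := padded fun i => ((num i).1.trans : ℚ)
  cost := padded fun i => (c (num i) : ℚ)
  α := padded fun v => (G.α v : ℚ)
  β := padded fun v => (G.β v : ℚ)
  δ := padded fun j => (δ j : ℚ)
  trans_nonneg := padded_nonneg fun _ => Nat.cast_nonneg _
  cost_nonneg := padded_nonneg fun _ => Nat.cast_nonneg _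
  α_nonneg := padded_nonneg fun _ => Nat.cast_nonneg _
  β_nonneg := padded_nonneg fun _ => Nat.cast_nonneg _
  δ_nonneg := padded_nonneg fun _ => NNRat.coe_nonneg _

theorem network_presents : RAM.Presents (network G num c δ s) (input G num c δ s) := by
  constructor <;> first | rfl | intro _ _; rfl

variable {G num c δ s}

theorem network_fol (i j : Fin G.E.card) :
    (network G num c δ s).Fol i j ↔ G.Follows (num i) (num j) := by
  simp only [Network.Fol, Network.arr, network, padded_val, Follows, Fin.val_inj]
  refine and_congr_right fun _ => ?_
  norm_cast

theorem network_start (i : Fin G.E.card) :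
    (network G num c δ s).start i = val c δ [num i] := by
  have e : ∀ j : Fin 7, (network G num c δ s).δ j = δ j := fun j => by
    simp only [network, padded_val]
  have e0 := e 0; have e1 := e 1; have e2 := e 2; have e3 := e 3; have e4 := e 4; have e5 := e 5
  norm_num at e0 e1 e2 e3 e4 e5
  rw [val_singleton, Network.start, e0, e1, e2, e3, e4, e5]
  simp only [Network.arr, network, padded_val]

theorem network_append (P : List G.E) (i j : Fin G.E.card) (h : P.getLast? = some (num i)) :
    (network G num c δ s).append (val c δ P) i j = val c δ (P ++ [num j]) := by
  have e : ∀ j : Fin 7, (network G num c δ s).δ j = δ j := fun j => by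
    simp only [network, padded_val]
  have e0 := e 0; have e2 := e 2; have e3 := e 3; have e4 := e 4; have e5 := e 5; have e6 := e 6
  norm_num at e0 e2 e3 e4 e5 e6
  rw [val_concat c δ P _ h, Network.append, Network.rate, Network.base, e0, e2, e3, e4, e5, e6]
  simp only [Network.arr, network, padded_val]
  ring

/-- Labels are attained: induction along the pointer chain. The last arc is carried along because
both the chain condition and the increment of the value refer to it. -/
theorem exists_walk_of_reach {st pred : ℕ → ℕ} {D : ℕ → ℚ} {i : ℕ}
    (h : (network G num c δ s).Reach st pred D i) :
    ∃ (hi : i < G.E.card) (P : List G.E), ReadOff num pred (i + 1) P ∧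
      G.IsWalk s (num ⟨i, hi⟩).1.dst P ∧ P.getLast? = some (num ⟨i, hi⟩) ∧ val c δ P = D i := by
  induction h with
  | start i hi _ hs hp hD =>
    refine ⟨hi, [num ⟨i, hi⟩], .arc ⟨i, hi⟩ [] (by rw [hp]; exact .null), ⟨?_, rfl, ?_⟩, rfl, ?_⟩
    · have e := padded_val (fun i => ((num i).1.src : ℕ)) ⟨i, hi⟩
      have : ((num ⟨i, hi⟩).1.src : ℕ) = s := e.symm.trans hs
      simpa using Fin.ext this
    · exact List.isChain_singleton _
    · rw [hD, ← network_start ⟨i, hi⟩]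
  | step e i hi _ _ hf hp hD ih =>
    obtain ⟨he, P, hR, ⟨h1, h2, h3⟩, hl, hv⟩ := ih
    refine ⟨hi, P ++ [num ⟨i, hi⟩], .arc ⟨i, hi⟩ P (by rw [hp]; exact hR), ⟨?_, by simp, ?_⟩,
      by simp, ?_⟩
    · cases P with
      | nil => simp at hl
      | cons a P => simpa using h1
    · rw [List.isChain_append]
      refine ⟨h3, List.isChain_singleton _, ?_⟩
      rintro x hx y hy
      rw [hl] at hx
      simp at hx hy
      subst hx hy
      exact (network_fol ⟨e, he⟩ ⟨i, hi⟩).1 hf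
    · rw [hD, ← hv]
      exact (network_append P ⟨e, he⟩ ⟨i, hi⟩ hl).symm

/-- Labels are lower bounds: induction on the walk, removing the last arc. The inequality for that
arc combines with the induction hypothesis because `append` is monotone in the value of the prefix.
-/
theorem label_le_val {st : ℕ → ℕ} {D : ℕ → ℚ}
    (h1 : ∀ f < (network G num c δ s).m, (network G num c δ s).src f = (network G num c δ s).source →
      st f = 3 ∧ D f ≤ (network G num c δ s).start f)
    (h2 : ∀ e < (network G num c δ s).m, st e = 3 → ∀ f < (network G num c δ s).m,
      (network G num c δ s).Fol e f → st f = 3 ∧ D f ≤ (network G num c δ s).append (D e) e f)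
    (P : List G.E) : P.head?.map (fun e => e.1.src) = some s → P.IsChain G.Follows →
      ∀ i, P.getLast? = some (num i) → st i = 3 ∧ D i ≤ val c δ P := by
  induction P using List.reverseRecOn with
  | nil => intro _ _ i hi; simp at hi
  | append_singleton P f ih =>
    intro hh hc i hi
    simp at hi
    subst hi
    rcases P.eq_nil_or_concat with rfl | ⟨Q, e, rfl⟩
    · simp at hh
      have := h1 i i.2 (by simp [network, hh])
      rwa [network_start] at this
    · obtain ⟨j, rfl⟩ := num.surjective e
      rw [List.concat_eq_append] at *
      rw [List.isChain_append] at hc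
      have hl : (Q ++ [num j]).getLast? = some (num j) := by simp
      obtain ⟨a, b⟩ := ih (by cases Q <;> simpa using hh) hc.1 j hl
      have hf : G.Follows (num j) (num i) := hc.2.2 _ (by simp) _ (by simp)
      obtain ⟨d, e⟩ := h2 j j.2 a i i.2 ((network_fol j i).2 hf)
      refine ⟨d, e.trans ?_⟩
      rw [← network_append (s := s) _ j i hl]
      exact add_le_add (sub_le_sub b le_rfl) le_rfl

theorem isSolution_of_solved {τ : RAM.State} (h : RAM.Solved (network G num c δ s) τ) :
    IsSolution G num c δ s τ := by
  obtain ⟨st, D, h1, h2, h3, h4⟩ := h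
  have hdst : ∀ i : Fin G.E.card, (network G num c δ s).dst i = ((num i).1.dst : ℕ) := fun i => by
    simp only [network, padded_val]
  have hwalk : ∀ v P, G.IsWalk s v P →
      ∃ i : Fin G.E.card, st i = 3 ∧ (num i).1.dst = v ∧ D i ≤ val c δ P := by
    rintro v P ⟨a, b, d⟩
    obtain ⟨e, he, hv⟩ := Option.map_eq_some_iff.1 b
    obtain ⟨i, rfl⟩ := num.surjective e
    obtain ⟨f, g⟩ := label_le_val h1 h2 P a d i he
    exact ⟨i, f, hv, g⟩
  intro v
  rcases h4 v with ⟨a, b⟩ | ⟨e, he, he3, hev, ho, hval, hmin⟩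
  · refine ⟨fun _ => a, ?_⟩
    rintro ⟨P, hP⟩
    obtain ⟨i, f, hv, -⟩ := hwalk v P hP
    exact absurd (by rw [hdst, hv]) (b i i.2 f)
  · obtain ⟨hi, P, hR, hP, -, hD⟩ := exists_walk_of_reach (h3 e he he3)
    have hv : (num ⟨e, hi⟩).1.dst = v := Fin.ext ((hdst ⟨e, hi⟩).symm.trans hev)
    rw [hv] at hP
    refine ⟨fun h => absurd ⟨P, hP⟩ h, fun _ => ⟨P, by rw [ho]; exact hR, ⟨hP, ?_⟩, ?_⟩⟩
    · intro Q hQ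
      obtain ⟨i, f, hv, g⟩ := hwalk v Q hQ
      rw [hD]
      exact (hmin i i.2 f (by rw [hdst, hv])).trans g
    · rw [hval, hD]

end OptWalks

/-! ### The time bound in terms of the natural logarithm -/

theorem log_two_le_two_mul_log {m : ℕ} (hm : 1 ≤ m) : (Nat.log 2 m : ℝ) ≤ 2 * Real.log m := by
  have h1 : (2 : ℝ) ^ Nat.log 2 m ≤ m := by exact_mod_cast Nat.pow_log_le_self 2 (by omega)
  have h2 := Real.log_le_log (by positivity) h1
  rw [Real.log_pow] at h2
  have h3 := Real.log_two_gt_d9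
  nlinarith [(Nat.cast_nonneg (Nat.log 2 m) : (0 : ℝ) ≤ _)]

/-- For `m ≥ 2` the natural logarithm is at least `1 / 2`, so `2 * log m + 3 ≤ 8 * log m`, and three
steps per arc give `24`. The additive `1`, and everything when `m ≤ 1` makes the logarithmic term
vanish, is charged to `n`. -/
theorem cost_le_linear_add_mul_log {n m : ℕ} (hn : 1 ≤ n) :
    ((Nat.log 2 m + 2 + 1) * (3 * m) + 1 : ℝ) ≤ 24 * (n + m * Real.log m) := by
  have hn : (1 : ℝ) ≤ n := by exact_mod_cast hn
  rcases Nat.lt_or_ge m 2 with h2 | h2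
  · interval_cases m <;> norm_num <;> linarith
  · have hl := log_two_le_two_mul_log (m := m) (by omega)
    have hm2 : (2 : ℝ) ≤ m := by exact_mod_cast h2
    have hlog : (1 / 2 : ℝ) ≤ Real.log m := by
      have := Real.log_le_log (by norm_num) hm2
      linarith [Real.log_two_gt_d9]
    have : (Nat.log 2 m + 2 + 1) * (3 * (m : ℝ)) ≤ (8 * Real.log m) * (3 * m) :=
      mul_le_mul_of_nonneg_right (by linarith) (by positivity)
    nlinarith

theorem theorem1 :
    ∃ (p : RAM.Prog) (C : ℝ),
      ∀ (n : ℕ) (G : TemporalGraph (Fin n)) (num : Fin G.E.card ≃ G.E) (c : G.E → ℕ)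
        (δ : Fin 7 → ℚ≥0) (s : Fin n),
        ∃ (k : ℕ) (τ : RAM.State),
          RAM.Runs p (OptWalks.input G num c δ s) k τ ∧
          OptWalks.IsSolution G num c δ s τ ∧
          (k : ℝ) ≤ C * ((n : ℝ) + (G.E.card : ℝ) * Real.log (G.E.card : ℝ)) := by
  refine ⟨RAM.optWalks, RAM.optWalks.weight * 24, fun n G num c δ s => ?_⟩
  -- Tree nodes are numbered below `2 * m`, which costs one binary digit more than `m`.
  have hk : 2 * (OptWalks.network G num c δ s).m < 2 ^ (Nat.log 2 G.E.card + 2) := by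
    have := Nat.lt_pow_succ_log_self (b := 2) (by omega) G.E.card
    rw [pow_succ]
    change 2 * G.E.card < _
    omega
  obtain ⟨k, τ, hr, hc, hs⟩ := RAM.optWalks_ter hk (OptWalks.network_presents G num c δ s) (by
    intro a ha
    obtain ⟨b, rfl⟩ := Nat.exists_eq_add_of_le' ha
    rfl)
  refine ⟨k, τ, hr, OptWalks.isSolution_of_solved hs, ?_⟩
  have hc' : (k : ℝ) ≤ RAM.optWalks.weight *
      ((Nat.log 2 G.E.card + 2 + 1) * (3 * G.E.card) + 1) := by
    exact_mod_cast hc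
  rw [mul_assoc]
  -- The existence of a source vertex guarantees `n ≥ 1`.
  exact hc'.trans (mul_le_mul_of_nonneg_left (cost_le_linear_add_mul_log s.pos)
    (Nat.cast_nonneg _))
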